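/- **Arithmetic.** Let $|n|$ be the length of the binary expansion of $n\in\mathbb N$ ($|0|=0$) and $[n]=\{0,\dots,n-1\}$. Fix a polynomial time coding $\langle n_0,\dots,n_{k-1}\rangle$ of finite sequences of natural numbers by natural numbers, with entries $(n)_i$ ($(n)_i=0$ if there is no such entry): the base-$4$ digits of the code, least significant first, are the binary digits of the entries, each entry followed by the digit $2$, with leading digit $3$. The language $\mathsf{PV}$ has the relation symbol $<$ and a function symbol for every polynomial time Turing machine; $\mathsf{PV}(\alpha)$ has in addition a unary relation symbol $\alpha$ and a function symbol for every polynomial time oracle Turing machine (one polynomial bounding the time for all oracles). $\mathbb N$ is the standard $\mathsf{PV}$-structure; for $A\subseteq\mathbb N$, $\langle\mathbb N,A\rangle$ is the $\mathsf{PV}(\alpha)$-structure interpreting $\alpha$ by $A$ and the function symbols by the functions computed with oracle $A$. We write $\langle N,\alpha^N\rangle$ for a $\mathsf{PV}(\alpha)$-structure with $\mathsf{PV}$-reduct $N$. $\forall\mathsf{PV}(\alpha)$ is the set of universal $\mathsf{PV}(\alpha)$-sentences true in $\langle\mathbb N,A\rangle$ for all $A\subseteq\mathbb N$. Sharply bounded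 $\mathsf{PV}(\alpha)$-formulas are built from atomic ones by Boolean connectives and quantifiers $\exists x<|t|$, $\forall x<|t|$; $\Sigma^b_1(\mathsf{PV}(\alpha))$ is their closure under $\wedge,\vee$, sharply bounded quantifiers and $\exists x<t$ (here $t$ is a $\mathsf{PV}$-term not containing $x$). The theory $\forall\mathsf T^1_2(\mathsf{PV}(\alpha))$ is $\forall\mathsf{PV}(\alpha)$ together with the universal closures of $\varphi(x,\bar x)\to\exists y\le x\,(\varphi(y,\bar x)\wedge\forall z<y\,\neg\varphi(z,\bar x))$ for all $\varphi\in\Sigma^b_1(\mathsf{PV}(\alpha))$. **Principles.** Let $L$ be a finite language disjoint from $\mathsf{PV}$, its symbols identified with distinct natural numbers. A *basic $L$-sentence with built-in $\mathsf{PV}$* is a sentence $\varphi=\exists\bar y\,\bigvee_{i\in I}\bigwedge_{j\in J}\lambda_{ij}$ with $I,J$ finite and nonempty, where each $\lambda_{ij}$ is of the form $R(\bar u)$, $\neg R(\bar u)$, $f(\bar u)=v$, $u=v$ or $\neg u=v$, with $R,f$ symbols from $L\cup\mathsf{PV}$ and $\bar u,u,v$ variables. It is *without built-in symbols* if no $\mathsf{PV}$-symbol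 occurs. In $L$-structures with universe $[n]$, where $n\ne 0$ is an element of a $\mathsf{PV}$-structure $N$ and $[n]=\{a\in N: a<n\}$, the built-in atoms are evaluated in $N$ (with $N=\mathbb N$ unless said otherwise), $f(\bar u)=v$ being read as membership of $(\bar u,v)$ in the graph of $f$. A *finitary combinatorial principle* in $L$ is a basic $L$-sentence with built-in $\mathsf{PV}$ that is true in all $L$-structures with universe $[n]$, $n\in\mathbb N\setminus\{0\}$. In a *partial $L$-structure* the function and relation symbols may be undefined at some arguments. Its *size* is the number of pairs $(S,\bar a)$, $S\in L$, such that $S$ is defined at $\bar a$; $s_L(n)$ is the size of a total $L$-structure on $n$ elements. A partial $L$-structure *verifies* $\varphi$ if for some assignment and some $i\in I$ all $\lambda_{ij}$, $j\in J$, hold with all the values of symbols involved defined; when the universe is $[n]$, built-in symbols are evaluated in $\mathbb N$, a function value outside $[n]$ counting as undefined. A *partial substructure* of a structure arises by restricting the universe to a nonempty subset and making some values undefined (in particular all function values outside that subset); it is *induced* if no other values are made undefined. An *embedding* is an isomorphism onto a partial substructure. The *determinacy* $d(n)$ of $\varphi$ is the least $m$ such that every partial $L$-structure with universe $[n]$ and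 size at least $m$ verifies $\varphi$. A principle $\varphi$ is *weak* if there is $\varepsilon>0$ with $s_L(n)\ge n^{\varepsilon}\, d(n)$ for all sufficiently large $n$. Let $B$ be an infinite $L$-structure and $g$ a function on the positive integers with values in $\mathbb N$. An induced partial substructure with finite universe $B_0$ is *$g$-large* if there is $V\subseteq B\setminus B_0$ with $|V|\le g(|B_0|)$ such that every function symbol of $L$ maps tuples from $B_0$ into $B_0\cup V$. $B$ is *$g$-large* if every finite partial substructure of $B$ embeds into a $g$-large induced partial substructure with a universe of the same cardinality. A basic $L$-sentence without built-in symbols is *strong* if its negation has an infinite $g$-large model for some $g$ with $g(n)\le n^{o(1)}$. **Coded structures and search problems.** Let $\langle N,\alpha^N\rangle\models\forall\mathsf T^1_2(\mathsf{PV}(\alpha))$, $n\in N\setminus\{0\}$, and let $X\subseteq N$ be $\alpha^N$ or of the form $f_{\bar a}^{-1}(0)=\{u\in N: f(u,\bar a)=0\}$ with $f(u,\bar z)\in\mathsf{PV}(\alpha)$ and $\bar a$ from $N$. Then $\mathfrak B(L,n,X)$ is the $L$-structure with universe $[n]$ in which a relation symbol $R$ holds of $\bar a$ iff $\langle R,\bar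 a\rangle\in X$, and a function symbol $S$ maps $\bar a$ to $\min\{c,n-1\}$, where $c$ is the number of length at most $|n|$ such that for all $i<|n|$ the $i$-th bit of $c$ is $1$ iff $\langle S,\bar a,i\rangle\in X$. For a finitary combinatorial principle $\varphi=\exists y_0\cdots y_{k-1}\psi$ in $L$, the search problem $Q_\varphi(x,y)$ is the formula $$0<x\to\textstyle\bigwedge_{j<k}(y)_j<x\wedge\psi'((y)_0,\dots,(y)_{k-1}),$$ where $\psi'$ is obtained from $\psi$ by replacing $L$-atoms by sharply bounded formulas in $x$ and $\alpha$ that express their truth in $\mathfrak B(L,x,\alpha)$. Write $Q_\varphi(x,y)[\alpha/f_{\bar z}^{-1}(0)]$ for the result of replacing atoms $\alpha(t)$ by $f(t,\bar z)=0$. For a theory $\mathsf T$, $Q_\varphi$ is a *consequence* of $Q_{\tilde\varphi}$ over $\mathsf T$ if $\mathsf T$ together with all sentences $\forall x\forall\bar z\exists y\,Q_{\tilde\varphi}(x,y)[\alpha/f_{\bar z}^{-1}(0)]$, $f(u,\bar z)\in\mathsf{PV}(\alpha)$, proves $\exists y\,Q_\varphi(x,y)$; otherwise $Q_\varphi$ is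 *independent* from $Q_{\tilde\varphi}$ over $\mathsf T$. **Cuts.** A function $h:\mathbb N\to\mathbb N$ is *subexponential* if $h(n)\le 2^{n^{o(1)}}$. A *$\mathsf{PV}$-cut* of a $\mathsf{PV}$-structure $M$ is a substructure that is an initial segment with respect to $<$. A $\mathsf{PV}$-cut $N$ of an elementary extension $M$ of $\mathbb N$ is *subexponential in $n$* if $h^M(n)\in N$ for every subexponential function $h$ definable in the $\mathsf{PV}$-structure $\mathbb N$, where $h^M$ is defined in $M$ by a formula that defines $h$ in $\mathbb N$. **Theorem.** Let $L,\tilde L$ be finite languages, let $\varphi$ be a strong basic $L$-sentence without built-in symbols, and let $\tilde\varphi$ be a weak finitary combinatorial principle in $\tilde L$ (possibly with built-in $\mathsf{PV}$). 1. There are a model $\langle N,\alpha^N\rangle$ of $\forall\mathsf T^1_2(\mathsf{PV}(\alpha))$ and $n\in N\setminus\{0\}$ such that (a) $\mathfrak B(L,n,\alpha^N)\not\models\varphi$, and (b) $\mathfrak B(\tilde L,m,f_{\bar a}^{-1}(0))\models\tilde\varphi$ for all $m\in N\setminus\{0\}$, all function symbols $f(u,\bar z)$ of $\mathsf{PV}(\alpha)$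 and all tuples $\bar a$ from $N$. 2. Moreover, for every $\mathsf{PV}$-formula $\psi(x)$ that defines an unbounded set in $\mathbb N$, $\langle N,\alpha^N\rangle$ and $n$ in 1 can be chosen such that $N$ is a $\mathsf{PV}$-cut of an elementary extension $M$ of $\mathbb N$, $N$ is subexponential in $n$, and $M\models\psi(n)$. 3. If moreover $\varphi$ is a finitary combinatorial principle, then $Q_\varphi$ is independent from $Q_{\tilde\varphi}$ over $\forall\mathsf T^1_2(\mathsf{PV}(\alpha))$. -/

import Mathlib

open FirstOrder FirstOrder.Language

/-! ## Oracle Turing machines and polynomial time -/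

/-- The number whose binary digits (least significant first) are written on the tape from the head
up to the first blank cell to the right. The tape symbols are `none` (blank), `0` and `1`. -/
noncomputable def readNat (T : Turing.Tape (Option Bool)) : ℕ :=
  ∑ i ∈ Finset.range (sInf {i : ℕ | T.nth i = none}), if T.nth i = some true then 2 ^ i else 0

/-- A deterministic multi-tape oracle Turing machine with `r` inputs. The tapes are `r` input tapes
and `work + 2` further tapes; among the latter, tape `0` is the output tape and tape `1` is the
query tape. In one step the machine reads all heads, changes its state, writes a symbol on every
tape and moves every head by at most one cell. In the state `query` it goes to `yes` or to `no`
according to whether the number on the query tape belongs to the oracle. -/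
structure OracleTM (r : ℕ) where
  work : ℕ
  states : ℕ
  start : Fin states
  halt : Fin states
  query : Fin states
  yes : Fin states
  no : Fin states
  next : Fin states → (Fin r ⊕ Fin (work + 2) → Option Bool) →
    Fin states × (Fin r ⊕ Fin (work + 2) → Option Bool × Option Turing.Dir)

namespace OracleTM

variable {r : ℕ}

structure Cfg (m : OracleTM r) where
  state : Fin m.states
  tape : Fin r ⊕ Fin (m.work + 2) → Turing.Tape (Option Bool)

/-- Initially the inputs are written on the input tapes in binary, all other tapes are blank. -/
def init (m : OracleTM r) (a : Fin r → ℕ) : m.Cfg where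
  state := m.start
  tape := Sum.elim (fun i => Turing.Tape.mk₁ ((a i).bits.map some)) (fun _ => default)

open Classical in
noncomputable def step (m : OracleTM r) (A : Set ℕ) (c : m.Cfg) : m.Cfg :=
  if c.state = m.halt then c
  else if c.state = m.query then
    { c with state := if readNat (c.tape (Sum.inr 1)) ∈ A then m.yes else m.no }
  else
    let o := m.next c.state (fun i => (c.tape i).head)
    { state := o.1
      tape := fun i =>
        let T := (c.tape i).write (o.2 i).1
        match (o.2 i).2 with
        | none => T
        | some d => T.move d }

/-- The configuration after `t` steps. -/
noncomputable def run (m : OracleTM r) (A : Set ℕ) (a : Fin r → ℕ) (t : ℕ) : m.Cfg :=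
  (m.step A)^[t] (m.init a)

/-- On all inputs and all oracles the machine halts after a number of steps that is bounded by a
fixed polynomial in the length of the input. -/
def PolyTime (m : OracleTM r) : Prop :=
  ∃ p : Polynomial ℕ, ∀ (A : Set ℕ) (a : Fin r → ℕ),
    ∃ t ≤ p.eval (∑ i, (a i).size), (m.run A a t).state = m.halt

/-- The value computed on input `a` with oracle `A`: the number on the output tape when halting. -/
noncomputable def eval (m : OracleTM r) (A : Set ℕ) (a : Fin r → ℕ) : ℕ :=
  readNat ((m.run A a (sInf {t | (m.run A a t).state = m.halt})).tape (Sum.inr 0))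

/-- The machine never enters its query state, so it is a Turing machine without oracle. -/
def QueryFree (m : OracleTM r) : Prop :=
  m.start ≠ m.query ∧ ∀ s σ, (m.next s σ).1 ≠ m.query

end OracleTM

/-! ## The languages `PV` and `PV(α)` and their standard models -/

inductive PVRel : ℕ → Type
  | lt : PVRel 2

inductive PVαRel : ℕ → Type
  | lt : PVαRel 2
  | alpha : PVαRel 1

/-- `PV`: the symbol `<` and a function symbol for every polynomial time Turing machine. -/
def PV : FirstOrder.Language.{0, 0} where
  Functions r := {m : OracleTM r // m.PolyTime ∧ m.QueryFree}
  Relations := PVRel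

/-- `PV(α)`: the symbols of `PV`, the unary relation symbol `α`, and a function symbol for every
polynomial time oracle Turing machine (machines without oracle being those without queries). -/
def PVα : FirstOrder.Language.{0, 0} where
  Functions r := {m : OracleTM r // m.PolyTime}
  Relations := PVαRel

def PVα.ltSym : PVα.Relations 2 := PVαRel.lt

def PVα.alphaSym : PVα.Relations 1 := PVαRel.alpha

/-- The inclusion of `PV` in `PV(α)`. -/
def PV.incl : PV →ᴸ PVα where
  onFunction _ f := ⟨f.1, f.2.1⟩
  onRelation _ R := match R with
    | PVRel.lt => PVαRel.lt

/-- The standard `PV`-model. -/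
noncomputable instance PV.standard : PV.Structure ℕ where
  funMap f a := f.1.eval ∅ a
  RelMap R a := match R, a with
    | PVRel.lt, a => a 0 < a 1

/-- The standard model `⟨ℕ, A⟩` of `PV(α)` with oracle `A`. -/
@[reducible] noncomputable def PVα.standard (A : Set ℕ) : PVα.Structure ℕ where
  funMap f a := f.1.eval A a
  RelMap R a := match R, a with
    | PVαRel.lt, a => a 0 < a 1
    | PVαRel.alpha, a => a 0 ∈ A

/-! ## Sequence coding and symbols for basic functions -/

/-- The code of a finite sequence: the number whose base 4 digits (least significant first) are the
binary digits of the entries, every entry being followed by the digit `2`, with leading digit `3`.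
-/
def seqCode (l : List ℕ) : ℕ :=
  Nat.ofDigits 4 ((l.flatMap fun n => (Nat.digits 2 n) ++ [2]) ++ [3])

open Classical in
/-- `(n)_i`: the entry with index `i` of the sequence coded by `n`, and `0` if there is none. -/
noncomputable def seqEntry (n i : ℕ) : ℕ :=
  if h : ∃ l : List ℕ, seqCode l = n then h.choose.getD i 0 else 0

/-- Notation: a choice of `PV`-symbols (that is, of polynomial time Turing machines) for some
concrete polynomial time functions. -/
structure BasicSymbols where
  /-- the constant `j` -/
  num : ℕ → PV.Functions 0
  num_spec : ∀ j a, Structure.funMap (M := ℕ) (num j) a = j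
  /-- the length `|n|` of the binary expansion, `|0| = 0` -/
  len : PV.Functions 1
  len_spec : ∀ n : ℕ, Structure.funMap len ![n] = n.size
  /-- the binary digit `bit(i, n)` -/
  bit : PV.Functions 2
  bit_spec : ∀ i n : ℕ, Structure.funMap bit ![i, n] = (n.testBit i).toNat
  /-- truncated predecessor -/
  pred : PV.Functions 1
  pred_spec : ∀ n : ℕ, Structure.funMap pred ![n] = n - 1
  /-- the code of a `k`-tuple -/
  tup : ∀ k, PV.Functions k
  tup_spec : ∀ k (a : Fin k → ℕ), Structure.funMap (tup k) a = seqCode (List.ofFn a)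
  /-- `(n)_i` -/
  entry : PV.Functions 2
  entry_spec : ∀ n i : ℕ, Structure.funMap entry ![n, i] = seqEntry n i

/-! ## The theory `∀T¹₂(PV(α))` -/

/-- The theory `∀PV(α)`: all universal sentences which are true in `⟨ℕ, A⟩` for every `A`. -/
def forallPVα : PVα.Theory :=
  {σ | BoundedFormula.IsUniversal σ ∧
    ∀ A : Set ℕ, @Sentence.Realize PVα ℕ (PVα.standard A) σ}

section Formulas

variable {β : Type} {n : ℕ}

def ltF (s t : PVα.Term (β ⊕ Fin n)) : PVα.BoundedFormula β n :=
  PVα.ltSym.boundedFormula₂ s t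

/-- A `PV`-term as a `PV(α)`-term in which the new last variable does not occur. -/
def boundTerm (t : PV.Term (β ⊕ Fin n)) : PVα.Term (β ⊕ Fin (n + 1)) :=
  PV.incl.onTerm (t.relabel (Sum.map id Fin.castSucc))

/-- The last variable. -/
def lastVar : PVα.Term (β ⊕ Fin (n + 1)) := Term.var (Sum.inr (Fin.last n))

/-- `∀ x < t, φ` -/
def allLt (t : PV.Term (β ⊕ Fin n)) (φ : PVα.BoundedFormula β (n + 1)) :
    PVα.BoundedFormula β n :=
  ((ltF lastVar (boundTerm t)).imp φ).all

/-- `∃ x < t, φ` -/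
def exLt (t : PV.Term (β ⊕ Fin n)) (φ : PVα.BoundedFormula β (n + 1)) :
    PVα.BoundedFormula β n :=
  (ltF lastVar (boundTerm t) ⊓ φ).ex

end Formulas

/-- `Δ₀ᵇ(PV(α))`, the sharply bounded formulas: the closure of the atomic formulas under Boolean
combinations (`⊥` and `→`) and sharply bounded quantifiers. -/
inductive IsSharplyBounded (κ : BasicSymbols) {β : Type} :
    ∀ {n : ℕ}, PVα.BoundedFormula β n → Prop
  | falsum {n : ℕ} : IsSharplyBounded κ (⊥ : PVα.BoundedFormula β n)
  | atomic {n : ℕ} {φ : PVα.BoundedFormula β n} : φ.IsAtomic → IsSharplyBounded κ φ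
  | imp {n : ℕ} {φ ψ : PVα.BoundedFormula β n} :
      IsSharplyBounded κ φ → IsSharplyBounded κ ψ → IsSharplyBounded κ (φ.imp ψ)
  | all {n : ℕ} (t : PV.Term (β ⊕ Fin n)) {φ : PVα.BoundedFormula β (n + 1)} :
      IsSharplyBounded κ φ → IsSharplyBounded κ (allLt (κ.len.apply₁ t) φ)
  | ex {n : ℕ} (t : PV.Term (β ⊕ Fin n)) {φ : PVα.BoundedFormula β (n + 1)} :
      IsSharplyBounded κ φ → IsSharplyBounded κ (exLt (κ.len.apply₁ t) φ)

/-- `Σ₁ᵇ(PV(α))`: the closure of the sharply bounded formulas under positive Boolean combinations,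
sharply bounded quantifiers and bounded existential quantifiers. -/
inductive IsSigmaB1 (κ : BasicSymbols) {β : Type} : ∀ {n : ℕ}, PVα.BoundedFormula β n → Prop
  | of {n : ℕ} {φ : PVα.BoundedFormula β n} : IsSharplyBounded κ φ → IsSigmaB1 κ φ
  | inf {n : ℕ} {φ ψ : PVα.BoundedFormula β n} :
      IsSigmaB1 κ φ → IsSigmaB1 κ ψ → IsSigmaB1 κ (φ ⊓ ψ)
  | sup {n : ℕ} {φ ψ : PVα.BoundedFormula β n} :
      IsSigmaB1 κ φ → IsSigmaB1 κ ψ → IsSigmaB1 κ (φ ⊔ ψ)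
  | allSharp {n : ℕ} (t : PV.Term (β ⊕ Fin n)) {φ : PVα.BoundedFormula β (n + 1)} :
      IsSigmaB1 κ φ → IsSigmaB1 κ (allLt (κ.len.apply₁ t) φ)
  | exSharp {n : ℕ} (t : PV.Term (β ⊕ Fin n)) {φ : PVα.BoundedFormula β (n + 1)} :
      IsSigmaB1 κ φ → IsSigmaB1 κ (exLt (κ.len.apply₁ t) φ)
  | ex {n : ℕ} (t : PV.Term (β ⊕ Fin n)) {φ : PVα.BoundedFormula β (n + 1)} :
      IsSigmaB1 κ φ → IsSigmaB1 κ (exLt t φ)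

/-- For a formula `φ` in the variables `0, …, k`, regarded as `φ(v, x̄)` where `v` is the variable
`k` and `x̄` are the others: the instance of `φ` in which `x̄` are the first `k` bound variables and
`v` is the bound variable `j`. -/
def plug {k m : ℕ} (φ : PVα.Formula (Fin (k + 1))) (hk : k ≤ m) (j : Fin m) :
    PVα.BoundedFormula Empty m :=
  BoundedFormula.relabel (n := m) (k := 0)
    (fun i => Sum.inr (Fin.lastCases (motive := fun _ => Fin m) j (Fin.castLE hk) i)) φ

/-- The universal closure of
`φ(x, x̄) → ∃ y ≤ x (φ(y, x̄) ∧ ∀ z < y ¬ φ(z, x̄))`. -/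
def minAxiom {k : ℕ} (φ : PVα.Formula (Fin (k + 1))) : PVα.Sentence :=
  let x : Fin (k + 3) := ⟨k, by omega⟩
  let y : Fin (k + 3) := ⟨k + 1, by omega⟩
  let z : Fin (k + 3) := ⟨k + 2, by omega⟩
  let x' : Fin (k + 2) := ⟨k, by omega⟩
  let y' : Fin (k + 2) := ⟨k + 1, by omega⟩
  BoundedFormula.alls (n := k + 1)
    ((plug (m := k + 1) φ (by omega) (Fin.last k)).imp
      ((ltF (&y') (&x') ⊔ (&y') =' (&x')) ⊓
        (plug (m := k + 2) φ (by omega) y' ⊓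
          ((ltF (&z) (&y)).imp (plug (m := k + 3) φ (by omega) z).not).all)).ex)

/-- `∀T¹₂(PV(α)) = ∀PV(α) ∪ MIN(Σ₁ᵇ(PV(α)))` -/
def forallT12 (κ : BasicSymbols) : PVα.Theory :=
  forallPVα ∪ {σ | ∃ (k : ℕ) (φ : PVα.Formula (Fin (k + 1))), IsSigmaB1 κ φ ∧ σ = minAxiom φ}

/-! ## Partial structures and basic sentences -/

/-- A partial `K`-structure on `A`; the value `none` means "undefined" (`1/2`). -/
structure PartialStr (K : FirstOrder.Language.{0, 0}) (A : Type) where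
  fn : ∀ {r : ℕ}, K.Functions r → (Fin r → A) → Option A
  rel : ∀ {r : ℕ}, K.Relations r → (Fin r → A) → Option Bool

/-- A literal in the variables `0, …, k - 1` of one of the forms `R(ū)`, `¬ R(ū)`, `f(ū) = v`,
`u = v`, `¬ u = v`. -/
inductive BasicLiteral (K : FirstOrder.Language.{0, 0}) (k : ℕ) : Type
  | rel {r : ℕ} (R : K.Relations r) (u : Fin r → Fin k)
  | nrel {r : ℕ} (R : K.Relations r) (u : Fin r → Fin k)
  | fn {r : ℕ} (f : K.Functions r) (u : Fin r → Fin k) (v : Fin k)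
  | eq (u v : Fin k)
  | ne (u v : Fin k)

/-- A basic `K`-sentence `∃ ȳ ⋁_{i ∈ I} ⋀_{j ∈ J} λ_{ij}` with nonempty `I` and `J`. -/
structure BasicSentence (K : FirstOrder.Language.{0, 0}) where
  vars : ℕ
  I : ℕ
  J : ℕ
  I_pos : 0 < I
  J_pos : 0 < J
  lit : Fin I → Fin J → BasicLiteral K vars

def BasicLiteral.map {K K' : FirstOrder.Language.{0, 0}} (ρ : K →ᴸ K') {k : ℕ} :
    BasicLiteral K k → BasicLiteral K' k
  | .rel R u => .rel (ρ.onRelation R) u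
  | .nrel R u => .nrel (ρ.onRelation R) u
  | .fn f u v => .fn (ρ.onFunction f) u v
  | .eq u v => .eq u v
  | .ne u v => .ne u v

/-- A basic sentence in a smaller language as one in a larger language. -/
def BasicSentence.map {K K' : FirstOrder.Language.{0, 0}} (ρ : K →ᴸ K') (φ : BasicSentence K) :
    BasicSentence K' :=
  { φ with lit := fun i j => (φ.lit i j).map ρ }

namespace PartialStr

variable {K : FirstOrder.Language.{0, 0}} {A B : Type}

/-- The literal has truth value `1` under the assignment `a`. -/
def VerifiesLit (P : PartialStr K A) {k : ℕ} (a : Fin k → A) : BasicLiteral K k → Prop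
  | .rel R u => P.rel R (a ∘ u) = some true
  | .nrel R u => P.rel R (a ∘ u) = some false
  | .fn f u v => P.fn f (a ∘ u) = some (a v)
  | .eq u v => a u = a v
  | .ne u v => a u ≠ a v

/-- `P` verifies `φ`: the value of `φ` in three-valued logic is `1`. If `P` is total, this means
that `φ` is true in `P`. -/
def Verifies (P : PartialStr K A) (φ : BasicSentence K) : Prop :=
  ∃ a : Fin φ.vars → A, ∃ i, ∀ j, P.VerifiesLit a (φ.lit i j)

open Classical in
/-- A (total) structure as a partial structure. -/
noncomputable def ofTotal (S : K.Structure A) : PartialStr K A where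
  fn f a := some (Structure.funMap f a)
  rel R a := some (decide (Structure.RelMap R a))

open Classical in
/-- The partial substructure induced on a subset of a total structure. -/
noncomputable def induced (S : K.Structure A) (s : Set A) : PartialStr K s where
  fn f a := if h : Structure.funMap f (fun i => (a i : A)) ∈ s then some ⟨_, h⟩ else none
  rel R a := some (decide (Structure.RelMap R (fun i => (a i : A))))

/-- `e` is an embedding: an isomorphism from `P` onto a partial substructure of `Q`, which arises
from `Q` by restricting the universe and by changing some values to undefined. -/
def IsEmbedding (P : PartialStr K A) (Q : PartialStr K B) (e : A → B) : Prop :=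
  Function.Injective e ∧
  (∀ {r : ℕ} (f : K.Functions r) (a : Fin r → A) (b : A),
    P.fn f a = some b → Q.fn f (e ∘ a) = some (e b)) ∧
  (∀ {r : ℕ} (R : K.Relations r) (a : Fin r → A) (v : Bool),
    P.rel R a = some v → Q.rel R (e ∘ a) = some v)

/-- The expansion of a partial `K`-structure on a subset `s` of a `PV`-structure by the built-in
symbols of `PV`, interpreted by the partial substructure induced on `s`. -/
noncomputable def withPV {N : Type} (S : PV.Structure N) (s : Set N) (P : PartialStr K s) :
    PartialStr (K.sum PV) s where
  fn f a := match f with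
    | .inl f => P.fn f a
    | .inr f => (induced S s).fn f a
  rel R a := match R with
    | .inl R => P.rel R a
    | .inr R => (induced S s).rel R a

end PartialStr

def symArity {K : FirstOrder.Language.{0, 0}} : K.Symbols → ℕ
  | .inl f => f.1
  | .inr R => R.1

def PartialStr.DefinedAt {K : FirstOrder.Language.{0, 0}} {A : Type} (P : PartialStr K A) :
    (S : K.Symbols) → (Fin (symArity S) → A) → Prop
  | .inl f, a => P.fn f.2 a ≠ none
  | .inr R, a => P.rel R.2 a ≠ none

/-- The size of a partial structure: the number of its defined values. -/
noncomputable def PartialStr.size {K : FirstOrder.Language.{0, 0}} [Fintype K.Symbols] {A : Type}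
    (P : PartialStr K A) : ℕ :=
  ∑ S : K.Symbols, Nat.card {a : Fin (symArity S) → A // P.DefinedAt S a}

/-- `s_K(n)`: the size of a total structure with a universe of cardinality `n`. -/
def totalSize (K : FirstOrder.Language.{0, 0}) [Fintype K.Symbols] (n : ℕ) : ℕ :=
  ∑ S : K.Symbols, n ^ symArity S

/-! ## Finitary combinatorial principles, weak and strong -/

/-- A basic sentence with built-in `PV` is a finitary combinatorial principle if it is true in all
structures with universe `[n] = {0, …, n - 1}`, `n ≥ 1`. -/
def IsFinitaryPrinciple {K : FirstOrder.Language.{0, 0}} (φ : BasicSentence (K.sum PV)) : Prop :=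
  ∀ n : ℕ, 0 < n → ∀ S : K.Structure (Set.Iio n),
    (PartialStr.withPV PV.standard (Set.Iio n) (PartialStr.ofTotal S)).Verifies φ

/-- The determinacy: the minimal `m` such that every partial `K`-structure on `[n]` of size at
least `m` verifies `φ`. -/
noncomputable def determinacy {K : FirstOrder.Language.{0, 0}} [Fintype K.Symbols]
    (φ : BasicSentence (K.sum PV)) (n : ℕ) : ℕ :=
  sInf {m | ∀ P : PartialStr K (Set.Iio n), m ≤ P.size →
    (PartialStr.withPV PV.standard (Set.Iio n) P).Verifies φ}

/-- `φ` is weak: `s_K(n) ≥ n^{Ω(1)} · d(n)`. -/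
def IsWeak {K : FirstOrder.Language.{0, 0}} [Fintype K.Symbols] (φ : BasicSentence (K.sum PV)) : Prop :=
  ∃ ε : ℝ, 0 < ε ∧ ∀ᶠ n : ℕ in Filter.atTop,
    (n : ℝ) ^ ε * (determinacy φ n : ℝ) ≤ (totalSize K n : ℝ)

/-- The partial substructure induced on the finite set `B₀` is `g`-large. -/
def IsLargeSub {K : FirstOrder.Language.{0, 0}} {B : Type} (S : K.Structure B) (g : ℕ → ℕ)
    (B₀ : Finset B) : Prop :=
  ∃ V : Finset B, Disjoint V B₀ ∧ V.card ≤ g B₀.card ∧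
    ∀ (r : ℕ) (f : K.Functions r) (a : Fin r → B), (∀ i, a i ∈ B₀) →
      Structure.funMap f a ∈ B₀ ∨ Structure.funMap f a ∈ V

/-- A structure is `g`-large if each of its finite partial substructures embeds into a `g`-large
induced partial substructure with a universe of the same cardinality. -/
def IsLarge {K : FirstOrder.Language.{0, 0}} {B : Type} (S : K.Structure B) (g : ℕ → ℕ) : Prop :=
  ∀ (A₀ : Finset B), A₀.Nonempty → ∀ P : PartialStr K {b // b ∈ A₀},
    P.IsEmbedding (PartialStr.ofTotal S) Subtype.val →
      ∃ B₀ : Finset B, B₀.card = A₀.card ∧ IsLargeSub S g B₀ ∧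
        ∃ e : {b // b ∈ A₀} → {b // b ∈ (B₀ : Set B)},
          P.IsEmbedding (PartialStr.induced S (B₀ : Set B)) e

/-- A basic sentence without built-in symbols is strong if its negation has an infinite
`n^{o(1)}`-large model. -/
def IsStrong {K : FirstOrder.Language.{0, 0}} (φ : BasicSentence K) : Prop :=
  ∃ (B : Type) (S : K.Structure B) (g : ℕ → ℕ), Infinite B ∧
    ¬ (PartialStr.ofTotal S).Verifies φ ∧
    (∀ ε : ℝ, 0 < ε → ∀ᶠ n : ℕ in Filter.atTop, (g n : ℝ) ≤ (n : ℝ) ^ ε) ∧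
    IsLarge S g

/-! ## Binary codes of structures in models of arithmetic -/

section Codes

variable (κ : BasicSymbols) {N : Type} [PV.Structure N]

def ltN (a b : N) : Prop := Structure.RelMap (L := PV) PVRel.lt ![a, b]

/-- The value of the numeral `j` in `N`. -/
def numN (j : ℕ) : N := Structure.funMap (κ.num j) ![]

/-- `[n]` as a subset of `N`. -/
def below (n : N) : Set N := {a | ltN a n}

/-- `X` is a binary code in `N` of the structure `S` on `[n]`: a relation symbol `R` holds of `ā`
iff `⟨R, ā⟩ ∈ X`, and the value of a function symbol `f` on `ā` is `min {c, n - 1}` for the number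
`c` of length at most `|n|` whose bits `i < |n|` are determined by `⟨f, ā, i⟩ ∈ X`. The symbols of
`K` are identified with natural numbers via `code`. -/
def IsBinaryCode {K : FirstOrder.Language.{0, 0}} (code : K.Symbols → ℕ) (n : N) (X : Set N)
    (S : K.Structure (below n)) : Prop :=
  (∀ (r : ℕ) (R : K.Relations r) (a : Fin r → below n),
    Structure.RelMap R a ↔
      Structure.funMap (κ.tup (r + 1))
        (Fin.cons (numN κ (code (.inr ⟨r, R⟩))) (fun i => (a i : N)) : Fin (r + 1) → N) ∈ X) ∧
  (∀ (r : ℕ) (f : K.Functions r) (a : Fin r → below n), ∃ c : N,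
    ¬ ltN (Structure.funMap κ.len ![n]) (Structure.funMap κ.len ![c]) ∧
    (∀ i : N, ltN i (Structure.funMap κ.len ![n]) →
      (Structure.funMap κ.bit ![i, c] = numN κ 1 ↔
        Structure.funMap (κ.tup (r + 2))
          (Fin.cons (numN κ (code (.inl ⟨r, f⟩)))
            (Fin.snoc (fun i => (a i : N)) i : Fin (r + 1) → N) : Fin (r + 2) → N) ∈ X)) ∧
    ((ltN c n ∧ (Structure.funMap f a).1 = c) ∨
      (¬ ltN c n ∧ (Structure.funMap f a).1 = Structure.funMap κ.pred ![n])))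

/-- `B(K, n, X) ⊨ φ`, where `B(K, n, X)` is the structure on `[n]` with binary code `X` and
built-in symbols from `PV` are evaluated in `N`. -/
def BModels {K : FirstOrder.Language.{0, 0}} (code : K.Symbols → ℕ) (n : N) (X : Set N)
    (φ : BasicSentence (K.sum PV)) : Prop :=
  ∃ S : K.Structure (below n), IsBinaryCode κ code n X S ∧
    (PartialStr.withPV inferInstance (below n) (PartialStr.ofTotal S)).Verifies φ

/-- `B(K, n, X) ⊭ φ` for `φ` without built-in symbols. -/
def BFails {K : FirstOrder.Language.{0, 0}} (code : K.Symbols → ℕ) (n : N) (X : Set N)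
    (φ : BasicSentence K) : Prop :=
  ∃ S : K.Structure (below n), IsBinaryCode κ code n X S ∧
    ¬ (PartialStr.ofTotal S).Verifies φ

/-- The interpretation `α^N` of the oracle symbol. -/
def oracle (N : Type) [PVα.Structure N] : Set N :=
  {a | Structure.RelMap PVα.alphaSym ![a]}

/-- `f_ā⁻¹(0) = {u | f(u, ā) = 0}` -/
def zeroSet [PVα.Structure N] {k : ℕ} (f : PVα.Functions (k + 1)) (a : Fin k → N) : Set N :=
  {u | Structure.funMap f (Fin.cons u a : Fin (k + 1) → N) = numN κ 0}

/-- In `N`, every structure `B(K, m, f_ā⁻¹(0))` with `m ≠ 0`, `f` a function symbol of `PV(α)` and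
`ā` a tuple from `N` is a model of `φ`. -/
def AllDefinableModel [PVα.Structure N] {K : FirstOrder.Language.{0, 0}} (code : K.Symbols → ℕ)
    (φ : BasicSentence (K.sum PV)) : Prop :=
  ∀ (m : N), m ≠ numN κ 0 → ∀ (k : ℕ) (f : PVα.Functions (k + 1)) (a : Fin k → N),
    BModels κ code m (zeroSet κ f a) φ

end Codes

/-! ## The search problems `Q_φ` and independence -/

section Search

variable (κ : BasicSymbols) {β : Type}

/-- A formula `χ(t)` for each term `t`, to be put in place of `α(t)`. -/
abbrev OracleFormula (β : Type) : Type :=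
  (m : ℕ) → PVα.Term (β ⊕ Fin m) → PVα.BoundedFormula β m

def alphaOracle : OracleFormula β := fun _ t => PVα.alphaSym.boundedFormula₁ t

def numT (j : ℕ) {γ : Type} : PVα.Term γ := Term.func (PV.incl.onFunction (κ.num j)) ![]

/-- `f(t, z̄) = 0` in place of `α(t)`. -/
def substOracle {k : ℕ} (f : PVα.Functions (k + 1)) (z : Fin k → β) : OracleFormula β :=
  fun m t =>
    (Term.func f (Fin.cons t (fun i => Term.var (Sum.inl (z i))) :
      Fin (k + 1) → PVα.Term (β ⊕ Fin m))) =' (numT κ 0)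

def lenT {γ : Type} (t : PVα.Term γ) : PVα.Term γ := (PV.incl.onFunction κ.len).apply₁ t

def predT {γ : Type} (t : PVα.Term γ) : PVα.Term γ := (PV.incl.onFunction κ.pred).apply₁ t

def bitT {γ : Type} (i t : PVα.Term γ) : PVα.Term γ := (PV.incl.onFunction κ.bit).apply₂ i t

def entryT {γ : Type} (t i : PVα.Term γ) : PVα.Term γ := (PV.incl.onFunction κ.entry).apply₂ t i

def tupT {γ : Type} {k : ℕ} (t : Fin k → PVα.Term γ) : PVα.Term γ :=
  Term.func (PV.incl.onFunction (κ.tup k)) t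

/-- A term without bound variables, in a context with `m` bound variables. -/
def up (m : ℕ) (t : PVα.Term β) : PVα.Term (β ⊕ Fin m) := t.relabel Sum.inl

/-- `⟨c, ū, i⟩` -/
def queryT {r m : ℕ} (c : ℕ) (u : Fin r → PVα.Term β) (i : PVα.Term (β ⊕ Fin m)) :
    PVα.Term (β ⊕ Fin m) :=
  tupT κ (Fin.cons (numT κ c) (Fin.snoc (fun j => up m (u j)) i :
    Fin (r + 1) → PVα.Term (β ⊕ Fin m)) : Fin (r + 2) → PVα.Term (β ⊕ Fin m))

/-- The graph `f(ū) = v` of the function with number `c` in the structure on `[x]` with binary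
code `α` (replaced by `χ`): either `v < x` has the bits `⟨c, ū, i⟩ ∈ α`, or `v = x - 1` and these
are the bits of a number greater than `x - 1`. -/
def graphF (χ : OracleFormula β) {r : ℕ} (c : ℕ) (u : Fin r → PVα.Term β)
    (v x : PVα.Term β) : PVα.BoundedFormula β 0 :=
  let i₁ : PVα.Term (β ⊕ Fin 1) := Term.var (Sum.inr 0)
  let i₂ : PVα.Term (β ⊕ Fin 2) := Term.var (Sum.inr 0)
  let j₂ : PVα.Term (β ⊕ Fin 2) := Term.var (Sum.inr 1)
  (ltF (up 0 v) (up 0 x) ⊓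
    ((ltF i₁ (lenT κ (up 1 x))).imp
      ((χ 1 (queryT κ c u i₁)).iff (bitT κ i₁ (up 1 v) =' numT κ 1))).all) ⊔
  ((up 0 v) =' (predT κ (up 0 x)) ⊓
    (ltF i₁ (lenT κ (up 1 x)) ⊓
      (χ 1 (queryT κ c u i₁) ⊓ ((bitT κ i₁ (predT κ (up 1 x)) =' numT κ 0) ⊓
        ((ltF j₂ (lenT κ (up 2 x))).imp
          ((ltF i₂ j₂).imp
            ((χ 2 (queryT κ c u j₂)).iff
              (bitT κ j₂ (predT κ (up 2 x)) =' numT κ 1)))).all))).ex)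

/-- The translation of a literal evaluated in the structure on `[x]` coded by `χ`, where the
`i`-th variable is `(y)_i`. -/
def litF {K : FirstOrder.Language.{0, 0}} (code : K.Symbols → ℕ) (χ : OracleFormula β) (x y : β) {k : ℕ} :
    BasicLiteral (K.sum PV) k → PVα.BoundedFormula β 0 :=
  let w : Fin k → PVα.Term β := fun i => entryT κ (Term.var y) (numT κ i)
  let relF : {r : ℕ} → (K.sum PV).Relations r → (Fin r → Fin k) → PVα.BoundedFormula β 0 :=
    fun {r} R u => match R with
      | .inl R => χ 0 (tupT κ (Fin.cons (numT κ (code (.inr ⟨r, R⟩))) (fun i => up 0 (w (u i))) :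
          Fin (r + 1) → PVα.Term (β ⊕ Fin 0)))
      | .inr R => Relations.boundedFormula (PV.incl.onRelation R) (fun i => up 0 (w (u i)))
  fun l => match l with
    | .rel R u => relF R u
    | .nrel R u => (relF R u).not
    | .fn (r := r) f u v => match f with
      | .inl f => graphF κ χ (code (.inl ⟨r, f⟩)) (fun i => w (u i)) (w v) (Term.var x)
      | .inr f => (Term.func (PV.incl.onFunction f) (fun i => up 0 (w (u i)))) =' (up 0 (w v))
    | .eq u v => (up 0 (w u)) =' (up 0 (w v))
    | .ne u v => ((up 0 (w u)) =' (up 0 (w v))).not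

/-- The formula `"B(K, x, α) ⊨ ψ(y)"` for `φ = ∃ ȳ ψ(ȳ)`, with `χ(t)` in place of `α(t)`:
`0 < x → ⋀_j (y)_j < x ∧ ψ'((y)_0, …)`. With `χ = α` this is the search problem `Q_φ`. -/
noncomputable def searchF {K : FirstOrder.Language.{0, 0}} (code : K.Symbols → ℕ)
    (φ : BasicSentence (K.sum PV)) (χ : OracleFormula β) (x y : β) : PVα.Formula β :=
  (ltF (numT κ 0) (up 0 (Term.var x))).imp
    ((BoundedFormula.iInf fun j : Fin φ.vars =>
        ltF (up 0 (entryT κ (Term.var y) (numT κ j))) (up 0 (Term.var x))) ⊓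
      BoundedFormula.iSup fun i : Fin φ.I => BoundedFormula.iInf fun j : Fin φ.J =>
        litF κ code χ x y (φ.lit i j))

/-- `Q_φ[PV(α)]`: the sentences `∀ x ∀ z̄ ∃ y Q_φ(x, y)[α / f_z̄⁻¹(0)]` for all function symbols
`f(u, z̄)` of `PV(α)`. -/
def substInstances {K : FirstOrder.Language.{0, 0}} (code : K.Symbols → ℕ) (φ : BasicSentence (K.sum PV)) :
    PVα.Theory :=
  {σ | ∃ (k : ℕ) (f : PVα.Functions (k + 1)),
    σ = Formula.iAlls (α := Empty) (Option (Fin k)) (Formula.iExs Unit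
      (searchF κ code φ (substOracle κ f fun i => Sum.inl (Sum.inr (some i)))
        (Sum.inl (Sum.inr none)) (Sum.inr ())))}

/-- `Q_φ` is a consequence of `Q_φ'` over `T`: `T ∪ Q_φ'[PV(α)]` proves `∃ y Q_φ(x, y)`. -/
def IsConsequence (T : PVα.Theory) {K K' : FirstOrder.Language.{0, 0}} (code : K.Symbols → ℕ)
    (φ : BasicSentence (K.sum PV)) (code' : K'.Symbols → ℕ) (φ' : BasicSentence (K'.sum PV)) :
    Prop :=
  (T ∪ substInstances κ code' φ') ⊨ᵇ
    (Formula.iExs Unit (searchF κ code φ alphaOracle (Sum.inl ()) (Sum.inr ())) :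
      PVα.Formula Unit)

/-- `Q_φ` is independent from `Q_φ'` over `T`. -/
def IsIndependent (T : PVα.Theory) {K K' : FirstOrder.Language.{0, 0}} (code : K.Symbols → ℕ)
    (φ : BasicSentence (K.sum PV)) (code' : K'.Symbols → ℕ) (φ' : BasicSentence (K'.sum PV)) :
    Prop :=
  ¬ IsConsequence κ T code φ code' φ'

end Search

/-! ## Cuts -/

/-- `f` is subexponential: `f(n) ≤ 2^{n^{o(1)}}`. -/
def IsSubexponential (f : ℕ → ℕ) : Prop :=
  ∀ ε : ℝ, 0 < ε → ∀ᶠ n : ℕ in Filter.atTop, (f n : ℝ) ≤ (2 : ℝ) ^ ((n : ℝ) ^ ε)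

section Cuts

variable {M : Type} [PV.Structure M]

/-- A `PV`-cut: a substructure that is an initial segment. -/
def IsCut (N : PV.Substructure M) : Prop :=
  ∀ a b : M, ltN a b → b ∈ N → a ∈ N

/-- `N` is subexponential in `n`: `f^M(n) ∈ N` for all subexponential `f` definable in the standard
`PV`-model; `f^M` is defined in `M` by the formula that defines `f`. -/
def IsSubexponentialIn (N : PV.Substructure M) (n : M) : Prop :=
  ∀ (f : ℕ → ℕ) (θ : PV.Formula (Fin 2)), IsSubexponential f →
    (∀ x y : ℕ, θ.Realize ![x, y] ↔ f x = y) → ∃ b ∈ N, θ.Realize ![n, b]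

end Cuts

/-! ## Query complexity -/

/-! The model is obtained by forcing over an ultrapower of `ℕ`. Let `S` be an infinite structure on
`B` in which `φ` fails. A condition is a finite set of atomic facts about a structure on `[n]`, all
of them true when `S` is pulled back along a single injection of `[n]` into `B` (`Good`). A decision
tree that queries the code of the structure can be followed at the cost of one fact per query
(`Good.exists_forces`): a function value outside the image of `[n]` is brought inside by redirecting
an unused number. Hence conditions of size `n^{o(1)}` suffice to decide polynomial time computations
on parameters of length `n^{o(1)}`.

The combinatorial core concerns the weak principle. A function symbol with parameters defines a
structure on `[m]`, each atom of which has a decision tree of small depth `d`. Embed `[n]` into `B`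
by a random permutation followed by a fixed enumeration of suitable elements. Iterated largeness
(`IsLarge.exists_layers`) supplies layers, each mapped into the next by all functions, whose bottom
contains all but at most `d * g n` of the enumerated elements. Along a tree the newly exposed
arguments very likely fall into the bottom layer, and then the function value lies in the next layer
and so is again enumerated; thus the tree is very likely followed by facts that are true under the
embedding (`mostlyIn_determinedBy`). By averaging, one embedding determines at least half of the
atoms (`Good.exists_determining`). Weakness says that half of the atoms exceeds the determinacy, so
the determined values form a partial structure verifying the principle. The verified disjunct has
`J` literals, each settled by at most `d` facts, so all but `J * d` new facts can be discarded
(`Good.exists_verifying_of_determinacy`). For the finitely many small `m` all atoms are decided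
instead.

Everything demanded of the model is phrased as countably many density requirements (`Req`), each
solved by an extension of size polynomial in the lengths of its parameters. In the ultrapower, take
a countable elementary submodel closed under chosen solutions, and let `N` be its cut of elements of
length `n^{o(1)}`. As `N` is countable, all requirements with parameters from `N` are met along one
chain of conditions. A diagonal choice of embeddings (`exists_chain_embedding`) makes every member
of the chain true in almost all coordinates, and the oracle codes the structures pulled back along
them. Since function symbols are evaluated coordinatewise with these oracles, universal sentences
transfer to `N`, and the failure of `φ` is inherited from `S`.

Minimization rests on a truth lemma (`IsSigmaB1.exists_truthLemma`): a `Σ₁ᵇ` formula holds in `N`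
iff some condition of the chain verifies it almost everywhere, where verification is monotone and
uses only a small part of the condition. The least number that any good extension can verify is
therefore verified by a small extension, after which no smaller number can become true. Independence
follows by reading the search formulas in this model. -/

/-- `QC d F`: the functional `F` of an oracle is computed by a decision tree of depth at most `d`. -/
inductive QC {X : Type} : ℕ → (Set ℕ → X) → Prop
  | const (d : ℕ) (x : X) : QC d (fun _ => x)
  | query (d u : ℕ) {F₁ F₀ F : Set ℕ → X} : QC d F₁ → QC d F₀ → (∀ A, u ∈ A → F A = F₁ A) →
      (∀ A, u ∉ A → F A = F₀ A) → QC (d + 1) F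

namespace QC

variable {X Y : Type}

theorem mono {d d' : ℕ} {F : Set ℕ → X} (h : QC d F) (hd : d ≤ d') : QC d' F := by
  induction h generalizing d' with
  | const d x => exact .const _ x
  | query d u _ _ h₁ h₀ ih₁ ih₀ =>
    obtain ⟨e, rfl⟩ : ∃ e, d' = e + 1 := ⟨d' - 1, by omega⟩
    exact .query e u (ih₁ (by omega)) (ih₀ (by omega)) h₁ h₀

/-- The second tree is attached at the leaves of the first, which is why its depth has to be bounded
uniformly in the value `x`. -/
theorem bind {d d' : ℕ} {F : Set ℕ → X} {G : X → Set ℕ → Y} (h : QC d F)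
    (hG : ∀ x, QC d' (G x)) : QC (d + d') (fun A => G (F A) A) := by
  induction h with
  | const d x => exact (hG x).mono (by omega)
  | query d u _ _ h₁ h₀ ih₁ ih₀ =>
    rw [show d + 1 + d' = d + d' + 1 by omega]
    exact .query _ u ih₁ ih₀ (fun A hA => by rw [h₁ A hA]) (fun A hA => by rw [h₀ A hA])

theorem map {d : ℕ} {F : Set ℕ → X} (h : QC d F) (G : X → Y) : QC d (fun A => G (F A)) :=
  h.bind (G := fun x _ => G x) (d' := 0) fun x => .const 0 (G x)

theorem map₂ {Z : Type} {d d' : ℕ} {F : Set ℕ → X} {F' : Set ℕ → Y} (h : QC d F) (h' : QC d' F')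
    (G : X → Y → Z) : QC (d + d') (fun A => G (F A) (F' A)) :=
  h.bind (G := fun x A => G x (F' A)) fun x => h'.map (G x)

theorem mem (u : ℕ) : QC 1 (fun A : Set ℕ => u ∈ A) :=
  .query 0 u (.const 0 True) (.const 0 False) (fun _ h => eq_true h) (fun _ h => eq_false h)

/-- Simultaneous evaluation of finitely many functionals. -/
theorem pi {r : ℕ} {F : Fin r → Set ℕ → X} {d : Fin r → ℕ} (h : ∀ i, QC (d i) (F i)) :
    QC (∑ i, d i) (fun A i => F i A) := by
  induction r with
  | zero =>
    have : (fun (A : Set ℕ) (i : Fin 0) => F i A) = fun _ => Fin.elim0 := by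
      funext A i; exact i.elim0
    rw [this]; exact .const _ _
  | succ r ih =>
    have := map₂ (h 0) (ih fun i => h i.succ) (fun x y => (Fin.cons x y : Fin (r + 1) → X))
    rw [Fin.sum_univ_succ]
    convert this using 3 with A i
    refine Fin.cases ?_ (fun j => ?_) i <;> simp

/-- Bounded search. -/
theorem exists_lt {F : ℕ → Set ℕ → Prop} {d : ℕ} (b : ℕ) (h : ∀ x < b, QC d (F x)) :
    QC (b * d) (fun A => ∃ x < b, F x A) := by
  induction b with
  | zero => simpa using (QC.const 0 False)
  | succ b ih =>
    have := map₂ (ih fun x hx => h x (by omega)) (h b (by omega)) Or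
    rw [Nat.succ_mul]
    convert this using 2 with A
    simp only [Nat.lt_succ_iff_lt_or_eq]
    constructor
    · rintro ⟨x, hx | rfl, hF⟩
      · exact .inl ⟨x, hx, hF⟩
      · exact .inr hF
    · rintro (⟨x, hx, hF⟩ | hF)
      · exact ⟨x, .inl hx, hF⟩
      · exact ⟨b, .inr rfl, hF⟩

/-- All values of a functional with a parameter below `b`. -/
theorem seq {F : ℕ → Set ℕ → X} {d : ℕ} (b : ℕ) (h : ∀ x < b, QC d (F x)) :
    QC (b * d) (fun A (i : Fin b) => F i A) := by
  have := pi (F := fun (i : Fin b) => F i) (d := fun _ => d) fun i => h i i.2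
  simpa using this

end QC

theorem Polynomial.eval_mono_nat (p : Polynomial ℕ) {a b : ℕ} (h : a ≤ b) :
    p.eval a ≤ p.eval b := by
  induction p using Polynomial.induction_on' with
  | add p q hp hq => simpa using Nat.add_le_add hp hq
  | monomial n c => simpa using Nat.mul_le_mul_left _ (Nat.pow_le_pow_left h n)

/-! ## Oracle machines: query complexity and size of the output -/

namespace OracleTM

variable {r : ℕ} (m : OracleTM r)

/-- The oracle is consulted only in the query state, and there about a single number. -/
theorem step_qc (c : m.Cfg) : QC 1 (fun A => m.step A c) := by
  unfold step
  split_ifs with h h'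
  · exact .const _ _
  · exact (QC.mem (readNat (c.tape (Sum.inr 1)))).map fun p : Prop =>
      ({ c with state := open Classical in if p then m.yes else m.no } : m.Cfg)
  · exact .const _ _

theorem run_succ (A : Set ℕ) (a : Fin r → ℕ) (t : ℕ) :
    m.run A a (t + 1) = m.step A (m.run A a t) := by
  simp [run, Function.iterate_succ_apply']

theorem run_qc (a : Fin r → ℕ) (t : ℕ) : QC t (fun A => m.run A a t) := by
  induction t with
  | zero => exact .const 0 (m.init a)
  | succ t ih =>
    simp only [run_succ]
    exact ih.bind (G := fun c A => m.step A c) m.step_qc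

theorem run_halted {A : Set ℕ} {a : Fin r → ℕ} {t t' : ℕ} (h : (m.run A a t).state = m.halt)
    (ht : t ≤ t') : m.run A a t' = m.run A a t := by
  induction t', ht using Nat.le_induction with
  | base => rfl
  | succ k _ ih => rw [run_succ, ih, step, if_pos h]

/-- Halted configurations are stationary, so the halting time, which depends on the oracle, can be
replaced by a fixed time bound. This is what allows a tree of fixed depth to simulate the machine.
-/
theorem eval_eq {A : Set ℕ} {a : Fin r → ℕ} {t T : ℕ} (ht : t ≤ T)
    (h : (m.run A a t).state = m.halt) :
    m.eval A a = readNat ((m.run A a T).tape (Sum.inr 0)) := by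
  have hs : (m.run A a (sInf {t | (m.run A a t).state = m.halt})).state = m.halt :=
    Nat.sInf_mem (s := {t | (m.run A a t).state = m.halt}) ⟨t, h⟩
  rw [eval, m.run_halted hs (t' := T) ((Nat.sInf_le h).trans ht)]

/-- Positions are relative to the head. A head moves by at most one cell per step and writes only
where it stands, so written cells remain within distance `t` of it. -/
theorem tape_blank (A : Set ℕ) (a : Fin r → ℕ) (t : ℕ) (j : Fin (m.work + 2)) (i : ℤ)
    (hi : (t : ℤ) < |i|) : ((m.run A a t).tape (Sum.inr j)).nth i = none := by
  induction t generalizing i with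
  | zero =>
    simp only [run, Function.iterate_zero, id, init, Sum.elim_inr]
    rcases i with (_ | i) | i <;> rfl
  | succ t ih =>
    rw [run_succ, step]
    push_cast at hi
    by_cases h : (m.run A a t).state = m.halt
    · rw [if_pos h]
      exact ih i (by omega)
    rw [if_neg h]
    by_cases h' : (m.run A a t).state = m.query
    · rw [if_pos h']
      exact ih i (by omega)
    · rw [if_neg h']
      have hw : ∀ (T : Turing.Tape (Option Bool)) (b : Option Bool) (i : ℤ), i ≠ 0 →
          (T.write b).nth i = T.nth i := fun T b i hi => by simp [Turing.Tape.write_nth, hi]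
      dsimp only
      split
      · rw [hw _ _ _ (by rintro rfl; simp at hi; omega)]
        exact ih i (by omega)
      · rename_i d _
        cases d
        · rw [Turing.Tape.move_left_nth, hw _ _ _ (by rintro h; simp [abs] at hi; omega)]
          exact ih _ (by rw [lt_abs] at *; omega)
        · rw [Turing.Tape.move_right_nth, hw _ _ _ (by rintro h; simp [abs] at hi; omega)]
          exact ih _ (by rw [lt_abs] at *; omega)

theorem readNat_size_le {T : Turing.Tape (Option Bool)} {t : ℕ}
    (h : ∀ i : ℤ, (t : ℤ) < |i| → T.nth i = none) : (readNat T).size ≤ t + 1 := by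
  rw [Nat.size_le, readNat]
  have hs : sInf {i : ℕ | T.nth i = none} ≤ t + 1 :=
    Nat.sInf_le (h _ (by rw [abs_of_nonneg (by positivity)]; push_cast; omega))
  generalize sInf {i : ℕ | T.nth i = none} = s at hs
  have hlt : ∀ s : ℕ, ∑ i ∈ Finset.range s, (if T.nth i = some true then 2 ^ i else 0) < 2 ^ s := by
    intro s
    induction s with
    | zero => simp
    | succ s ih =>
      rw [Finset.sum_range_succ, pow_succ]
      split_ifs <;> omega
  exact (hlt s).trans_le (Nat.pow_le_pow_right (by norm_num) hs)

/-- A polynomial time machine has polynomial query complexity and polynomially bounded output. -/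
theorem PolyTime.exists_bound {m : OracleTM r} (h : m.PolyTime) : ∃ p : Polynomial ℕ,
    ∀ a : Fin r → ℕ, QC (p.eval (∑ i, (a i).size)) (fun A => m.eval A a) ∧
      ∀ A, (m.eval A a).size ≤ p.eval (∑ i, (a i).size) := by
  obtain ⟨p, hp⟩ := h
  refine ⟨p + 1, fun a => ?_⟩
  have he : ∀ A, m.eval A a =
      readNat ((m.run A a (p.eval (∑ i, (a i).size))).tape (Sum.inr 0)) := fun A => by
    obtain ⟨t, ht, h⟩ := hp A a
    exact m.eval_eq ht h
  simp only [he, Polynomial.eval_add, Polynomial.eval_one]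
  exact ⟨((m.run_qc a _).map fun c => readNat (c.tape (Sum.inr 0))).mono (Nat.le_succ _),
    fun A => readNat_size_le fun i hi => m.tape_blank A a _ 0 i hi⟩

/-- The two runs agree step by step, since the state in which the oracle matters is never entered.
Consequently `PV` has the same interpretation in all `⟨ℕ, A⟩`. -/
theorem QueryFree.eval_eq {m : OracleTM r} (h : m.QueryFree) (A A' : Set ℕ) (a : Fin r → ℕ) :
    m.eval A a = m.eval A' a := by
  have hr : ∀ t, m.run A a t = m.run A' a t ∧ (m.run A a t).state ≠ m.query := by
    intro t
    induction t with
    | zero => exact ⟨rfl, h.1⟩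
    | succ t ih =>
      rw [run_succ, run_succ, ← ih.1]
      unfold step
      rw [if_neg ih.2, if_neg ih.2]
      by_cases h1 : (m.run A a t).state = m.halt
      · rw [if_pos h1]
        exact ⟨rfl, ih.2⟩
      · rw [if_neg h1]
        exact ⟨rfl, h.2 _ _⟩
  simp only [eval, fun t => (hr t).1]

end OracleTM

/-! ## Realization of terms and bounded quantifiers -/

/-- The total length of a tuple of numbers. -/
def sz {α : Type} [Fintype α] (w : α → ℕ) : ℕ := ∑ i, (w i).size

theorem sz_elim {α β : Type} [Fintype α] [Fintype β] (v : α → ℕ) (w : β → ℕ) :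
    sz (Sum.elim v w) = sz v + sz w := by
  simp [sz, Fintype.sum_sum_type]

theorem sz_snoc {n : ℕ} (v : Fin n → ℕ) (x : ℕ) :
    sz (Fin.snoc v x : Fin (n + 1) → ℕ) = sz v + x.size := by
  simp [sz, Fin.sum_univ_castSucc]

theorem size_le_sz {α : Type} [Fintype α] (w : α → ℕ) (i : α) : (w i).size ≤ sz w :=
  Finset.single_le_sum (f := fun i => (w i).size) (fun _ _ => Nat.zero_le _) (Finset.mem_univ i)

theorem realize_lastVar {N : Type} [PVα.Structure N] {β : Type} {n : ℕ} {v : β → N}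
    {xs : Fin n → N} {x : N} :
    (lastVar : PVα.Term (β ⊕ Fin (n + 1))).realize (Sum.elim v (Fin.snoc xs x)) = x := by
  simp [lastVar]

section Realize

variable {N : Type} [PV.Structure N] [PVα.Structure N] [PV.incl.IsExpansionOn N]
  {β : Type} {n : ℕ} {v : β → N} {xs : Fin n → N}

theorem relMap_lt_iff (a b : N) : Structure.RelMap PVα.ltSym ![a, b] ↔ ltN a b :=
  iff_of_eq (LHom.IsExpansionOn.map_onRelation (ϕ := PV.incl) (M := N) PVRel.lt ![a, b])

theorem realize_ltF {s t : PVα.Term (β ⊕ Fin n)} : (ltF s t).Realize v xs ↔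
    ltN (s.realize (Sum.elim v xs)) (t.realize (Sum.elim v xs)) := by
  rw [ltF, BoundedFormula.realize_rel₂, relMap_lt_iff]

theorem realize_boundTerm {t : PV.Term (β ⊕ Fin n)} {x : N} :
    (boundTerm t).realize (Sum.elim v (Fin.snoc xs x)) = t.realize (Sum.elim v xs) := by
  rw [boundTerm, LHom.realize_onTerm, Term.realize_relabel]
  congr 1
  funext i
  rcases i with i | i <;> simp

theorem realize_allLt {t : PV.Term (β ⊕ Fin n)} {φ : PVα.BoundedFormula β (n + 1)} :
    (allLt t φ).Realize v xs ↔
      ∀ x, ltN x (t.realize (Sum.elim v xs)) → φ.Realize v (Fin.snoc xs x) := by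
  simp only [allLt, BoundedFormula.realize_all, BoundedFormula.realize_imp, realize_ltF,
    realize_boundTerm, realize_lastVar]

theorem realize_exLt {t : PV.Term (β ⊕ Fin n)} {φ : PVα.BoundedFormula β (n + 1)} :
    (exLt t φ).Realize v xs ↔
      ∃ x, ltN x (t.realize (Sum.elim v xs)) ∧ φ.Realize v (Fin.snoc xs x) := by
  simp only [exLt, BoundedFormula.realize_ex, BoundedFormula.realize_inf, realize_ltF,
    realize_boundTerm, realize_lastVar]

end Realize

theorem PVα.standard_isExpansionOn (A : Set ℕ) :
    @LHom.IsExpansionOn PV PVα PV.incl ℕ PV.standard (PVα.standard A) :=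
  @LHom.IsExpansionOn.mk PV PVα PV.incl ℕ PV.standard (PVα.standard A)
    (fun f a => f.2.2.eval_eq A ∅ a)
    (fun R a => by cases R; rfl)

/-- The value of a term with oracle `A`. -/
noncomputable def tval (A : Set ℕ) {α : Type} (t : PVα.Term α) (w : α → ℕ) : ℕ :=
  @Term.realize PVα ℕ (PVα.standard A) α w t

/-- Truth of a formula with oracle `A`. -/
def fval (A : Set ℕ) {β : Type} {n : ℕ} (φ : PVα.BoundedFormula β n) (v : β → ℕ)
    (xs : Fin n → ℕ) : Prop :=
  @BoundedFormula.Realize PVα ℕ (PVα.standard A) β n φ v xs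

theorem fval_allLt {A : Set ℕ} {β : Type} {n : ℕ} {t : PV.Term (β ⊕ Fin n)}
    {φ : PVα.BoundedFormula β (n + 1)} {v : β → ℕ} {xs : Fin n → ℕ} :
    fval A (allLt t φ) v xs ↔ ∀ x < t.realize (Sum.elim v xs), fval A φ v (Fin.snoc xs x) := by
  let := PVα.standard A
  have := PVα.standard_isExpansionOn A
  exact realize_allLt

theorem fval_exLt {A : Set ℕ} {β : Type} {n : ℕ} {t : PV.Term (β ⊕ Fin n)}
    {φ : PVα.BoundedFormula β (n + 1)} {v : β → ℕ} {xs : Fin n → ℕ} :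
    fval A (exLt t φ) v xs ↔ ∃ x < t.realize (Sum.elim v xs), fval A φ v (Fin.snoc xs x) := by
  let := PVα.standard A
  have := PVα.standard_isExpansionOn A
  exact realize_exLt

theorem realize_len (κ : BasicSymbols) {α : Type} (t : PV.Term α) (w : α → ℕ) :
    (κ.len.apply₁ t).realize w = (t.realize w).size := by
  rw [Functions.apply₁, Term.realize_func, ← κ.len_spec]
  congr 1
  funext i
  fin_cases i
  rfl

/-! ## Query complexity of terms and sharply bounded formulas -/

/-- Depth and length have to be bounded together: the depth for the outer symbol is a polynomial in
the lengths of the inner values. -/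
theorem Term.exists_bound {α : Type} [Fintype α] (t : PVα.Term α) : ∃ p : Polynomial ℕ,
    ∀ w : α → ℕ, QC (p.eval (sz w)) (fun A => tval A t w) ∧
      ∀ A, (tval A t w).size ≤ p.eval (sz w) := by
  induction t with
  | var i => exact ⟨Polynomial.X, fun w => ⟨.const _ (w i), fun A => by
    rw [Polynomial.eval_X]
    exact size_le_sz w i⟩⟩
  | @func l f ts ih =>
    choose p hp using ih
    obtain ⟨q, hq⟩ := f.2.exists_bound
    refine ⟨∑ i, p i + q.comp (∑ i, p i), fun w => ?_⟩
    have hle : ∀ A, ∑ i, (tval A (ts i) w).size ≤ (∑ i, p i).eval (sz w) := fun A => by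
      rw [Polynomial.eval_finsetSum]
      exact Finset.sum_le_sum fun i _ => (hp i w).2 A
    constructor
    · rw [Polynomial.eval_add, Polynomial.eval_comp]
      have h1 := QC.pi (F := fun i A => tval A (ts i) w) fun i => (hp i w).1
      rw [← Polynomial.eval_finsetSum] at h1
      -- `QC.bind` wants a depth valid for every tuple, so the outer function is replaced by `0` on
      -- tuples that are too long to occur.
      have h2 : ∀ a : Fin l → ℕ, QC (q.eval ((∑ i, p i).eval (sz w))) (fun A =>
          if ∑ i, (a i).size ≤ (∑ i, p i).eval (sz w) then f.1.eval A a else 0) := fun a => by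
        split_ifs with h
        · exact (hq a).1.mono (q.eval_mono_nat h)
        · exact .const _ _
      convert h1.bind h2 using 2 with A
      rw [if_pos (hle A)]
      rfl
    · intro A
      rw [Polynomial.eval_add, Polynomial.eval_comp]
      exact (((hq _).2 A).trans (q.eval_mono_nat (hle A))).trans (Nat.le_add_left _ _)

theorem tval_incl (A : Set ℕ) {α : Type} (t : PV.Term α) (w : α → ℕ) :
    tval A (PV.incl.onTerm t) w = t.realize w := by
  let := PVα.standard A
  have := PVα.standard_isExpansionOn A
  exact LHom.realize_onTerm _ _ _

theorem PVTerm.exists_bound {α : Type} [Fintype α] (t : PV.Term α) : ∃ p : Polynomial ℕ,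
    ∀ w : α → ℕ, (t.realize w).size ≤ p.eval (sz w) := by
  obtain ⟨p, hp⟩ := Term.exists_bound (PV.incl.onTerm t)
  exact ⟨p, fun w => by simpa [tval_incl] using (hp w).2 ∅⟩

theorem IsAtomic.exists_qc {β : Type} [Fintype β] {n : ℕ} {φ : PVα.BoundedFormula β n}
    (h : φ.IsAtomic) : ∃ p : Polynomial ℕ, ∀ (v : β → ℕ) (xs : Fin n → ℕ),
      QC (p.eval (sz v + sz xs)) (fun A => fval A φ v xs) := by
  cases h with
  | equal t₁ t₂ =>
    obtain ⟨p, hp⟩ := Term.exists_bound t₁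
    obtain ⟨q, hq⟩ := Term.exists_bound t₂
    refine ⟨p + q, fun v xs => ?_⟩
    rw [Polynomial.eval_add, ← sz_elim]
    convert ((hp (Sum.elim v xs)).1.map₂ (hq (Sum.elim v xs)).1 fun a b => a = b) using 2 with A
    let := PVα.standard A
    exact BoundedFormula.realize_bdEqual (M := ℕ) t₁ t₂
  | @rel l R ts =>
    choose p hp using fun i => Term.exists_bound (ts i)
    refine ⟨∑ i, p i + 1, fun v xs => ?_⟩
    rw [Polynomial.eval_add, ← sz_elim, Polynomial.eval_finsetSum, Polynomial.eval_one]
    have h1 := QC.pi (F := fun i A => tval A (ts i) (Sum.elim v xs)) fun i => (hp i _).1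
    refine h1.bind (d' := 1) (G := fun a A => @Structure.RelMap PVα ℕ (PVα.standard A) l R a) ?_
    intro a
    cases R with
    | lt => exact .const _ _
    | alpha => exact QC.mem (a 0)

/-- A sharply bounded quantifier ranges over polynomially many numbers, so exhaustive search stays
polynomial. -/
theorem IsSharplyBounded.exists_qc {κ : BasicSymbols} {β : Type} [Fintype β] {n : ℕ}
    {φ : PVα.BoundedFormula β n} (h : IsSharplyBounded κ φ) : ∃ p : Polynomial ℕ,
      ∀ (v : β → ℕ) (xs : Fin n → ℕ), QC (p.eval (sz v + sz xs)) (fun A => fval A φ v xs) := by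
  -- The existential case for arbitrary functionals; the universal quantifier is reduced to it by
  -- negating twice.
  have ex : ∀ {n : ℕ} (t : PV.Term (β ⊕ Fin n)) (F : Set ℕ → (β → ℕ) → (Fin (n + 1) → ℕ) → Prop)
      (p : Polynomial ℕ), (∀ v xs, QC (p.eval (sz v + sz xs)) (fun A => F A v xs)) →
      ∃ p : Polynomial ℕ, ∀ (v : β → ℕ) (xs : Fin n → ℕ), QC (p.eval (sz v + sz xs))
        (fun A => ∃ x < (κ.len.apply₁ t).realize (Sum.elim v xs), F A v (Fin.snoc xs x)) := by
    intro n t F p hp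
    obtain ⟨q, hq⟩ := PVTerm.exists_bound t
    refine ⟨q * p.comp (Polynomial.X + q), fun v xs => ?_⟩
    have hb : (κ.len.apply₁ t).realize (Sum.elim v xs) ≤ q.eval (sz v + sz xs) := by
      rw [realize_len, ← sz_elim]
      exact hq _
    refine (QC.exists_lt _ (d := p.eval (sz v + sz xs + q.eval (sz v + sz xs))) fun x hx =>
      (hp v (Fin.snoc xs x)).mono ?_).mono ?_
    · refine p.eval_mono_nat ?_
      rw [sz_snoc]
      have : x.size ≤ x := Nat.size_le.2 Nat.lt_two_pow_self
      omega
    · rw [Polynomial.eval_mul, Polynomial.eval_comp]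
      simpa using Nat.mul_le_mul_right _ hb
  induction h with
  | falsum => exact ⟨0, fun v xs => .const _ _⟩
  | atomic h => exact IsAtomic.exists_qc h
  | imp _ _ ih₁ ih₂ =>
    obtain ⟨p, hp⟩ := ih₁
    obtain ⟨q, hq⟩ := ih₂
    refine ⟨p + q, fun v xs => ?_⟩
    rw [Polynomial.eval_add]
    exact (hp v xs).map₂ (hq v xs) fun a b => a → b
  | all t _ ih =>
    obtain ⟨p, hp⟩ := ih
    obtain ⟨q, hq⟩ := ex t _ p fun v xs => (hp v xs).map Not
    refine ⟨q, fun v xs => ?_⟩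
    convert (hq v xs).map Not using 2 with A
    rw [fval_allLt]
    push Not
    rfl
  | ex t _ ih =>
    obtain ⟨p, hp⟩ := ih
    obtain ⟨q, hq⟩ := ex t _ p hp
    refine ⟨q, fun v xs => ?_⟩
    simpa only [fval_exLt] using hq v xs

/-! ## Injectivity of the sequence coding -/

theorem List.eq_of_append_cons_eq {α : Type} {a : α} {x y r s : List α} (hx : a ∉ x)
    (hy : a ∉ y) (h : x ++ a :: r = y ++ a :: s) : x = y ∧ r = s := by
  induction x generalizing y with
  | nil =>
    cases y with
    | nil => simpa using h
    | cons b y => simp at h; simp [h.1] at hy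
  | cons c x ih =>
    cases y with
    | nil => simp at h; simp [h.1] at hx
    | cons b y =>
      simp only [List.cons_append, List.cons.injEq, List.mem_cons, not_or] at h hx hy
      obtain ⟨h1, h2⟩ := ih hx.2 hy.2 h.2
      exact ⟨by rw [h.1, h1], h2⟩

/-- The digit `2` never occurs among binary digits, so it separates the entries and the digit string
can be parsed from the left. -/
theorem seqCode_injective : Function.Injective seqCode := by
  have hd : ∀ l : List ℕ, Nat.digits 4 (seqCode l) =
      (l.flatMap fun n => (Nat.digits 2 n) ++ [2]) ++ [3] := by
    intro l
    refine Nat.digits_ofDigits 4 (by norm_num) _ ?_ (by simp)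
    intro x hx
    simp only [List.mem_append, List.mem_flatMap, List.mem_singleton] at hx
    rcases hx with ⟨n, _, hx | rfl⟩ | rfl
    · exact (Nat.digits_lt_base (by norm_num) hx).trans (by norm_num)
    · norm_num
    · norm_num
  intro l l' h
  replace h := (hd l).symm.trans ((congrArg _ h).trans (hd l'))
  rw [List.append_left_inj] at h
  have h2 : ∀ n, 2 ∉ Nat.digits 2 n := fun n hn =>
    absurd (Nat.digits_lt_base (by norm_num) hn) (by norm_num)
  induction l generalizing l' with
  | nil => cases l' with
    | nil => rfl
    | cons b l' => simp at h
  | cons a l ih => cases l' with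
    | nil => simp at h
    | cons b l' =>
      simp only [List.flatMap_cons, List.append_assoc, List.singleton_append] at h
      obtain ⟨h1, h3⟩ := List.eq_of_append_cons_eq (h2 a) (h2 b) h
      rw [Nat.digits_inj_iff.1 h1, ih h3]

theorem seqEntry_seqCode (l : List ℕ) (i : ℕ) : seqEntry (seqCode l) i = l.getD i 0 := by
  have h : ∃ l', seqCode l' = seqCode l := ⟨l, rfl⟩
  rw [seqEntry, dif_pos h, seqCode_injective h.choose_spec]

/-! ## Facts about structures on an initial segment, and oracles coding them -/

/-- An atomic fact about an `L`-structure on a set of numbers. -/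
inductive AtomFact (L : FirstOrder.Language.{0, 0}) : Type
  | rel {r : ℕ} (R : L.Relations r) (a : Fin r → ℕ) (v : Bool)
  | fn {r : ℕ} (f : L.Functions r) (a : Fin r → ℕ) (b : ℕ)

namespace AtomFact

variable {L : FirstOrder.Language.{0, 0}}

/-- Countability lets finite sets of facts be coded by numbers, so that a sequence of conditions
becomes an element of the ultrapower. -/
instance [Countable L.Symbols] : Countable (AtomFact L) := by
  let F : AtomFact L → L.Symbols × List ℕ × ℕ := fun x => match x with
    | @rel _ r R a v => (.inr ⟨r, R⟩, List.ofFn a, v.toNat)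
    | @fn _ r f a b => (.inl ⟨r, f⟩, List.ofFn a, b)
  refine Function.Injective.countable (f := F) ?_
  rintro (⟨R, a, v⟩ | ⟨f, a, b⟩) (⟨R', a', v'⟩ | ⟨f', a', b'⟩) h <;>
    simp only [F, Prod.mk.injEq, Sum.inr.injEq, Sum.inl.injEq, Sigma.mk.injEq, reduceCtorEq,
      false_and] at h
  · obtain ⟨⟨rfl, h1⟩, h2, h3⟩ := h
    rw [List.ofFn_injective h2, eq_of_heq h1]
    congr 1
    revert h3; cases v <;> cases v' <;> simp
  · obtain ⟨⟨rfl, h1⟩, h2, h3⟩ := h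
    rw [List.ofFn_injective h2, eq_of_heq h1, h3]

/-- The numbers occurring in a fact. -/
noncomputable def supp : AtomFact L → Finset ℕ
  | rel _ a _ => Finset.univ.image a
  | fn _ a b => insert b (Finset.univ.image a)

/-- The fact holds in the structure obtained by pulling back `S` along `e`. -/
def Holds {B : Type} (S : L.Structure B) (e : ℕ → B) : AtomFact L → Prop
  | rel R a v => S.RelMap R (e ∘ a) ↔ v = true
  | fn f a b => S.funMap f (e ∘ a) = e b

theorem Holds.congr {B : Type} {S : L.Structure B} {e e' : ℕ → B} {x : AtomFact L}
    (h : ∀ i ∈ x.supp, e i = e' i) (hx : x.Holds S e) : x.Holds S e' := by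
  cases x with
  | rel R a v =>
    have : e ∘ a = e' ∘ a := funext fun i => h _ (by simp [supp])
    simpa [Holds, this] using hx
  | fn f a b =>
    have h1 : e ∘ a = e' ∘ a := funext fun i => h _ (by simp [supp])
    have h2 : e b = e' b := h _ (by simp [supp])
    simpa [Holds, h1, h2] using hx

end AtomFact

theorem symArity_le_sum {L : FirstOrder.Language.{0, 0}} [Fintype L.Symbols] (s : L.Symbols) :
    symArity s ≤ ∑ s : L.Symbols, symArity s :=
  Finset.single_le_sum (f := fun s : L.Symbols => symArity s) (fun _ _ => Nat.zero_le _)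
    (Finset.mem_univ s)

/-- One more than the sum of the arities of the symbols. -/
def width (L : FirstOrder.Language.{0, 0}) [Fintype L.Symbols] : ℕ :=
  ∑ s : L.Symbols, symArity s + 1

theorem rel_arity_lt {L : FirstOrder.Language.{0, 0}} [Fintype L.Symbols] {r : ℕ}
    (R : L.Relations r) : r < width L :=
  Nat.lt_succ_of_le (symArity_le_sum (.inr ⟨r, R⟩ : L.Symbols))

theorem fn_arity_lt {L : FirstOrder.Language.{0, 0}} [Fintype L.Symbols] {r : ℕ}
    (f : L.Functions r) : r < width L :=
  Nat.lt_succ_of_le (symArity_le_sum (.inl ⟨r, f⟩ : L.Symbols))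

theorem AtomFact.card_supp_le {L : FirstOrder.Language.{0, 0}} [Fintype L.Symbols] (x : AtomFact L) :
    x.supp.card ≤ width L := by
  cases x with
  | @rel r R a v =>
    exact Finset.card_image_le.trans (by simpa using (rel_arity_lt R).le)
  | @fn r f a b =>
    refine (Finset.card_insert_le _ _).trans ?_
    have : (Finset.univ.image a).card ≤ r := Finset.card_image_le.trans (by simp)
    have := fn_arity_lt f
    omega

section Oracles

variable {L : FirstOrder.Language.{0, 0}} (code : L.Symbols → ℕ)

/-- The query `⟨R, ā⟩`. -/
def relQ {r : ℕ} (R : L.Relations r) (a : Fin r → ℕ) : ℕ :=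
  seqCode (List.ofFn (Fin.cons (code (.inr ⟨r, R⟩)) a : Fin (r + 1) → ℕ))

/-- The query `⟨f, ā, i⟩`. -/
def fnQ {r : ℕ} (f : L.Functions r) (a : Fin r → ℕ) (i : ℕ) : ℕ :=
  seqCode (List.ofFn (Fin.cons (code (.inl ⟨r, f⟩))
    (Fin.snoc a i : Fin (r + 1) → ℕ) : Fin (r + 2) → ℕ))

variable {code}

theorem relQ_inj (hc : Function.Injective code) {r r' : ℕ} {R : L.Relations r}
    {R' : L.Relations r'} {a : Fin r → ℕ} {a' : Fin r' → ℕ} (h : relQ code R a = relQ code R' a') :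
    r = r' ∧ R ≍ R' ∧ a ≍ a' := by
  have h := seqCode_injective h
  simp only [List.ofFn_succ, Fin.cons_zero, Fin.cons_succ, List.cons.injEq] at h
  have h1 := hc h.1
  simp only [Sum.inr.injEq, Sigma.mk.injEq] at h1
  obtain ⟨rfl, h1⟩ := h1
  exact ⟨rfl, h1, heq_of_eq (List.ofFn_injective h.2)⟩

theorem fnQ_inj (hc : Function.Injective code) {r r' : ℕ} {f : L.Functions r}
    {f' : L.Functions r'} {a : Fin r → ℕ} {a' : Fin r' → ℕ} {i i' : ℕ}
    (h : fnQ code f a i = fnQ code f' a' i') :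
    r = r' ∧ f ≍ f' ∧ a ≍ a' ∧ i = i' := by
  have h := seqCode_injective h
  rw [List.ofFn_succ, List.ofFn_succ (n := r' + 1)] at h
  simp only [Fin.cons_zero, Fin.cons_succ, List.cons.injEq] at h
  have h1 := hc h.1
  simp only [Sum.inl.injEq, Sigma.mk.injEq] at h1
  obtain ⟨rfl, h1⟩ := h1
  obtain ⟨h2, h3⟩ := Fin.snoc_injective2 (List.ofFn_injective h.2)
  exact ⟨rfl, h1, heq_of_eq h2, h3⟩

theorem relQ_ne_fnQ (hc : Function.Injective code) {r r' : ℕ} {R : L.Relations r}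
    {f : L.Functions r'} {a : Fin r → ℕ} {a' : Fin r' → ℕ} {i : ℕ} :
    relQ code R a ≠ fnQ code f a' i := by
  intro h
  have h := seqCode_injective h
  rw [List.ofFn_succ, List.ofFn_succ (n := r' + 1)] at h
  simp only [Fin.cons_zero, Fin.cons_succ, List.cons.injEq] at h
  simpa using hc h.1

variable (code)

/-- The number is a query about a structure with universe `[n]`. -/
def Live (n u : ℕ) : Prop :=
  (∃ (r : ℕ) (R : L.Relations r) (a : Fin r → ℕ), (∀ i, a i < n) ∧ u = relQ code R a) ∨
  ∃ (r : ℕ) (f : L.Functions r) (a : Fin r → ℕ) (i : ℕ),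
    (∀ i, a i < n) ∧ i < n.size ∧ u = fnQ code f a i

/-- The oracle gives the answers determined by the fact. -/
def AtomFact.Agrees (n : ℕ) (A : Set ℕ) : AtomFact L → Prop
  | .rel R a v => relQ code R a ∈ A ↔ v = true
  | .fn f a b => ∀ i < n.size, (fnQ code f a i ∈ A ↔ b.testBit i = true)

/-- The oracle codes a structure on `[n]` of which the facts in `p` are true. -/
def Compat (n : ℕ) (A : Set ℕ) (p : Finset (AtomFact L)) : Prop :=
  (∀ x ∈ p, x.Agrees code n A) ∧ ∀ u ∈ A, Live code n u

/-- The facts in `p` determine the value of the functional. -/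
def Forces {X : Type} (n : ℕ) (p : Finset (AtomFact L)) (F : Set ℕ → X) (x : X) : Prop :=
  ∀ A, Compat code n A p → F A = x

/-- The binary code of the structure on `[n]` pulled back along `e`. -/
def oracleOf {B : Type} (S : L.Structure B) (n : ℕ) (e : ℕ → B) : Set ℕ :=
  {u | (∃ (r : ℕ) (R : L.Relations r) (a : Fin r → ℕ), (∀ i, a i < n) ∧ u = relQ code R a ∧
      S.RelMap R (e ∘ a)) ∨
    ∃ (r : ℕ) (f : L.Functions r) (a : Fin r → ℕ) (i b : ℕ), (∀ i, a i < n) ∧ i < n.size ∧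
      b < n ∧ S.funMap f (e ∘ a) = e b ∧ b.testBit i = true ∧ u = fnQ code f a i}

variable {code}

theorem Compat.mono {n : ℕ} {A : Set ℕ} {p q : Finset (AtomFact L)} (h : Compat code n A q)
    (hp : p ⊆ q) : Compat code n A p :=
  ⟨fun x hx => h.1 x (hp hx), h.2⟩

variable {B : Type} {S : L.Structure B} {n : ℕ} {e : ℕ → B}

theorem relQ_mem_oracleOf (hc : Function.Injective code) {r : ℕ} {R : L.Relations r}
    {a : Fin r → ℕ} (ha : ∀ i, a i < n) :
    relQ code R a ∈ oracleOf code S n e ↔ S.RelMap R (e ∘ a) := by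
  constructor
  · rintro (⟨r', R', a', _, h, hR⟩ | ⟨r', f, a', i, b, _, _, _, _, _, h⟩)
    · obtain ⟨rfl, h1, h2⟩ := relQ_inj hc h
      cases h1; cases h2; exact hR
    · exact absurd h (relQ_ne_fnQ hc)
  · exact fun h => .inl ⟨r, R, a, ha, rfl, h⟩

theorem fnQ_mem_oracleOf (hc : Function.Injective code) (he : Set.InjOn e (Set.Iio n)) {r : ℕ}
    {f : L.Functions r} {a : Fin r → ℕ} (ha : ∀ i, a i < n) {b i : ℕ} (hb : b < n)
    (hi : i < n.size) (h : S.funMap f (e ∘ a) = e b) :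
    fnQ code f a i ∈ oracleOf code S n e ↔ b.testBit i = true := by
  constructor
  · rintro (⟨r', R', a', _, h', hR⟩ | ⟨r', f', a', i', b', _, _, hb', hf, ht, h'⟩)
    · exact absurd h'.symm (relQ_ne_fnQ hc)
    · obtain ⟨rfl, h1, h2, rfl⟩ := fnQ_inj hc h'
      cases h1; cases h2
      rw [h] at hf
      rwa [he hb hb' hf]
  · exact fun h' => .inr ⟨r, f, a, i, b, ha, hi, hb, h, h', rfl⟩

/-- Injectivity of `e` on `[n]` makes the number naming a function value unique, so the digits in
the oracle are those of the fact. Values outside the image of `[n]` contribute no digits, but no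
fact in `p` speaks about them. -/
theorem compat_oracleOf (hc : Function.Injective code) (he : Set.InjOn e (Set.Iio n))
    {p : Finset (AtomFact L)} (hp : ∀ x ∈ p, x.Holds S e ∧ ∀ i ∈ x.supp, i < n) :
    Compat code n (oracleOf code S n e) p := by
  constructor
  · intro x hx
    obtain ⟨h1, h2⟩ := hp x hx
    cases x with
    | rel R a v =>
      exact (relQ_mem_oracleOf hc fun i => h2 _ (by simp [AtomFact.supp])).trans h1
    | fn f a b =>
      exact fun i hi => fnQ_mem_oracleOf hc he (fun i => h2 _ (by simp [AtomFact.supp]))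
        (h2 b (by simp [AtomFact.supp])) hi h1
  · rintro u (⟨r', R', a', h, h', hR⟩ | ⟨r', f', a', i', b', h, hi, hb', hf, ht, h'⟩)
    · exact .inl ⟨r', R', a', h, h'⟩
    · exact .inr ⟨r', f', a', i', h, hi, h'⟩

variable (S) in
/-- The set of facts is true in a structure on `[n]` that is pulled back along an injection. -/
def Good (n : ℕ) (p : Finset (AtomFact L)) : Prop :=
  ∃ e : ℕ → B, Set.InjOn e (Set.Iio n) ∧ ∀ x ∈ p, x.Holds S e ∧ ∀ i ∈ x.supp, i < n

theorem Good.mono {p q : Finset (AtomFact L)} (h : Good S n q) (hp : p ⊆ q) : Good S n p :=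
  let ⟨e, he, h⟩ := h
  ⟨e, he, fun x hx => h x (hp hx)⟩

theorem Good.exists_compat (hc : Function.Injective code) {p : Finset (AtomFact L)}
    (h : Good S n p) : ∃ A, Compat code n A p :=
  let ⟨e, he, h⟩ := h
  ⟨oracleOf code S n e, compat_oracleOf hc he h⟩

theorem good_empty [Infinite B] : Good S n ∅ :=
  ⟨Infinite.natEmbedding B, (Infinite.natEmbedding B).injective.injOn, by simp⟩

end Oracles

/-! ## Extending conditions -/

section Extension

open Classical

variable {L : FirstOrder.Language.{0, 0}} [Fintype L.Symbols] {code : L.Symbols → ℕ}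
  {B : Type} {S : L.Structure B} {n : ℕ} {p : Finset (AtomFact L)}

theorem card_biUnion_supp_le (p : Finset (AtomFact L)) : (p.biUnion AtomFact.supp).card ≤ p.card * width L :=
  Finset.card_biUnion_le_card_mul _ _ _ fun x _ => x.card_supp_le

/-- A condition can be extended by a value of a function. -/
theorem Good.exists_fn (hp : Good S n p) (hn : (p.card + 1) * width L ≤ n) {r : ℕ}
    (f : L.Functions r) (a : Fin r → ℕ) (ha : ∀ i, a i < n) :
    ∃ b < n, Good S n (insert (AtomFact.fn f a b) p) := by
  obtain ⟨e, he, hp⟩ := hp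
  by_cases h : ∃ b < n, S.funMap f (e ∘ a) = e b
  · obtain ⟨b, hb, h⟩ := h
    refine ⟨b, hb, e, he, fun x hx => ?_⟩
    rcases Finset.mem_insert.1 hx with rfl | hx
    · refine ⟨h, fun i hi => ?_⟩
      simp only [AtomFact.supp, Finset.mem_insert, Finset.mem_image, Finset.mem_univ, true_and] at hi
      rcases hi with rfl | ⟨j, rfl⟩
      exacts [hb, ha j]
    · exact hp x hx
  · push Not at h
    -- The value lies outside the image of `[n]`. By counting, some `b` occurs neither in `p` nor in
    -- `a`; sending `b` to the value disturbs no fact of `p` and keeps the map injective.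
    let D := p.biUnion AtomFact.supp ∪ Finset.univ.image a
    have hD : D.card < n := by
      refine (Finset.card_union_le _ _).trans_lt ?_
      have h1 := card_biUnion_supp_le p
      have h2 : (Finset.univ.image a).card ≤ r := Finset.card_image_le.trans (by simp)
      have h3 := fn_arity_lt f
      rw [Nat.succ_mul] at hn
      omega
    obtain ⟨b, hb, hbD⟩ : ∃ b ∈ Finset.range n, b ∉ D :=
      Finset.exists_mem_notMem_of_card_lt_card (by simpa using hD)
    rw [Finset.mem_range] at hb
    simp only [D, Finset.mem_union, not_or, Finset.mem_biUnion, not_exists, not_and,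
      Finset.mem_image, Finset.mem_univ, true_and] at hbD
    let e' := Function.update e b (S.funMap f (e ∘ a))
    have he' : ∀ i, i ≠ b → e i = e' i := fun i hi => by simp [e', hi]
    refine ⟨b, hb, e', ?_, fun x hx => ?_⟩
    · intro i hi j hj hij
      by_cases hib : i = b <;> by_cases hjb : j = b
      · rw [hib, hjb]
      · subst hib
        rw [← he' j hjb] at hij
        exact absurd (by simpa [e'] using hij) (h j hj)
      · subst hjb
        rw [← he' i hib] at hij
        exact absurd (by simpa [e'] using hij.symm) (h i hi)
      · rw [← he' i hib, ← he' j hjb] at hij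
        exact he hi hj hij
    · rcases Finset.mem_insert.1 hx with rfl | hx
      · refine ⟨?_, fun i hi => ?_⟩
        · have : e' ∘ a = e ∘ a := funext fun i => (he' _ fun hi => hbD.2 i hi).symm
          change S.funMap f (e' ∘ a) = e' b
          rw [this]
          simp [e']
        · simp only [AtomFact.supp, Finset.mem_insert, Finset.mem_image, Finset.mem_univ,
            true_and] at hi
          rcases hi with rfl | ⟨j, rfl⟩
          exacts [hb, ha j]
      · exact ⟨(hp x hx).1.congr fun i hi => he' i fun hib => hbD.1 x hx (hib ▸ hi), (hp x hx).2⟩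

/-- A condition can be extended so that it answers a query. -/
theorem Good.exists_query (hp : Good S n p) (hn : (p.card + 1) * width L ≤ n)
    (u : ℕ) : ∃ x : Finset (AtomFact L), x.card ≤ 1 ∧ Good S n (p ∪ x) ∧
      ∃ v : Prop, ∀ A, Compat code n A x → (u ∈ A ↔ v) := by
  by_cases hu : Live code n u
  · rcases hu with ⟨r, R, a, ha, rfl⟩ | ⟨r, f, a, i, ha, hi, rfl⟩
    -- Relations are total, so the embedding at hand already supplies the answer.
    · obtain ⟨e, he, hp⟩ := hp
      refine ⟨{.rel R a (decide (S.RelMap R (e ∘ a)))}, by simp, ⟨e, he, fun x hx => ?_⟩,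
        S.RelMap R (e ∘ a), fun A hA => ?_⟩
      · rw [Finset.mem_union, Finset.mem_singleton] at hx
        rcases hx with hx | rfl
        · exact hp x hx
        · refine ⟨by simp [AtomFact.Holds], fun i hi => ?_⟩
          simp only [AtomFact.supp, Finset.mem_image, Finset.mem_univ, true_and] at hi
          obtain ⟨j, rfl⟩ := hi
          exact ha j
      · have := hA.1 _ (Finset.mem_singleton_self _)
        simpa [AtomFact.Agrees] using this
    · obtain ⟨b, hb, h⟩ := hp.exists_fn hn f a ha
      refine ⟨{.fn f a b}, by simp, by rwa [Finset.union_comm, ← Finset.insert_eq],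
        b.testBit i = true, fun A hA => ?_⟩
      exact hA.1 _ (Finset.mem_singleton_self _) i hi
  -- A number that is not a query about `[n]` belongs to no compatible oracle, hence the answer
  -- costs no fact.
  · exact ⟨∅, by simp, by simpa using hp, False, fun A hA => iff_of_false
      (fun h => hu (hA.2 u h)) id⟩

/-- A condition can be extended so that it determines the value of a functional. -/
theorem Good.exists_forces {X : Type} {d : ℕ} {F : Set ℕ → X} (hF : QC d F) :
    ∀ p : Finset (AtomFact L), Good S n p → (p.card + d) * width L ≤ n →
    ∃ q : Finset (AtomFact L), q.card ≤ d ∧ Good S n (p ∪ q) ∧ ∃ x, Forces code n q F x := by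
  induction hF with
  | const d x => exact fun p hp _ => ⟨∅, by simp, by simpa using hp, x, fun _ _ => rfl⟩
  | @query d u F₁ F₀ F _ _ h₁ h₀ ih₁ ih₀ =>
    intro p hp hn
    obtain ⟨y, hy, hg, v, hv⟩ := hp.exists_query (code := code)
      ((Nat.mul_le_mul_right _ (by omega)).trans hn) u
    have hcard : ((p ∪ y).card + d) * width L ≤ n :=
      (Nat.mul_le_mul_right _ (by have := Finset.card_union_le p y; omega)).trans hn
    have key : ∀ q : Finset (AtomFact L), q.card ≤ d → (y ∪ q).card ≤ d + 1 := fun q hq => by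
      have := Finset.card_union_le y q
      omega
    by_cases hv' : v
    · obtain ⟨q, hq, hg', x, hx⟩ := ih₁ (p ∪ y) hg hcard
      refine ⟨y ∪ q, key q hq, by rwa [← Finset.union_assoc], x, fun A hA => ?_⟩
      rw [h₁ A ((hv A (hA.mono Finset.subset_union_left)).2 hv')]
      exact hx A (hA.mono Finset.subset_union_right)
    · obtain ⟨q, hq, hg', x, hx⟩ := ih₀ (p ∪ y) hg hcard
      refine ⟨y ∪ q, key q hq, by rwa [← Finset.union_assoc], x, fun A hA => ?_⟩
      rw [h₀ A fun h => hv' ((hv A (hA.mono Finset.subset_union_left)).1 h)]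
      exact hx A (hA.mono Finset.subset_union_right)

end Extension

/-! ## Layers of a large structure -/

section Layers

open Classical

variable {L : FirstOrder.Language.{0, 0}} {B : Type} {S : L.Structure B} {g : ℕ → ℕ}

/-- A finite part of a large structure embeds into the bottom of a sequence of finite sets, each of
which is mapped into the next one by all functions, and which grows slowly. -/
theorem IsLarge.exists_layers (hL : IsLarge S g) (hg : Monotone g) {A₀ : Finset B}
    (hne : A₀.Nonempty) {n : ℕ} : ∀ t : ℕ, A₀.card + t * g n ≤ n →
    ∃ (lev : ℕ → Finset B) (ε : B → B), Set.InjOn ε A₀ ∧ lev 0 = A₀.image ε ∧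
      (∀ i ≤ t, lev 0 ⊆ lev i) ∧ (∀ i < t, lev i ⊆ lev (i + 1)) ∧ (∀ i ≤ t, lev i ⊆ lev t) ∧
      (∀ i < t, ∀ (r : ℕ) (f : L.Functions r) (a : Fin r → B), (∀ j, a j ∈ lev i) →
        S.funMap f a ∈ lev (i + 1)) ∧
      (lev t).card ≤ A₀.card + t * g n ∧
      (∀ (r : ℕ) (R : L.Relations r) (a : Fin r → B), (∀ j, a j ∈ A₀) →
        (S.RelMap R (ε ∘ a) ↔ S.RelMap R a)) ∧
      (∀ (r : ℕ) (f : L.Functions r) (a : Fin r → B), (∀ j, a j ∈ A₀) → S.funMap f a ∈ A₀ →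
        S.funMap f (ε ∘ a) = ε (S.funMap f a)) := by
  intro t
  induction t with
  | zero =>
    intro _
    refine ⟨fun _ => A₀, id, Set.injOn_id _, by simp, ?_, ?_, ?_, ?_, ?_, ?_, ?_⟩ <;> simp
  | succ t ih =>
    intro hn
    obtain ⟨lev, ε, hε, h0, hb, hs, ht, hf, hc, hR, hF⟩ := ih (by rw [Nat.succ_mul] at hn; omega)
    have hX : (lev t).Nonempty := (hne.image ε).mono (h0 ▸ hb t le_rfl)
    -- Largeness is applied to the structure induced on the whole top layer: the embedding `δ` then
    -- transports the entire tower, and `B₀ ∪ V` becomes the new top.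
    obtain ⟨B₀, hB, ⟨V, -, hV, hVf⟩, e, he, heF, heR⟩ :=
      hL (lev t) hX (PartialStr.induced S (lev t : Set B)) (by
        refine ⟨Subtype.val_injective, fun f a b h => ?_, fun R a v h => ?_⟩
        · simp only [PartialStr.induced] at h
          split at h
          · simp only [Option.some.injEq] at h
            subst h
            rfl
          · simp at h
        · simp only [PartialStr.induced] at h
          exact h)
    let δ : B → B := fun b => if h : b ∈ lev t then (e ⟨b, h⟩ : B) else b
    have hδ : ∀ b (h : b ∈ lev t), δ b = e ⟨b, h⟩ := fun b h => dif_pos h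
    have hδi : Set.InjOn δ (lev t) := fun a ha b hb hab => by
      rw [hδ a ha, hδ b hb] at hab
      exact congrArg Subtype.val (he (Subtype.ext hab))
    -- Equality of cardinalities makes the embedding surjective, so that `V` captures the values on
    -- the transported top layer.
    have him : (lev t).image δ = B₀ := by
      refine Finset.eq_of_subset_of_card_le ?_ ?_
      · intro y hy
        obtain ⟨b, hb, rfl⟩ := Finset.mem_image.1 hy
        rw [hδ b hb]
        exact (e ⟨b, hb⟩).2
      · rw [Finset.card_image_of_injOn hδi, hB]
    have hδF : ∀ (r : ℕ) (f : L.Functions r) (a : Fin r → B), (∀ j, a j ∈ lev t) →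
        S.funMap f a ∈ lev t → S.funMap f (δ ∘ a) = δ (S.funMap f a) := fun r f a ha hfa => by
      have h1 := heF f (fun j => ⟨a j, ha j⟩) ⟨S.funMap f a, hfa⟩ (by
        simp only [PartialStr.induced]
        exact dif_pos hfa)
      simp only [PartialStr.induced] at h1
      split at h1
      · rw [hδ _ hfa, ← Option.some.inj h1]
        congr 1
        funext j
        exact hδ _ (ha j)
      · simp at h1
    have hδR : ∀ (r : ℕ) (R : L.Relations r) (a : Fin r → B), (∀ j, a j ∈ lev t) →
        (S.RelMap R (δ ∘ a) ↔ S.RelMap R a) := fun r R a ha => by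
      have h1 := heR R (fun j => ⟨a j, ha j⟩) (decide (S.RelMap R a)) rfl
      simp only [PartialStr.induced, Option.some.injEq, decide_eq_decide] at h1
      rw [← h1]
      have : δ ∘ a = fun j => ((e ⟨a j, ha j⟩ : {b // b ∈ (B₀ : Set B)}) : B) :=
        funext fun j => hδ _ (ha j)
      rw [this]
      rfl
    have hA : ∀ b ∈ A₀, ε b ∈ lev t := fun b h => hb t le_rfl (h0 ▸ Finset.mem_image_of_mem ε h)
    refine ⟨fun i => if i ≤ t then (lev i).image δ else B₀ ∪ V, δ ∘ ε, ?_, ?_, ?_, ?_, ?_, ?_, ?_,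
      ?_, ?_⟩
    · exact hδi.comp hε fun b h => hA b h
    · simp [h0, Finset.image_image]
    · intro i hi
      simp only [Nat.zero_le, if_true]
      split_ifs with h
      · exact Finset.image_subset_image (hb i h)
      · exact (Finset.image_subset_image (hb t le_rfl)).trans (him ▸ Finset.subset_union_left)
    · intro i hi
      simp only [Nat.le_of_lt_succ hi, if_true]
      split_ifs with h
      · exact Finset.image_subset_image (hs i h)
      · exact (Finset.image_subset_image (ht i (by omega))).trans
          (him ▸ Finset.subset_union_left)
    · intro i hi
      simp only [show ¬ t + 1 ≤ t by omega, if_false]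
      split_ifs with h
      · exact (Finset.image_subset_image (ht i h)).trans (him ▸ Finset.subset_union_left)
      · exact subset_rfl
    · intro i hi r f a ha
      simp only [Nat.le_of_lt_succ hi, if_true] at ha
      by_cases h : i + 1 ≤ t
      · simp only [h, if_true]
        choose b hb hab using fun j => Finset.mem_image.1 (ha j)
        have : a = δ ∘ b := funext fun j => (hab j).symm
        rw [this, hδF r f b (fun j => ht i (by omega) (hb j))
          (ht _ h (hf i (by omega) r f b hb))]
        exact Finset.mem_image_of_mem _ (hf i (by omega) r f b hb)
      · simp only [h, if_false, Finset.mem_union]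
        obtain rfl : i = t := by omega
        exact hVf r f a fun j => him ▸ ha j
    · simp only [show ¬ t + 1 ≤ t by omega, if_false]
      refine (Finset.card_union_le _ _).trans ?_
      rw [hB, Nat.succ_mul, ← add_assoc]
      -- The increment is `g` of the size of the previous layer; that size is at most `n`, and
      -- monotonicity replaces the increment by `g n`.
      refine Nat.add_le_add hc (hV.trans (hg ?_))
      rw [hB]
      rw [Nat.succ_mul] at hn
      omega
    · intro r R a ha
      rw [← hR r R a ha]
      exact hδR r R (ε ∘ a) fun j => hA _ (ha j)
    · intro r f a ha hfa
      have h1 := hF r f a ha hfa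
      rw [Function.comp_assoc, hδF r f (ε ∘ a) (fun j => hA _ (ha j)) (h1 ▸ hA _ hfa), h1]
      rfl

end Layers

/-! ## Random permutations with prescribed values -/

section Perm

open Classical

variable {n : ℕ}

/-- The permutations with prescribed values. -/
noncomputable def permsExtending (D : Finset (Fin n × Fin n)) : Finset (Equiv.Perm (Fin n)) :=
  Finset.univ.filter fun π => ∀ c ∈ D, π c.1 = c.2

theorem mem_permsExtending {D : Finset (Fin n × Fin n)} {π : Equiv.Perm (Fin n)} :
    π ∈ permsExtending D ↔ ∀ c ∈ D, π c.1 = c.2 := by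
  simp [permsExtending]

theorem mem_permsExtending_insert {D : Finset (Fin n × Fin n)} {π : Equiv.Perm (Fin n)}
    {x y : Fin n} :
    π ∈ permsExtending (insert (x, y) D) ↔ π x = y ∧ π ∈ permsExtending D := by
  simp [mem_permsExtending]

/-- Composition with the transposition of `y` and another free value `y'` injects the permutations
with `π x = y` into those with `π x = y'`. At least `w` values are free, so a single value has
probability at most `1 / w`. -/
theorem card_permsExtending_insert_le {D : Finset (Fin n × Fin n)} {x : Fin n}
    (hx : ∀ c ∈ D, c.1 ≠ x) (y : Fin n) {w : ℕ} (hw : D.card + w ≤ n) :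
    (permsExtending (insert (x, y) D)).card * w ≤ (permsExtending D).card := by
  rcases (permsExtending (insert (x, y) D)).eq_empty_or_nonempty with h | ⟨π, hπ⟩
  · simp [h]
  let Y : Finset (Fin n) := (D.image Prod.snd)ᶜ
  have hcard : w ≤ Y.card := by
    rw [Finset.card_compl, Fintype.card_fin]
    have : (D.image Prod.snd).card ≤ D.card := Finset.card_image_le
    omega
  have hy : y ∈ Y := by
    rw [Finset.mem_compl, Finset.mem_image]
    rintro ⟨c, hc, hcy⟩
    rw [mem_permsExtending_insert, mem_permsExtending] at hπ
    exact hx c hc (π.injective (by rw [hπ.2 c hc, hcy, hπ.1]))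
  have hle : ∀ y' ∈ Y, (permsExtending (insert (x, y) D)).card ≤
      ((permsExtending D).filter fun π => π x = y').card := by
    intro y' hy'
    refine Finset.card_le_card_of_injOn (fun π => Equiv.swap y y' * π) ?_
      (fun a _ b _ h => mul_left_cancel h)
    intro π hπ
    rw [Finset.mem_coe, mem_permsExtending_insert, mem_permsExtending] at hπ
    rw [Finset.mem_coe, Finset.mem_filter, mem_permsExtending]
    refine ⟨fun c hc => ?_, by simp [hπ.1]⟩
    have hc2 : c.2 ∈ D.image Prod.snd := Finset.mem_image_of_mem _ hc
    rw [Equiv.Perm.mul_apply, hπ.2 c hc]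
    refine Equiv.swap_apply_of_ne_of_ne ?_ ?_
    · rintro h; exact (Finset.mem_compl.1 hy) (h ▸ hc2)
    · rintro h; exact (Finset.mem_compl.1 hy') (h ▸ hc2)
  calc (permsExtending (insert (x, y) D)).card * w
      ≤ ∑ _y' ∈ Y, (permsExtending (insert (x, y) D)).card := by
        rw [Finset.sum_const, smul_eq_mul, mul_comm]
        exact Nat.mul_le_mul_right _ hcard
    _ ≤ ∑ y' ∈ Y, ((permsExtending D).filter fun π => π x = y').card := Finset.sum_le_sum hle
    _ ≤ ∑ y', ((permsExtending D).filter fun π => π x = y').card :=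
        Finset.sum_le_sum_of_subset (Finset.subset_univ _)
    _ = (permsExtending D).card :=
        (Finset.card_eq_sum_card_fiberwise fun _ _ => Finset.mem_univ _).symm

/-- The extensions of `D` are partitioned by the value at `x`; the primed version partitions them by
the preimage of `y`. -/
theorem sum_card_permsExtending_insert (D : Finset (Fin n × Fin n)) (x : Fin n)
    (G : Set (Equiv.Perm (Fin n))) :
    ∑ y, ((permsExtending (insert (x, y) D)).filter (· ∉ G)).card =
      ((permsExtending D).filter (· ∉ G)).card := by
  rw [Finset.card_eq_sum_card_fiberwise (f := fun π : Equiv.Perm (Fin n) => π x)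
    (t := Finset.univ) fun _ _ => Finset.mem_univ _]
  refine Finset.sum_congr rfl fun y _ => congrArg _ ?_
  ext π
  simp only [Finset.mem_filter, mem_permsExtending_insert]
  tauto

theorem sum_card_permsExtending_insert' (D : Finset (Fin n × Fin n)) (y : Fin n)
    (G : Set (Equiv.Perm (Fin n))) :
    ∑ x, ((permsExtending (insert (x, y) D)).filter (· ∉ G)).card =
      ((permsExtending D).filter (· ∉ G)).card := by
  rw [Finset.card_eq_sum_card_fiberwise (f := fun π : Equiv.Perm (Fin n) => π.symm y)
    (t := Finset.univ) fun _ _ => Finset.mem_univ _]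
  refine Finset.sum_congr rfl fun x _ => congrArg _ ?_
  ext π
  simp only [Finset.mem_filter, mem_permsExtending_insert, Equiv.symm_apply_eq]
  tauto

/-- The permutations extending `D` are outside `G` with probability at most `c / w`. -/
def MostlyIn (w c : ℕ) (D : Finset (Fin n × Fin n)) (G : Set (Equiv.Perm (Fin n))) : Prop :=
  ((permsExtending D).filter (· ∉ G)).card * w ≤ c * (permsExtending D).card

theorem MostlyIn.mono {w c c' : ℕ} {D : Finset (Fin n × Fin n)} {G G' : Set (Equiv.Perm (Fin n))}
    (h : MostlyIn w c D G) (hc : c ≤ c') (hG : ∀ π ∈ permsExtending D, π ∈ G → π ∈ G') :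
    MostlyIn w c' D G' := by
  refine (Nat.mul_le_mul_right _ (Finset.card_le_card ?_)).trans
    (h.trans (Nat.mul_le_mul_right _ hc))
  intro π
  simp only [Finset.mem_filter]
  exact fun h => ⟨h.1, fun h' => h.2 (hG π h.1 h')⟩

theorem sum_card_permsExtending (D : Finset (Fin n × Fin n)) (x : Fin n) :
    ∑ y, (permsExtending (insert (x, y) D)).card = (permsExtending D).card := by
  simpa using sum_card_permsExtending_insert D x ∅

theorem sum_card_permsExtending' (D : Finset (Fin n × Fin n)) (y : Fin n) :
    ∑ x, (permsExtending (insert (x, y) D)).card = (permsExtending D).card := by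
  simpa using sum_card_permsExtending_insert' D y ∅

/-- Exposing the value at a new point hits `Z` with probability at most `Z.card / w`. Otherwise the
hypothesis bounds the conditional failure probability, and the two losses add up. -/
theorem MostlyIn.forward {w c : ℕ} {D : Finset (Fin n × Fin n)} {G : Set (Equiv.Perm (Fin n))}
    {x : Fin n} (hx : ∀ c ∈ D, c.1 ≠ x) (hw : D.card + w ≤ n) (Z : Finset (Fin n))
    (h : ∀ y ∉ Z, MostlyIn w c (insert (x, y) D) G) : MostlyIn w (Z.card + c) D G := by
  have hy : ∀ y, ((permsExtending (insert (x, y) D)).filter (· ∉ G)).card * w ≤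
      (if y ∈ Z then (permsExtending D).card else 0) +
        c * (permsExtending (insert (x, y) D)).card := by
    intro y
    split_ifs with hZ
    · exact ((Nat.mul_le_mul_right _ (Finset.card_filter_le _ _)).trans
        (card_permsExtending_insert_le hx y hw)).trans (Nat.le_add_right _ _)
    · rw [zero_add]
      exact h y hZ
  rw [MostlyIn, ← sum_card_permsExtending_insert D x G, Finset.sum_mul]
  refine (Finset.sum_le_sum fun y _ => hy y).trans_eq ?_
  rw [Finset.sum_add_distrib, ← Finset.mul_sum, sum_card_permsExtending, add_mul]
  simp

/-- Exposing the preimage of `y` loses nothing, because every outcome is acceptable. -/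
theorem MostlyIn.backward {w c : ℕ} {D : Finset (Fin n × Fin n)} {G : Set (Equiv.Perm (Fin n))}
    (y : Fin n) (h : ∀ x, MostlyIn w c (insert (x, y) D) G) : MostlyIn w c D G := by
  rw [MostlyIn, ← sum_card_permsExtending_insert' D y G, Finset.sum_mul,
    ← sum_card_permsExtending' D y, Finset.mul_sum]
  exact Finset.sum_le_sum fun x _ => h x

/-- Probing the values of a permutation at finitely many points. -/
theorem MostlyIn.probe {w c : ℕ} {G : Set (Equiv.Perm (Fin n))} {Z : Finset (Fin n)}
    {Q : Fin n → Prop} (hQ : ∀ y ∉ Z, Q y) :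
    ∀ (l : List (Fin n)) (D : Finset (Fin n × Fin n)), D.card + l.length + w ≤ n →
      (∀ c ∈ D, Q c.2) →
      (∀ D' : Finset (Fin n × Fin n), D'.card ≤ D.card + l.length → (∀ c ∈ D', Q c.2) →
        (∀ x ∈ l, ∃ y, (x, y) ∈ D') → D ⊆ D' → MostlyIn w c D' G) →
      MostlyIn w (l.length * Z.card + c) D G := by
  intro l
  induction l with
  | nil => exact fun D _ hD h => by simpa using h D le_rfl hD (by simp) subset_rfl
  | cons x l ih =>
    intro D hw hD h
    rw [List.length_cons] at hw h ⊢
    -- A point whose value is already prescribed is skipped; a fresh one pays `Z.card`.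
    by_cases hx : ∃ y, (x, y) ∈ D
    · refine (ih D (by omega) hD fun D' h1 h2 h3 h4 => h D' (by omega) h2 ?_ h4).mono
        (Nat.add_le_add_right (Nat.mul_le_mul_right _ (Nat.le_succ _)) _) fun _ _ h => h
      obtain ⟨y, hy⟩ := hx
      intro z hz
      rcases List.mem_cons.1 hz with rfl | hz
      exacts [⟨y, h4 hy⟩, h3 z hz]
    · rw [Nat.succ_mul, show l.length * Z.card + Z.card + c = Z.card + (l.length * Z.card + c) by
        omega]
      refine MostlyIn.forward (x := x) (fun c hc hcx => hx ⟨c.2, hcx ▸ hc⟩) (by omega) Z ?_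
      intro y hy
      have hcard : (insert (x, y) D).card ≤ D.card + 1 := Finset.card_insert_le _ _
      refine ih _ (by omega) ?_ fun D' h1 h2 h3 h4 => h D' (by omega) h2 ?_
        ((Finset.subset_insert _ _).trans h4)
      · intro c hc
        rcases Finset.mem_insert.1 hc with rfl | hc
        exacts [hQ _ hy, hD c hc]
      · intro z hz
        rcases List.mem_cons.1 hz with rfl | hz
        exacts [⟨y, h4 (Finset.mem_insert_self _ _)⟩, h3 z hz]

end Perm

/-! ## Random embeddings -/

section RandomEmbedding

open Classical

variable {L : FirstOrder.Language.{0, 0}} {code : L.Symbols → ℕ}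
  {B : Type} {S : L.Structure B} {n : ℕ}

/-- The functional is determined by at most `d` facts that are true under `e`. -/
def DeterminedBy (code : L.Symbols → ℕ) (S : L.Structure B) (n : ℕ) (e : ℕ → B) (d : ℕ) {X : Type}
    (F : Set ℕ → X) : Prop :=
  ∃ q : Finset (AtomFact L), q.card ≤ d ∧ (∀ x ∈ q, x.Holds S e ∧ ∀ i ∈ x.supp, i < n) ∧
    ∃ y, Forces code n q F y

/-- The fact answering the root query is added to the facts that determine the subtree reached. -/
theorem DeterminedBy.cons {e : ℕ → B} {d : ℕ} {X : Type} {F F' : Set ℕ → X}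
    (h : DeterminedBy code S n e d F') {x : AtomFact L} (hx : x.Holds S e)
    (hxn : ∀ i ∈ x.supp, i < n) (hF : ∀ A, Compat code n A {x} → F A = F' A) :
    DeterminedBy code S n e (d + 1) F := by
  obtain ⟨q, hq, hqe, y, hy⟩ := h
  refine ⟨insert x q, (Finset.card_insert_le _ _).trans (by omega), ?_, y, fun A hA => ?_⟩
  · intro z hz
    rcases Finset.mem_insert.1 hz with rfl | hz
    exacts [⟨hx, hxn⟩, hqe z hz]
  · rw [hF A (hA.mono (by simp))]
    exact hy A (hA.mono (Finset.subset_insert _ _))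

/-- The map on numbers given by a permutation followed by an enumeration of elements. -/
noncomputable def permMap (ι : Fin n → B) (b : B) (π : Equiv.Perm (Fin n)) (i : ℕ) : B :=
  if h : i < n then ι (π ⟨i, h⟩) else b

theorem permMap_val (ι : Fin n → B) (b : B) (π : Equiv.Perm (Fin n)) (i : Fin n) :
    permMap ι b π i = ι (π i) := by
  simp [permMap]

variable [Fintype L.Symbols]

/-- Here `D` records the part of the permutation exposed so far, with all its values in layer `i`. A
query first exposes its arguments, and fails only if one of them falls outside the bottom layer; a
function value then lies in layer `i + 1`, hence is enumerated by `ι`, and its preimage is exposed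
without loss. Each query uses at most `width L` pairs and climbs one layer, so `d` layers suffice
for depth `d`. -/
theorem mostlyIn_determinedBy {ι : Fin n → B} {b₀ : B} {lev : ℕ → Finset B} {t : ℕ}
    (h0 : ∀ i ≤ t, lev 0 ⊆ lev i) (hs : ∀ i < t, lev i ⊆ lev (i + 1))
    (hr : ∀ i ≤ t, ∀ b ∈ lev i, b ∈ Set.range ι)
    (hf : ∀ i < t, ∀ (r : ℕ) (f : L.Functions r) (a : Fin r → B), (∀ j, a j ∈ lev i) →
        S.funMap f a ∈ lev (i + 1))
    {X : Type} {d w : ℕ} {F : Set ℕ → X} (hF : QC d F) :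
    ∀ (D : Finset (Fin n × Fin n)) (i : ℕ), (∀ c ∈ D, ι c.2 ∈ lev i) → i + d ≤ t →
      D.card + d * width L + w ≤ n →
      MostlyIn w (d * width L * (Finset.univ.filter fun y => ι y ∉ lev 0).card) D
        {π | DeterminedBy code S n (permMap ι b₀ π) d F} := by
  set Z := Finset.univ.filter fun y => ι y ∉ lev 0 with hZ
  induction hF with
  | const d x =>
    intro D i _ _ _
    have : MostlyIn w 0 D {π | DeterminedBy code S n (permMap ι b₀ π) d fun _ => x} := by
      have : (permsExtending D).filter
          (· ∉ {π | DeterminedBy code S n (permMap ι b₀ π) d fun _ => x}) = ∅ := by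
        refine Finset.filter_eq_empty_iff.2 fun π _ h => h ⟨∅, by simp, by simp, x, fun _ _ => rfl⟩
      rw [MostlyIn, this]
      simp
    exact this.mono (Nat.zero_le _) fun _ _ h => h
  | @query d u F₁ F₀ F _ _ h₁ h₀ ih₁ ih₀ =>
    intro D i hD hi hw
    have hW : (d + 1) * width L = d * width L + width L := Nat.succ_mul _ _
    rw [hW] at hw
    have hQ : ∀ y ∉ Z, ι y ∈ lev i := fun y hy => h0 i (by omega) (by simpa [hZ] using hy)
    by_cases hu : Live code n u
    swap
    · refine (ih₀ D i hD (by omega) (by omega)).mono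
        (Nat.mul_le_mul_right _ (Nat.mul_le_mul_right _ (Nat.le_succ d))) ?_
      rintro π _ ⟨q, hq, hqe, y, hy⟩
      exact ⟨q, by omega, hqe, y, fun A hA => by
        rw [h₀ A fun h => hu (hA.2 u h)]
        exact hy A hA⟩
    -- The common treatment of the arguments of a query; `D'.card + 1` leaves room for the pair that
    -- names a function value.
    have probe : ∀ {r : ℕ} (a : Fin r → ℕ), (∀ j, a j < n) → r < width L →
        (∀ (D' : Finset (Fin n × Fin n)) (y : Fin r → Fin n), D'.card + 1 ≤ D.card + width L →
          (∀ c ∈ D', ι c.2 ∈ lev i) →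
          (∀ j, ι (y j) ∈ lev i) → (∀ π ∈ permsExtending D', permMap ι b₀ π ∘ a = ι ∘ y) →
          MostlyIn w (d * width L * Z.card) D'
            {π | DeterminedBy code S n (permMap ι b₀ π) (d + 1) F}) →
        MostlyIn w ((d + 1) * width L * Z.card) D
            {π | DeterminedBy code S n (permMap ι b₀ π) (d + 1) F} := by
      intro r a ha hr h
      let a' : Fin r → Fin n := fun j => ⟨a j, ha j⟩
      refine (MostlyIn.probe (Q := fun y => ι y ∈ lev i) hQ (List.ofFn a') D
        (by simp; omega) hD (c := d * width L * Z.card) ?_).mono ?_ fun _ _ h => h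
      · intro D' h1 h2 h3 _
        rw [List.length_ofFn] at h1
        choose y hy using fun j => h3 (a' j) (by simp [List.mem_ofFn])
        refine h D' y (by omega) h2 (fun j => h2 _ (hy j)) fun π hπ => funext fun j => ?_
        have := permMap_val ι b₀ π (a' j)
        rw [mem_permsExtending.1 hπ _ (hy j)] at this
        exact this
      · rw [List.length_ofFn, hW, add_mul, add_comm]
        exact Nat.add_le_add_left (Nat.mul_le_mul_right _ hr.le) _
    rcases hu with ⟨r, R, a, ha, rfl⟩ | ⟨r, f, a, k, ha, hk, rfl⟩
    · refine probe a ha (rel_arity_lt R) fun D' y hc hD' hy hπ => ?_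
      have hn : ∀ k ∈ (AtomFact.rel R a (decide (S.RelMap R (ι ∘ y)))).supp, k < n := by
        intro k hk
        simp only [AtomFact.supp, Finset.mem_image, Finset.mem_univ, true_and] at hk
        obtain ⟨j, rfl⟩ := hk
        exact ha j
      have hx : ∀ π ∈ permsExtending D',
          (AtomFact.rel R a (decide (S.RelMap R (ι ∘ y)))).Holds S (permMap ι b₀ π) := by
        intro π h
        simp [AtomFact.Holds, hπ π h]
      have hm : ∀ A, Compat code n A {AtomFact.rel R a (decide (S.RelMap R (ι ∘ y)))} →
          (relQ code R a ∈ A ↔ S.RelMap R (ι ∘ y)) := fun A hA => by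
        simpa [AtomFact.Agrees] using hA.1 _ (Finset.mem_singleton_self _)
      by_cases hv : S.RelMap R (ι ∘ y)
      · exact (ih₁ D' i hD' (by omega) (by omega)).mono le_rfl fun π h hd =>
          hd.cons (hx π h) hn fun A hA => h₁ A ((hm A hA).2 hv)
      · exact (ih₀ D' i hD' (by omega) (by omega)).mono le_rfl fun π h hd =>
          hd.cons (hx π h) hn fun A hA => h₀ A fun h => hv ((hm A hA).1 h)
    · refine probe a ha (fn_arity_lt f) fun D' y hc hD' hy hπ => ?_
      have hl := hf i (by omega) r f (ι ∘ y) hy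
      obtain ⟨z, hz⟩ := hr (i + 1) (by omega) _ hl
      -- The function value is `ι z`; its number in `[n]` is the preimage `x` of `z`, whatever it
      -- turns out to be.
      refine MostlyIn.backward z fun x => ?_
      have hn : ∀ k ∈ (AtomFact.fn f a (x : ℕ)).supp, k < n := by
        intro k hk
        simp only [AtomFact.supp, Finset.mem_insert, Finset.mem_image, Finset.mem_univ,
          true_and] at hk
        rcases hk with rfl | ⟨j, rfl⟩
        exacts [x.2, ha j]
      have hx : ∀ π ∈ permsExtending (insert (x, z) D'),
          (AtomFact.fn f a (x : ℕ)).Holds S (permMap ι b₀ π) := by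
        intro π h
        rw [mem_permsExtending_insert] at h
        change S.funMap f (permMap ι b₀ π ∘ a) = permMap ι b₀ π x
        rw [hπ π h.2, permMap_val, h.1, hz]
      have hm : ∀ A, Compat code n A {AtomFact.fn f a (x : ℕ)} →
          (fnQ code f a k ∈ A ↔ (x : ℕ).testBit k = true) := fun A hA =>
        hA.1 _ (Finset.mem_singleton_self _) k hk
      have hD'' : ∀ c ∈ insert (x, z) D', ι c.2 ∈ lev (i + 1) := by
        intro c hc
        rcases Finset.mem_insert.1 hc with rfl | hc
        · exact hz ▸ hl
        · exact hs i (by omega) (hD' c hc)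
      have hcard : (insert (x, z) D').card ≤ D'.card + 1 := Finset.card_insert_le _ _
      by_cases hv : (x : ℕ).testBit k = true
      · exact (ih₁ _ (i + 1) hD'' (by omega) (by omega)).mono le_rfl fun π h hd =>
          hd.cons (hx π h) hn fun A hA => h₁ A ((hm A hA).2 hv)
      · exact (ih₀ _ (i + 1) hD'' (by omega) (by omega)).mono le_rfl fun π h hd =>
          hd.cons (hx π h) hn fun A hA => h₀ A fun h => hv ((hm A hA).1 h)

/-- Given functionals of small query complexity, some structure on `[n]` that extends a given
condition determines at least half of them by few facts. -/
theorem Good.exists_determining [Infinite B] {g : ℕ → ℕ} (hL : IsLarge S g) (hg : Monotone g)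
    {p : Finset (AtomFact L)} (hp : Good S n p) {X T : Type} [Fintype T] {d : ℕ}
    {F : T → Set ℕ → X} (hF : ∀ x, QC d (F x))
    (hn : p.card * width L + d * width L + (2 * (d * width L * (d * g n)) + 1) + d * g n ≤ n) :
    ∃ e : ℕ → B, Set.InjOn e (Set.Iio n) ∧ (∀ x ∈ p, x.Holds S e ∧ ∀ i ∈ x.supp, i < n) ∧
      Fintype.card T ≤ 2 * (Finset.univ.filter fun x => DeterminedBy code S n e d (F x)).card := by
  obtain ⟨e₀, he₀, hp⟩ := hp
  have hsupp := card_biUnion_supp_le p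
  set s := p.biUnion AtomFact.supp with hs
  have hsn : s ⊆ Finset.range n := by
    intro i hi
    obtain ⟨x, hx, hi⟩ := Finset.mem_biUnion.1 hi
    exact Finset.mem_range.2 ((hp x hx).2 i hi)
  -- A reserve of `d * g n` points is left out so that all `d` layers fit into `n` elements.
  obtain ⟨X₀, hsX, hXn, hXc⟩ := Finset.exists_subsuperset_card_eq hsn (n := n - d * g n)
    (by omega) (by simp)
  have hinj : Set.InjOn e₀ X₀ := he₀.mono fun i hi => Finset.mem_range.1 (hXn hi)
  have hc₀ : (X₀.image e₀).card = n - d * g n := by rw [Finset.card_image_of_injOn hinj, hXc]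
  obtain ⟨lev, ε, hε, h0, hb, hst, ht, hf, hc, hR, hFn⟩ :=
    hL.exists_layers hg (A₀ := X₀.image e₀) (n := n) (Finset.card_pos.1 (by omega)) d (by omega)
  rw [hc₀] at hc
  obtain ⟨A, hlA, hA⟩ := Infinite.exists_superset_card_eq (lev d) n (by omega)
  have hmem : ∀ x ∈ s, e₀ x ∈ X₀.image e₀ := fun x hx => Finset.mem_image_of_mem _ (hsX hx)
  -- The top layer is padded to exactly `n` elements and enumerated so that the support of `p` keeps
  -- its transported images.
  obtain ⟨ι', hι'⟩ := Finset.exists_equiv_extend_of_card_eq (α := Fin n) (t := A)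
    (by simpa using hA.symm) (s := Finset.univ.filter fun i : Fin n => (i : ℕ) ∈ s)
    (f := fun i => ε (e₀ i)) (by
      intro b hb'
      obtain ⟨i, hi, rfl⟩ := Finset.mem_image.1 hb'
      refine hlA (hb d le_rfl ?_)
      rw [h0]
      exact Finset.mem_image_of_mem _ (hmem i (by simpa using hi)))
    (by
      intro i hi j hj hij
      simp only [Finset.coe_filter, Finset.mem_univ, true_and, Set.mem_ofPred_eq] at hi hj
      exact Fin.ext (he₀ i.2 j.2 (hε (hmem i hi) (hmem j hj) hij)))
  let ι : Fin n → B := fun i => ι' i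
  have hιs : ∀ i : Fin n, (i : ℕ) ∈ s → ι i = ε (e₀ i) := fun i hi => hι' i (by simpa using hi)
  have hιi : Function.Injective ι := fun i j h => ι'.injective (Subtype.ext h)
  have hrange : ∀ b ∈ A, b ∈ Set.range ι := fun b hb => ⟨ι'.symm ⟨b, hb⟩, by simp [ι]⟩
  obtain ⟨b₀⟩ : Nonempty B := inferInstance
  -- Only permutations fixing the support of `p` pointwise are considered; this keeps the facts of
  -- `p` true.
  let D : Finset (Fin n × Fin n) :=
    (Finset.univ.filter fun i : Fin n => (i : ℕ) ∈ s).image fun i => (i, i)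
  have hDc : D.card ≤ s.card := by
    refine Finset.card_image_le.trans (Finset.card_le_card_of_injOn (fun i => (i : ℕ)) ?_
      Fin.val_injective.injOn)
    intro i hi
    simpa using hi
  have hDl : ∀ c ∈ D, ι c.2 ∈ lev 0 := by
    intro c hc
    obtain ⟨i, hi, rfl⟩ := Finset.mem_image.1 hc
    have hi : (i : ℕ) ∈ s := by simpa using hi
    rw [hιs i hi, h0]
    exact Finset.mem_image_of_mem _ (hmem i hi)
  have hZ : (Finset.univ.filter fun y => ι y ∉ lev 0).card ≤ d * g n := by
    have h1 : (lev 0).card ≤ (Finset.univ.filter fun y => ι y ∈ lev 0).card := by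
      refine (Finset.card_le_card (t := (Finset.univ.filter fun y => ι y ∈ lev 0).image ι)
        fun b hb' => ?_).trans Finset.card_image_le
      obtain ⟨y, rfl⟩ := hrange b (hlA (ht 0 (Nat.zero_le _) hb'))
      exact Finset.mem_image_of_mem _ (by simpa using hb')
    have h2 := Finset.card_filter_add_card_filter_not (s := (Finset.univ : Finset (Fin n)))
      (fun y => ι y ∈ lev 0)
    rw [h0, Finset.card_image_of_injOn hε, hc₀] at h1
    rw [Finset.card_univ, Fintype.card_fin, h0] at h2
    rw [h0]
    omega
  -- With `w` larger than twice the numerator, the failure probability of each single functional is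
  -- at most one half.
  have hbad : ∀ x, 2 * ((permsExtending D).filter
      fun π => ¬ DeterminedBy code S n (permMap ι b₀ π) d (F x)).card ≤ (permsExtending D).card := by
    intro x
    set w := 2 * (d * width L * (d * g n)) + 1 with hw
    have h1 := mostlyIn_determinedBy (code := code) (S := S) (b₀ := b₀) (w := w) hb hst
      (fun i hi b hb' => hrange b (hlA (ht i hi hb'))) hf (hF x) D 0 hDl (by omega) (by omega)
    have h2 : ((permsExtending D).filter
      fun π => ¬ DeterminedBy code S n (permMap ι b₀ π) d (F x)).card * w ≤
        d * width L * (d * g n) * (permsExtending D).card :=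
      h1.trans (Nat.mul_le_mul_right _ (Nat.mul_le_mul_left _ hZ))
    generalize ((permsExtending D).filter
      fun π => ¬ DeterminedBy code S n (permMap ι b₀ π) d (F x)).card = a at h2
    generalize (permsExtending D).card = E at h2 ⊢
    generalize d * width L * (d * g n) = c at h2 hw
    rw [hw] at h2
    by_contra! hlt
    nlinarith
  have hD1 : (1 : Equiv.Perm (Fin n)) ∈ permsExtending D := by
    rw [mem_permsExtending]
    intro c hc
    obtain ⟨i, _, rfl⟩ := Finset.mem_image.1 hc
    rfl
  -- Double counting of pairs of a permutation and a functional on which it fails yields a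
  -- permutation that is at least average.
  obtain ⟨π, hπ, hhalf⟩ : ∃ π ∈ permsExtending D, 2 * (Finset.univ.filter
      fun x => ¬ DeterminedBy code S n (permMap ι b₀ π) d (F x)).card ≤ Fintype.card T := by
    by_contra! hlt
    have h1 := Finset.sum_lt_sum_of_nonempty ⟨1, hD1⟩ hlt
    have h2 : ∑ x : T, 2 * ((permsExtending D).filter
        fun π => ¬ DeterminedBy code S n (permMap ι b₀ π) d (F x)).card ≤
        ∑ _x : T, (permsExtending D).card := Finset.sum_le_sum fun x _ => hbad x
    rw [← Finset.mul_sum] at h1 h2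
    have h3 := Finset.sum_card_bipartiteAbove_eq_sum_card_bipartiteBelow (s := permsExtending D)
      (t := (Finset.univ : Finset T))
      (fun π x => ¬ DeterminedBy code S n (permMap ι b₀ π) d (F x))
    simp only [Finset.bipartiteAbove, Finset.bipartiteBelow] at h3
    rw [h3] at h1
    simp only [Finset.sum_const, smul_eq_mul, Finset.card_univ] at h1 h2
    rw [mul_comm (permsExtending D).card] at h1
    omega
  refine ⟨permMap ι b₀ π, ?_, ?_, ?_⟩
  · intro i hi j hj hij
    have h1 := permMap_val ι b₀ π ⟨i, hi⟩
    have h2 := permMap_val ι b₀ π ⟨j, hj⟩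
    rw [show permMap ι b₀ π i = permMap ι b₀ π j from hij] at h1
    exact congrArg Fin.val (π.injective (hιi (h1.symm.trans h2)))
  · intro x hx
    refine ⟨?_, (hp x hx).2⟩
    have hval : ∀ i ∈ s, permMap ι b₀ π i = ε (e₀ i) := by
      intro i hi
      have hin := Finset.mem_range.1 (hsn hi)
      have := permMap_val ι b₀ π ⟨i, hin⟩
      rw [mem_permsExtending.1 hπ (⟨i, hin⟩, ⟨i, hin⟩)
        (Finset.mem_image_of_mem (fun i => (i, i)) (by simpa using hi)), hιs _ hi] at this
      exact this
    have hxs : ∀ i ∈ x.supp, i ∈ s := fun i hi => Finset.mem_biUnion.2 ⟨x, hx, hi⟩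
    refine AtomFact.Holds.congr (e := ε ∘ e₀) (fun i hi => (hval i (hxs i hi)).symm) ?_
    have hxh := (hp x hx).1
    cases x with
    | rel R a v =>
      have := hR _ R (e₀ ∘ a) fun j => hmem _ (hxs _ (by simp [AtomFact.supp]))
      exact this.trans hxh
    | fn f a b =>
      have hab : S.funMap f (e₀ ∘ a) = e₀ b := hxh
      have := hFn _ f (e₀ ∘ a) (fun j => hmem _ (hxs _ (by simp [AtomFact.supp])))
        (hab ▸ hmem _ (hxs _ (by simp [AtomFact.supp])))
      rw [hab] at this
      exact this
  · have := Finset.card_filter_add_card_filter_not (s := (Finset.univ : Finset T))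
      (fun x => DeterminedBy code S n (permMap ι b₀ π) d (F x))
    rw [Finset.card_univ] at this
    omega

end RandomEmbedding

/-! ## Structures coded by oracles -/

section Codes

open Classical

/-- The standard interpretation of the zero set of a function symbol. -/
def zeroNat {k : ℕ} (f : PVα.Functions (k + 1)) (A : Set ℕ) (a : Fin k → ℕ) : Set ℕ :=
  {u | f.1.eval A (Fin.cons u a) = 0}

variable {K : FirstOrder.Language.{0, 0}} (code : K.Symbols → ℕ)

/-- The number with the bits that code the value of a function. -/
noncomputable def bitsOf (m : ℕ) (X : Set ℕ) {r : ℕ} (f : K.Functions r) (b : Fin r → ℕ) : ℕ :=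
  Nat.ofBits fun i : Fin m.size => decide (fnQ code f b i ∈ X)

theorem bitsOf_size_le (m : ℕ) (X : Set ℕ) {r : ℕ} (f : K.Functions r) (b : Fin r → ℕ) :
    (bitsOf code m X f b).size ≤ m.size :=
  Nat.size_le.2 (Nat.ofBits_lt_two_pow _)

theorem testBit_bitsOf {m : ℕ} {X : Set ℕ} {r : ℕ} {f : K.Functions r} {b : Fin r → ℕ} {i : ℕ}
    (hi : i < m.size) : (bitsOf code m X f b).testBit i = true ↔ fnQ code f b i ∈ X := by
  rw [bitsOf, Nat.testBit_ofBits_lt _ _ hi, decide_eq_true_iff]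

/-- The value of a function in the structure coded by an oracle. -/
noncomputable def codedFn (m : ℕ) (X : Set ℕ) {r : ℕ} (f : K.Functions r) (b : Fin r → ℕ) : ℕ :=
  min (bitsOf code m X f b) (m - 1)

/-- Truth of a literal in the structure on `[m]` coded by an oracle. -/
def LitTrue (m : ℕ) (X : Set ℕ) {k : ℕ} (w : Fin k → ℕ) : BasicLiteral (K.sum PV) k → Prop
  | .rel (.inl R) u => relQ code R (w ∘ u) ∈ X
  | .rel (.inr R) u => PV.standard.RelMap R (w ∘ u)
  | .nrel (.inl R) u => relQ code R (w ∘ u) ∉ X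
  | .nrel (.inr R) u => ¬ PV.standard.RelMap R (w ∘ u)
  | .fn (.inl f) u v => codedFn code m X f (w ∘ u) = w v
  | .fn (.inr f) u v => PV.standard.funMap f (w ∘ u) = w v
  | .eq u v => w u = w v
  | .ne u v => w u ≠ w v

theorem sz_cons {k : ℕ} (u : ℕ) (a : Fin k → ℕ) :
    sz (Fin.cons u a : Fin (k + 1) → ℕ) = u.size + sz a := by
  simp [sz, Fin.sum_univ_succ]

theorem mem_zeroNat_qc {k : ℕ} (f : PVα.Functions (k + 1)) : ∃ p : Polynomial ℕ,
    ∀ (u : ℕ) (a : Fin k → ℕ), QC (p.eval (u.size + sz a)) (fun A => u ∈ zeroNat f A a) := by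
  obtain ⟨p, hp⟩ := f.2.exists_bound
  refine ⟨p, fun u a => ?_⟩
  rw [← sz_cons]
  exact (hp _).1.map fun y => y = 0

/-- Tupling is computed by a polynomial time machine, so the length bound comes from its running
time and not from a calculation with digits. -/
theorem seqCode_size_le (κ : BasicSymbols) (r : ℕ) : ∃ p : Polynomial ℕ,
    ∀ a : Fin r → ℕ, (seqCode (List.ofFn a)).size ≤ p.eval (sz a) := by
  obtain ⟨p, hp⟩ := OracleTM.PolyTime.exists_bound (κ.tup r).2.1
  exact ⟨p, fun a => by rw [← κ.tup_spec]; exact (hp a).2 ∅⟩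

theorem relQ_mem_zeroNat_qc (κ : BasicSymbols) {k r : ℕ} (f : PVα.Functions (k + 1))
    (R : K.Relations r) : ∃ p : Polynomial ℕ, ∀ (a : Fin k → ℕ) (b : Fin r → ℕ),
      QC (p.eval (sz a + sz b)) (fun A => relQ code R b ∈ zeroNat f A a) := by
  obtain ⟨p, hp⟩ := mem_zeroNat_qc f
  obtain ⟨q, hq⟩ := seqCode_size_le κ (r + 1)
  refine ⟨p.comp (q.comp (Polynomial.C (code (.inr ⟨r, R⟩)).size + Polynomial.X) + Polynomial.X),
    fun a b => (hp _ _).mono ?_⟩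
  rw [Polynomial.eval_comp]
  refine p.eval_mono_nat ?_
  rw [Polynomial.eval_add, Polynomial.eval_comp, Polynomial.eval_add, Polynomial.eval_C,
    Polynomial.eval_X]
  refine Nat.add_le_add ((hq _).trans (q.eval_mono_nat ?_)) (Nat.le_add_right _ _)
  rw [sz_cons]
  omega

theorem bitsOf_qc (κ : BasicSymbols) {k r : ℕ} (f : PVα.Functions (k + 1))
    (h : K.Functions r) : ∃ p : Polynomial ℕ, ∀ (m : ℕ) (a : Fin k → ℕ) (b : Fin r → ℕ),
      QC (p.eval (m.size + sz a + sz b)) (fun A => bitsOf code m (zeroNat f A a) h b) := by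
  obtain ⟨p, hp⟩ := mem_zeroNat_qc f
  obtain ⟨q, hq⟩ := seqCode_size_le κ (r + 2)
  refine ⟨Polynomial.X *
    p.comp (q.comp (Polynomial.C (code (.inl ⟨r, h⟩)).size + Polynomial.X) + Polynomial.X),
    fun m a b => ?_⟩
  set P := p.comp (q.comp (Polynomial.C (code (.inl ⟨r, h⟩)).size + Polynomial.X) + Polynomial.X)
  have := QC.seq (F := fun i A => fnQ code h b i ∈ zeroNat f A a) (d := P.eval (m.size + sz a + sz b))
    m.size fun i hi => (hp _ _).mono (by
      rw [Polynomial.eval_comp]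
      refine p.eval_mono_nat ?_
      rw [Polynomial.eval_add, Polynomial.eval_comp, Polynomial.eval_add, Polynomial.eval_C,
        Polynomial.eval_X]
      refine Nat.add_le_add ((hq _).trans (q.eval_mono_nat ?_)) (by omega)
      rw [sz_cons, sz_snoc]
      have : i.size ≤ i := Nat.size_le.2 Nat.lt_two_pow_self
      omega)
  refine (this.map fun B => Nat.ofBits fun i => decide (B i)).mono ?_
  rw [Polynomial.eval_mul, Polynomial.eval_X]
  exact Nat.mul_le_mul_right _ (by omega)

/-- The atoms of structures on `[m]`. -/
abbrev AtomOn (K : FirstOrder.Language.{0, 0}) (m : ℕ) : Type :=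
  Σ s : K.Symbols, (Fin (symArity s) → Set.Iio m)

/-- The value of an atom in the structure on `[m]` coded by an oracle; truth values are `1`
and `0`. -/
noncomputable def atomVal (m : ℕ) (X : Set ℕ) : AtomOn K m → ℕ
  | ⟨.inl f, b⟩ => codedFn code m X f.2 fun i => (b i : ℕ)
  | ⟨.inr R, b⟩ => if relQ code R.2 (fun i => (b i : ℕ)) ∈ X then 1 else 0

variable {code}

theorem Nat.size_mono_lt {a b : ℕ} (h : a < b) : a.size ≤ b.size := Nat.size_le_size h.le

/-- Arguments are below `m` and arities are fixed, so their lengths are absorbed in a polynomial in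
`m.size`; this makes the depth uniform over all atoms. -/
theorem atomVal_qc (κ : BasicSymbols) [Fintype K.Symbols] {k : ℕ} (f : PVα.Functions (k + 1)) :
    ∃ p : Polynomial ℕ, ∀ (m : ℕ) (a : Fin k → ℕ) (x : AtomOn K m),
      QC (p.eval (m.size + sz a)) (fun A => atomVal code m (zeroNat f A a) x) := by
  have hs : ∀ s : K.Symbols, ∃ p : Polynomial ℕ, ∀ (m : ℕ) (a : Fin k → ℕ)
      (b : Fin (symArity s) → Set.Iio m),
      QC (p.eval (m.size + sz a)) (fun A => atomVal code m (zeroNat f A a) ⟨s, b⟩) := by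
    have hb : ∀ (r m : ℕ) (b : Fin r → Set.Iio m), sz (fun i => (b i : ℕ)) ≤ r * m.size := by
      intro r m b
      refine (Finset.sum_le_sum fun i _ => Nat.size_mono_lt (b i).2).trans ?_
      simp
    intro s
    rcases s with ⟨r, h⟩ | ⟨r, R⟩
    · obtain ⟨p, hp⟩ := bitsOf_qc code κ f h
      refine ⟨p.comp (Polynomial.X + Polynomial.C r * Polynomial.X), fun m a b =>
        ((hp m a fun i => (b i : ℕ)).map fun c => min c (m - 1)).mono ?_⟩
      rw [Polynomial.eval_comp]
      refine p.eval_mono_nat ?_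
      have := hb r m b
      simp only [Polynomial.eval_add, Polynomial.eval_mul, Polynomial.eval_C,
        Polynomial.eval_X]
      nlinarith [Nat.zero_le (r * sz a)]
    · obtain ⟨p, hp⟩ := relQ_mem_zeroNat_qc code κ f R
      refine ⟨p.comp (Polynomial.X + Polynomial.C r * Polynomial.X), fun m a b =>
        ((hp a fun i => (b i : ℕ)).map fun c : Prop => if c then 1 else 0).mono ?_⟩
      rw [Polynomial.eval_comp]
      refine p.eval_mono_nat ?_
      have := hb r m b
      simp only [Polynomial.eval_add, Polynomial.eval_mul, Polynomial.eval_C,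
        Polynomial.eval_X]
      nlinarith [Nat.zero_le (r * sz a)]
  choose p hp using hs
  refine ⟨∑ s, p s, fun m a x => (hp x.1 m a x.2).mono ?_⟩
  rw [Polynomial.eval_finsetSum]
  exact Finset.single_le_sum (f := fun s => (p s).eval (m.size + sz a)) (fun _ _ => Nat.zero_le _)
    (Finset.mem_univ x.1)

theorem litTrue_fn {m : ℕ} {X : Set ℕ} {k r : ℕ} {w : Fin k → Set.Iio m} {f : K.Functions r}
    {u : Fin r → Fin k} {v : Fin k} :
    LitTrue code m X (fun i => (w i : ℕ)) (.fn (.inl f) u v) ↔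
      atomVal code m X ⟨.inl ⟨r, f⟩, w ∘ u⟩ = w v := Iff.rfl

theorem litTrue_rel {m : ℕ} {X : Set ℕ} {k r : ℕ} {w : Fin k → Set.Iio m} {R : K.Relations r}
    {u : Fin r → Fin k} :
    LitTrue code m X (fun i => (w i : ℕ)) (.rel (.inl R) u) ↔
      atomVal code m X ⟨.inr ⟨r, R⟩, w ∘ u⟩ = 1 := by
  have : LitTrue code m X (fun i => (w i : ℕ)) (.rel (.inl R) u) ↔
    relQ code R (fun i => ((w ∘ u) i : ℕ)) ∈ X := Iff.rfl
  rw [this, atomVal]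
  split_ifs with h
  · exact iff_of_true h rfl
  · exact iff_of_false h (by norm_num)

theorem litTrue_nrel {m : ℕ} {X : Set ℕ} {k r : ℕ} {w : Fin k → Set.Iio m} {R : K.Relations r}
    {u : Fin r → Fin k} :
    LitTrue code m X (fun i => (w i : ℕ)) (.nrel (.inl R) u) ↔
      atomVal code m X ⟨.inr ⟨r, R⟩, w ∘ u⟩ = 0 := by
  have : LitTrue code m X (fun i => (w i : ℕ)) (.nrel (.inl R) u) ↔
    relQ code R (fun i => ((w ∘ u) i : ℕ)) ∉ X := Iff.rfl
  rw [this, atomVal]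
  split_ifs with h
  · exact iff_of_false (fun h' => h' h) (by norm_num)
  · exact iff_of_true h rfl

/-- Literals that are verified by a partial structure are true in coded structures with the same
values. -/
theorem litTrue_of_verifiesLit {m : ℕ} {k : ℕ} {P : PartialStr K (Set.Iio m)}
    {C : Set (Set (Set ℕ))} (hC : C.Nonempty)
    (hf : ∀ (r : ℕ) (f : K.Functions r) (b : Fin r → Set.Iio m) (c : Set.Iio m),
      P.fn f b = some c → ∃ Φ ∈ C, ∀ X ∈ Φ, atomVal code m X ⟨.inl ⟨r, f⟩, b⟩ = c)
    (hR : ∀ (r : ℕ) (R : K.Relations r) (b : Fin r → Set.Iio m) (v : Bool),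
      P.rel R b = some v → ∃ Φ ∈ C, ∀ X ∈ Φ, atomVal code m X ⟨.inr ⟨r, R⟩, b⟩ = v.toNat)
    {w : Fin k → Set.Iio m} {l : BasicLiteral (K.sum PV) k}
    (h : (PartialStr.withPV PV.standard (Set.Iio m) P).VerifiesLit w l) :
    ∃ Φ ∈ C, ∀ X ∈ Φ, LitTrue code m X (fun i => (w i : ℕ)) l := by
  -- Built-in literals and equalities do not depend on the oracle, so any member of `C` serves for
  -- them.
  obtain ⟨Ψ, hΨ⟩ := hC
  cases l with
  | rel R u =>
    rcases R with R | R
    · obtain ⟨Φ, hΦ, hx⟩ := hR _ R (w ∘ u) true h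
      exact ⟨Φ, hΦ, fun X hX => litTrue_rel.2 (hx X hX)⟩
    · have : some (decide (PV.standard.RelMap R fun i => ((w ∘ u) i : ℕ))) = some true := h
      exact ⟨Ψ, hΨ, fun _ _ => of_decide_eq_true (Option.some.inj this)⟩
  | nrel R u =>
    rcases R with R | R
    · obtain ⟨Φ, hΦ, hx⟩ := hR _ R (w ∘ u) false h
      exact ⟨Φ, hΦ, fun X hX => litTrue_nrel.2 (hx X hX)⟩
    · have : some (decide (PV.standard.RelMap R fun i => ((w ∘ u) i : ℕ))) = some false := h
      exact ⟨Ψ, hΨ, fun _ _ => of_decide_eq_false (Option.some.inj this)⟩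
  | fn f u v =>
    rcases f with f | f
    · obtain ⟨Φ, hΦ, hx⟩ := hf _ f (w ∘ u) (w v) h
      exact ⟨Φ, hΦ, fun X hX => litTrue_fn.2 (hx X hX)⟩
    · have : (PartialStr.induced PV.standard (Set.Iio m)).fn f (w ∘ u) = some (w v) := h
      simp only [PartialStr.induced] at this
      split at this
      · exact ⟨Ψ, hΨ, fun _ _ => congrArg Subtype.val (Option.some.inj this)⟩
      · simp at this
  | eq u v => exact ⟨Ψ, hΨ, fun _ _ => congrArg Subtype.val h⟩
  | ne u v => exact ⟨Ψ, hΨ, fun _ _ h' => h (Subtype.ext h')⟩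

end Codes

/-! ## Conditions that verify a weak principle -/

section WeakPrinciple

open Classical

theorem QC.pi_fintype {T X : Type} [Fintype T] {F : T → Set ℕ → X} {d : ℕ} (h : ∀ x, QC d (F x)) :
    QC (Fintype.card T * d) (fun A x => F x A) := by
  have := (QC.pi (F := fun i => F ((Fintype.equivFin T).symm i)) (d := fun _ => d)
    fun i => h _).map fun B x => B (Fintype.equivFin T x)
  simpa using this

theorem card_atomOn (K : FirstOrder.Language.{0, 0}) [Fintype K.Symbols] (m : ℕ) :
    Fintype.card (AtomOn K m) = totalSize K m := by
  simp [AtomOn, totalSize]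

theorem PartialStr.size_eq {K : FirstOrder.Language.{0, 0}} [Fintype K.Symbols] {m : ℕ}
    (P : PartialStr K (Set.Iio m)) :
    P.size = (Finset.univ.filter fun x : AtomOn K m => P.DefinedAt x.1 x.2).card := by
  rw [PartialStr.size, ← Nat.card_sigma, ← Fintype.card_subtype, ← Nat.card_eq_fintype_card]
  exact Nat.card_congr
    ⟨fun x => ⟨⟨x.1, x.2.1⟩, x.2.2⟩, fun x => ⟨x.1.1, x.1.2, x.2⟩, fun _ => rfl, fun _ => rfl⟩

/-- The infimum is attained: the defining set is nonempty because no partial structure has size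
above the total size. -/
theorem verifies_of_determinacy_le {K : FirstOrder.Language.{0, 0}} [Fintype K.Symbols]
    {φ : BasicSentence (K.sum PV)} {m : ℕ} {P : PartialStr K (Set.Iio m)}
    (h : determinacy φ m ≤ P.size) :
    (PartialStr.withPV PV.standard (Set.Iio m) P).Verifies φ := by
  have hne : {d | ∀ P : PartialStr K (Set.Iio m), d ≤ P.size →
      (PartialStr.withPV PV.standard (Set.Iio m) P).Verifies φ}.Nonempty := by
    refine ⟨totalSize K m + 1, fun P hP => absurd hP ?_⟩
    rw [PartialStr.size_eq, ← card_atomOn]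
    exact not_le.2 (Nat.lt_succ_of_le (Finset.card_le_univ _))
  exact Nat.sInf_mem hne P h

/-- Of weakness only a factor of two is used, matching the half of the atoms that a good embedding
determines. -/
theorem IsWeak.eventually_two_mul_le {K : FirstOrder.Language.{0, 0}} [Fintype K.Symbols]
    {φ : BasicSentence (K.sum PV)} (h : IsWeak φ) :
    ∃ m₀, ∀ m, m₀ ≤ m → 2 * determinacy φ m ≤ totalSize K m := by
  obtain ⟨ε, hε, h⟩ := h
  have h2 : ∀ᶠ m : ℕ in Filter.atTop, (2 : ℝ) ≤ (m : ℝ) ^ ε :=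
    ((tendsto_rpow_atTop hε).comp tendsto_natCast_atTop_atTop).eventually_ge_atTop 2
  obtain ⟨m₀, hm₀⟩ := Filter.eventually_atTop.1 (h.and h2)
  refine ⟨m₀, fun m hm => ?_⟩
  obtain ⟨h3, h4⟩ := hm₀ m hm
  have : (2 : ℝ) * determinacy φ m ≤ totalSize K m :=
    (mul_le_mul_of_nonneg_right h4 (by positivity)).trans h3
  exact_mod_cast this

variable {L : FirstOrder.Language.{0, 0}} [Fintype L.Symbols] {code : L.Symbols → ℕ}
  {B : Type} {S : L.Structure B} {g : ℕ → ℕ}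
  {K : FirstOrder.Language.{0, 0}} [Fintype K.Symbols] {code' : K.Symbols → ℕ}

/-- For a sentence with small determinacy: verification by few facts. -/
theorem Good.exists_verifying_of_determinacy [Infinite B] (hc : Function.Injective code) (hL : IsLarge S g)
    (hg : Monotone g) {φ : BasicSentence (K.sum PV)} {k : ℕ} {f : PVα.Functions (k + 1)} {m d : ℕ}
    (hm : 2 * determinacy φ m ≤ totalSize K m) {a : Fin k → ℕ}
    (hd : ∀ x : AtomOn K m, QC d (fun A => atomVal code' m (zeroNat f A a) x)) (hm0 : 0 < m)
    {n : ℕ} {p : Finset (AtomFact L)} (hp : Good S n p)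
    (hn : p.card * width L + d * width L + (2 * (d * width L * (d * g n)) + 1) + d * g n ≤ n) :
    ∃ q, p ⊆ q ∧ q.card ≤ p.card + φ.J * d ∧ Good S n q ∧
      ∃ (w : Fin φ.vars → ℕ) (i : Fin φ.I), (∀ j, w j < m) ∧ ∀ A, Compat code n A q →
        ∀ j, LitTrue code' m (zeroNat f A a) w (φ.lit i j) := by
  obtain ⟨e, he, hpe, hhalf⟩ := hp.exists_determining (code := code) hL hg hd hn
  rw [card_atomOn] at hhalf
  let Det (x : AtomOn K m) (y : ℕ) : Prop := ∃ q : Finset (AtomFact L), q.card ≤ d ∧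
    (∀ x ∈ q, x.Holds S e ∧ ∀ i ∈ x.supp, i < n) ∧
    Forces code n q (fun A => atomVal code' m (zeroNat f A a) x) y
  -- The partial structure of those values that are forced by at most `d` facts true under `e`.
  let P : PartialStr K (Set.Iio m) :=
    { fn := fun {r} h b => if hy : ∃ y : Set.Iio m, Det ⟨.inl ⟨r, h⟩, b⟩ y then some hy.choose
        else none
      rel := fun {r} R b => if hv : ∃ v : Bool, Det ⟨.inr ⟨r, R⟩, b⟩ v.toNat then some hv.choose
        else none }
  have hsize : determinacy φ m ≤ P.size := by
    have : (Finset.univ.filter fun x => DeterminedBy code S n e d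
        fun A => atomVal code' m (zeroNat f A a) x).card ≤ P.size := by
      rw [PartialStr.size_eq]
      refine Finset.card_le_card fun x => ?_
      simp only [Finset.mem_filter, Finset.mem_univ, true_and]
      rintro ⟨q, hq, hqe, y, hy⟩
      -- The oracle coding the structure along `e` is compatible with these facts, so the forced
      -- value is one that really occurs: below `m` for functions, `0` or `1` for relations.
      have hA := hy _ (compat_oracleOf hc he hqe)
      rcases x with ⟨⟨r, h⟩ | ⟨r, R⟩, b⟩
      · have hlt : y < m := by
          rw [← hA]
          exact (min_le_right _ _).trans_lt (by omega)
        have hex : ∃ y : Set.Iio m, Det ⟨.inl ⟨r, h⟩, b⟩ y := ⟨⟨y, hlt⟩, q, hq, hqe, hy⟩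
        have : P.fn h b = some hex.choose := dif_pos hex
        simp [PartialStr.DefinedAt, this]
      · have hex : ∃ v : Bool, Det ⟨.inr ⟨r, R⟩, b⟩ v.toNat := by
          simp only [atomVal] at hA
          split_ifs at hA
          · exact ⟨true, q, hq, hqe, by subst hA; exact hy⟩
          · exact ⟨false, q, hq, hqe, by subst hA; exact hy⟩
        have : P.rel R b = some hex.choose := dif_pos hex
        simp [PartialStr.DefinedAt, this]
    omega
  obtain ⟨w, i, hw⟩ := verifies_of_determinacy_le hsize
  -- A literal involves at most one atom of `K`, hence depends on at most `d` facts. Only these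
  -- facts, one batch for each of the `J` literals, are kept.
  have hlit : ∀ j, ∃ q : Finset (AtomFact L), q.card ≤ d ∧
      (∀ x ∈ q, x.Holds S e ∧ ∀ i ∈ x.supp, i < n) ∧
      ∀ A, Compat code n A q → LitTrue code' m (zeroNat f A a) (fun i => (w i : ℕ))
        (φ.lit i j) := by
    intro j
    obtain ⟨Φ, ⟨q, hq, hqe, rfl⟩, hΦ⟩ := litTrue_of_verifiesLit (code := code') (P := P)
      (C := {Φ | ∃ q : Finset (AtomFact L), q.card ≤ d ∧
        (∀ x ∈ q, x.Holds S e ∧ ∀ i ∈ x.supp, i < n) ∧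
        Φ = (fun A => zeroNat f A a) '' {A | Compat code n A q}})
      ⟨_, ∅, by simp, by simp, rfl⟩ (by
        intro r h b c hc
        simp only [P] at hc
        split at hc
        · rename_i hex
          obtain rfl := Option.some.inj hc
          obtain ⟨q, hq, hqe, hy⟩ := hex.choose_spec
          exact ⟨_, ⟨q, hq, hqe, rfl⟩, by rintro _ ⟨A, hA, rfl⟩; exact hy A hA⟩
        · simp at hc) (by
        intro r R b v hv
        simp only [P] at hv
        split at hv
        · rename_i hex
          obtain rfl := Option.some.inj hv
          obtain ⟨q, hq, hqe, hy⟩ := hex.choose_spec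
          exact ⟨_, ⟨q, hq, hqe, rfl⟩, by rintro _ ⟨A, hA, rfl⟩; exact hy A hA⟩
        · simp at hv) (hw j)
    exact ⟨q, hq, hqe, fun A hA => hΦ _ ⟨A, hA, rfl⟩⟩
  choose q hq hqe hqA using hlit
  refine ⟨p ∪ Finset.univ.biUnion q, Finset.subset_union_left, ?_, ⟨e, he, fun x hx => ?_⟩,
    fun i => w i, i, fun j => (w j).2, fun A hA j => hqA j A (hA.mono ?_)⟩
  · refine (Finset.card_union_le _ _).trans (Nat.add_le_add_left ?_ _)
    simpa using Finset.card_biUnion_le_card_mul Finset.univ q d fun j _ => hq j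
  · rcases Finset.mem_union.1 hx with hx | hx
    · exact hpe x hx
    · obtain ⟨j, _, hx⟩ := Finset.mem_biUnion.1 hx
      exact hqe j x hx
  · exact (Finset.subset_biUnion_of_mem q (Finset.mem_univ j)).trans Finset.subset_union_right

/-- Verification of a principle by a condition that decides all atoms of the structure on `[m]`. -/
theorem Good.exists_verifying_of_decided (hc : Function.Injective code)
    {φ : BasicSentence (K.sum PV)} (hφ : IsFinitaryPrinciple φ) {k : ℕ}
    {f : PVα.Functions (k + 1)} {m d : ℕ} {a : Fin k → ℕ}
    (hd : ∀ x : AtomOn K m, QC d (fun A => atomVal code' m (zeroNat f A a) x)) (hm0 : 0 < m)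
    {n : ℕ} {p : Finset (AtomFact L)} (hp : Good S n p)
    (hn : (p.card + totalSize K m * d) * width L ≤ n) :
    ∃ q, p ⊆ q ∧ q.card ≤ p.card + totalSize K m * d ∧ Good S n q ∧
      ∃ (w : Fin φ.vars → ℕ) (i : Fin φ.I), (∀ j, w j < m) ∧ ∀ A, Compat code n A q →
        ∀ j, LitTrue code' m (zeroNat f A a) w (φ.lit i j) := by
  have hQ := QC.pi_fintype hd
  rw [card_atomOn] at hQ
  obtain ⟨q, hq, hg, V, hV⟩ := Good.exists_forces hQ p hp hn
  obtain ⟨A₀, hA₀⟩ := hg.exists_compat hc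
  -- One compatible oracle yields a total structure, in which the principle holds; since all atoms
  -- are decided, every other compatible oracle yields the same values.
  let T : K.Structure (Set.Iio m) :=
    { funMap := fun {r} h b => ⟨atomVal code' m (zeroNat f A₀ a) ⟨.inl ⟨r, h⟩, b⟩,
        Set.mem_Iio.2 ((min_le_right _ _).trans_lt (show m - 1 < m by omega))⟩
      RelMap := fun {r} R b => atomVal code' m (zeroNat f A₀ a) ⟨.inr ⟨r, R⟩, b⟩ = 1 }
  obtain ⟨w, i, hw⟩ := hφ m hm0 T
  have hsame : ∀ A, Compat code n A (p ∪ q) → ∀ x,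
      atomVal code' m (zeroNat f A a) x = atomVal code' m (zeroNat f A₀ a) x := fun A hA x =>
    congrFun ((hV A (hA.mono Finset.subset_union_right)).trans
      (hV A₀ (hA₀.mono Finset.subset_union_right)).symm) x
  refine ⟨p ∪ q, Finset.subset_union_left, (Finset.card_union_le _ _).trans (by omega), hg,
    fun i => w i, i, fun j => (w j).2, fun A hA j => ?_⟩
  obtain ⟨_, rfl, hΦ⟩ := litTrue_of_verifiesLit (code := code')
    (C := {{X | ∀ x, atomVal code' m X x = atomVal code' m (zeroNat f A₀ a) x}})
    (Set.singleton_nonempty _) (by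
      intro r h b c hc
      exact ⟨_, rfl, fun X hX => (hX _).trans (congrArg Subtype.val (Option.some.inj hc))⟩) (by
      intro r R b v hv
      refine ⟨_, rfl, fun X hX => (hX _).trans ?_⟩
      have hv : some (decide (T.RelMap R b)) = some v := hv
      obtain rfl := Option.some.inj hv
      have hT : T.RelMap R b ↔ atomVal code' m (zeroNat f A₀ a) ⟨.inr ⟨r, R⟩, b⟩ = 1 := Iff.rfl
      by_cases h : T.RelMap R b
      · rw [hT.1 h, decide_eq_true h, Bool.toNat_true]
      · rw [decide_eq_false h, Bool.toNat_false]
        rw [hT] at h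
        exact if_neg fun h' => h (if_pos h')) (hw j)
  exact hΦ _ (hsame A hA)

/-- Every condition can be extended by few facts to one that verifies a weak principle in the
structure on `[m]` coded by a definable oracle. -/
theorem exists_verifying [Infinite B] (κ : BasicSymbols) (hc : Function.Injective code) (hL : IsLarge S g)
    (hg : Monotone g) {φ : BasicSentence (K.sum PV)} (hφ : IsFinitaryPrinciple φ)
    (hweak : IsWeak φ) {k : ℕ} (f : PVα.Functions (k + 1)) :
    ∃ Q D : Polynomial ℕ, ∀ (n : ℕ) (p : Finset (AtomFact L)) (m : ℕ) (a : Fin k → ℕ), 0 < m →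
      Good S n p → Q.eval (p.card + m.size + sz a + g n) ≤ n →
      ∃ q, p ⊆ q ∧ q.card ≤ p.card + D.eval (m.size + sz a) ∧ Good S n q ∧
        ∃ (w : Fin φ.vars → ℕ) (i : Fin φ.I), (∀ j, w j < m) ∧ ∀ A, Compat code n A q →
          ∀ j, LitTrue code' m (zeroNat f A a) w (φ.lit i j) := by
  obtain ⟨P, hP⟩ := atomVal_qc (code := code') κ f
  obtain ⟨m₀, hm₀⟩ := hweak.eventually_two_mul_le
  let W : Polynomial ℕ := Polynomial.C (width L)
  let C : Polynomial ℕ := Polynomial.C (totalSize K m₀)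
  let J : Polynomial ℕ := Polynomial.C φ.J
  let X : Polynomial ℕ := Polynomial.X
  refine ⟨X * W + P * W + (2 * (P * W * (P * X)) + 1) + P * X + (X + C * P) * W, J * P + C * P,
    fun n p m a hm hp hn => ?_⟩
  simp only [Polynomial.eval_add, Polynomial.eval_mul, Polynomial.eval_C, Polynomial.eval_X,
    Polynomial.eval_one, Polynomial.eval_ofNat, X, W, C, J] at hn ⊢
  have hle : P.eval (m.size + sz a) ≤ P.eval (p.card + m.size + sz a + g n) :=
    P.eval_mono_nat (by omega)
  set d := P.eval (m.size + sz a)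
  set E := P.eval (p.card + m.size + sz a + g n)
  have hx : p.card ≤ p.card + m.size + sz a + g n := by omega
  have hx' : g n ≤ p.card + m.size + sz a + g n := by omega
  set x := p.card + m.size + sz a + g n
  -- Below the threshold weakness says nothing, but the number of atoms is bounded by the constant
  -- `totalSize K m₀` and all can be decided.
  by_cases h : m₀ ≤ m
  · obtain ⟨q, h1, h2, h3⟩ := hp.exists_verifying_of_determinacy (code := code) hc hL hg (hm₀ m h)
      (fun y => hP m a y) hm (by
        refine le_trans ?_ ((Nat.le_add_right _ _).trans hn)
        gcongr)
    exact ⟨q, h1, h2.trans (Nat.add_le_add_left (Nat.le_add_right _ _) _), h3⟩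
  · have hs : totalSize K m ≤ totalSize K m₀ := Finset.sum_le_sum fun s _ =>
      Nat.pow_le_pow_left (by omega) _
    obtain ⟨q, h1, h2, h3⟩ := hp.exists_verifying_of_decided (code := code) hc hφ
      (fun y => hP m a y) hm (by
        refine le_trans ?_ ((Nat.le_add_left _ _).trans hn)
        gcongr)
    exact ⟨q, h1, h2.trans (Nat.add_le_add_left ((Nat.mul_le_mul_right _ hs).trans
      (Nat.le_add_left _ _)) _), h3⟩

end WeakPrinciple

/-! ## Requirements on conditions -/

section Requirements

variable {L : FirstOrder.Language.{0, 0}} {B : Type}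

/-- A density requirement: every condition with sufficient room has a small extension such that,
together with some numbers, a given relation holds. -/
structure Req (S : L.Structure B) (g : ℕ → ℕ) where
  b : ℕ
  l : ℕ
  Post : ℕ → Finset (AtomFact L) → (Fin b ⊕ Fin l → ℕ) → Finset (AtomFact L) → (ℕ → ℕ) → Prop
  D : Polynomial ℕ
  Q : Polynomial ℕ
  solvable : ∀ n p v, Good S n p → Q.eval (p.card + sz v + g n) ≤ n →
    ∃ q w, p ⊆ q ∧ q.card ≤ p.card + D.eval (sz v) ∧ Good S n q ∧ Post n p v q w

namespace Req

open Classical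

variable {S : L.Structure B} {g : ℕ → ℕ} (ρ : Req S g)

/-- Where there is no room the condition is left unchanged. Thus solutions form a total function
that is monotone and size-bounded unconditionally, and they can be iterated before goodness is
known. -/
theorem exists_sol (n : ℕ) (p : Finset (AtomFact L)) (v : Fin ρ.b ⊕ Fin ρ.l → ℕ) :
    ∃ s : Finset (AtomFact L) × (ℕ → ℕ), p ⊆ s.1 ∧ s.1.card ≤ p.card + ρ.D.eval (sz v) ∧
      (Good S n p → ρ.Q.eval (p.card + sz v + g n) ≤ n → Good S n s.1 ∧ ρ.Post n p v s.1 s.2) := by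
  by_cases h : Good S n p ∧ ρ.Q.eval (p.card + sz v + g n) ≤ n
  · obtain ⟨q, w, h1, h2, h3⟩ := ρ.solvable n p v h.1 h.2
    exact ⟨(q, w), h1, h2, fun _ _ => h3⟩
  · exact ⟨(p, fun _ => 0), subset_rfl, Nat.le_add_right _ _, fun h1 h2 => absurd ⟨h1, h2⟩ h⟩

/-- A chosen solution. -/
noncomputable def sol (n : ℕ) (p : Finset (AtomFact L)) (v : Fin ρ.b ⊕ Fin ρ.l → ℕ) :
    Finset (AtomFact L) × (ℕ → ℕ) := (ρ.exists_sol n p v).choose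

theorem sol_spec (n : ℕ) (p : Finset (AtomFact L)) (v : Fin ρ.b ⊕ Fin ρ.l → ℕ) :
    p ⊆ (ρ.sol n p v).1 ∧ (ρ.sol n p v).1.card ≤ p.card + ρ.D.eval (sz v) ∧
      (Good S n p → ρ.Q.eval (p.card + sz v + g n) ≤ n →
        Good S n (ρ.sol n p v).1 ∧ ρ.Post n p v (ρ.sol n p v).1 (ρ.sol n p v).2) :=
  (ρ.exists_sol n p v).choose_spec

end Req

open Classical

variable (S : L.Structure B) (g : ℕ → ℕ) (code : L.Symbols → ℕ)

/-- To decide the value of a functional. -/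
noncomputable def Req.decide [Fintype L.Symbols] (b l : ℕ)
    (F : Set ℕ → (Fin b ⊕ Fin l → ℕ) → ℕ)
    (D : Polynomial ℕ) (hF : ∀ v, QC (D.eval (sz v)) (fun A => F A v)) : Req S g where
  b := b
  l := l
  Post n _ v q w := ∃ p' ⊆ q, p'.card ≤ D.eval (sz v) ∧ Forces code n p' (fun A => F A v) (w 0)
  D := D
  Q := (Polynomial.X + D) * Polynomial.C (width L)
  solvable n p v hp hn := by
    obtain ⟨q, hq, hg, x, hx⟩ := Good.exists_forces (hF v) p hp (le_trans (by
      simp only [Polynomial.eval_mul, Polynomial.eval_add, Polynomial.eval_X, Polynomial.eval_C]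
      gcongr
      · omega
      · exact D.eval_mono_nat (by omega)) hn)
    exact ⟨p ∪ q, fun _ => x, Finset.subset_union_left, (Finset.card_union_le _ _).trans (by omega),
      hg, q, Finset.subset_union_right, hq, hx⟩

/-- To make the first number below a bound verified that can be verified at all. -/
noncomputable def Req.min (b l : ℕ)
    (W : ℕ → Finset (AtomFact L) → (Fin b ⊕ Fin l → ℕ) → ℕ → Prop)
    (bd : (Fin b ⊕ Fin l → ℕ) → ℕ) (D : Polynomial ℕ)
    (hmono : ∀ n p q v y, W n p v y → p ⊆ q → W n q v y)
    (hsupp : ∀ n p v y, y < bd v → W n p v y → ∃ p' ⊆ p, p'.card ≤ D.eval (sz v) ∧ W n p' v y) :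
    Req S g where
  b := b
  l := l
  Post n p v q w := (w 0 < bd v ∧ W n q v (w 0) ∧
      ∀ z < w 0, ∀ r, p ⊆ r → Good S n r → ¬ W n r v z) ∨
    ∀ z < bd v, ∀ r, p ⊆ r → Good S n r → ¬ W n r v z
  D := D
  Q := 0
  solvable n p v hp _ := by
    by_cases h : ∃ z < bd v, ∃ r, p ⊆ r ∧ Good S n r ∧ W n r v z
    · obtain ⟨hlt, r, hpr, hr, hW⟩ := Nat.find_spec h
      obtain ⟨p', hp', hc, hW'⟩ := hsupp n r v _ hlt hW
      refine ⟨p ∪ p', fun _ => Nat.find h, Finset.subset_union_left,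
        (Finset.card_union_le _ _).trans (Nat.add_le_add_left hc _),
        hr.mono (Finset.union_subset hpr hp'), .inl ⟨hlt, hmono _ _ _ _ _ hW'
          Finset.subset_union_right, fun z hz r hpr hr hW => ?_⟩⟩
      exact Nat.find_min h hz ⟨hz.trans hlt, r, hpr, hr, hW⟩
    · push Not at h
      exact ⟨p, fun _ => 0, subset_rfl, Nat.le_add_right _ _, hp, .inr h⟩

/-- To make as many numbers below a bound verified as possible. -/
noncomputable def Req.all (b l : ℕ)
    (W : ℕ → Finset (AtomFact L) → (Fin b ⊕ Fin l → ℕ) → ℕ → Prop)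
    (bd : (Fin b ⊕ Fin l → ℕ) → ℕ) (D E : Polynomial ℕ) (hbd : ∀ v, bd v ≤ E.eval (sz v))
    (hmono : ∀ n p q v y, W n p v y → p ⊆ q → W n q v y)
    (hsupp : ∀ n p v y, y < bd v → W n p v y → ∃ p' ⊆ p, p'.card ≤ D.eval (sz v) ∧ W n p' v y) :
    Req S g where
  b := b
  l := l
  Post n _ v q w := w 0 ≤ bd v ∧ (∀ y < w 0, W n q v y) ∧
    (w 0 < bd v → ∀ r, q ⊆ r → Good S n r → ¬ W n r v (w 0))
  D := E * D
  Q := 0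
  solvable n p v hp _ := by
    -- The first `x` numbers can be verified within the budget of `D` facts each. At the maximal
    -- such `x`, an extension verifying `x` as well would, through its small support, contradict
    -- maximality.
    let R : ℕ → Prop := fun x => ∃ q, p ⊆ q ∧ q.card ≤ p.card + x * D.eval (sz v) ∧ Good S n q ∧
      ∀ y < x, W n q v y
    have h0 : R 0 := ⟨p, subset_rfl, by simp, hp, by simp⟩
    obtain ⟨q, h1, h2, h3, h4⟩ := Nat.findGreatest_spec (P := R) (Nat.zero_le (bd v)) h0
    have hle : Nat.findGreatest R (bd v) ≤ bd v := Nat.findGreatest_le _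
    refine ⟨q, fun _ => Nat.findGreatest R (bd v), h1, ?_, h3, hle, h4, ?_⟩
    · rw [Polynomial.eval_mul]
      exact h2.trans (Nat.add_le_add_left (Nat.mul_le_mul_right _ (hle.trans (hbd v))) _)
    · intro hlt r hqr hr hW
      obtain ⟨p', hp', hc, hW'⟩ := hsupp n r v _ hlt hW
      refine Nat.findGreatest_is_greatest (P := R) (Nat.lt_succ_self _) hlt ⟨q ∪ p',
        h1.trans Finset.subset_union_left, ?_, hr.mono (Finset.union_subset hqr hp'), ?_⟩
      · rw [Nat.succ_mul]
        exact (Finset.card_union_le _ _).trans (by omega)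
      · intro y hy
        rcases Nat.lt_succ_iff_lt_or_eq.1 hy with hy | rfl
        · exact hmono _ _ _ _ _ (h4 y hy) Finset.subset_union_left
        · exact hmono _ _ _ _ _ hW' Finset.subset_union_right

/-- To define a value of a function. -/
noncomputable def Req.value [Fintype L.Symbols] {r : ℕ} (f : L.Functions r) : Req S g where
  b := r
  l := 0
  Post n _ v q w := (∀ i, v (.inl i) < n) →
    AtomFact.fn f (fun i => v (.inl i)) (w 0) ∈ q ∧ w 0 < n
  D := 1
  Q := (Polynomial.X + 1) * Polynomial.C (width L)
  solvable n p v hp hn := by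
    by_cases hv : ∀ i, v (.inl i) < n
    · obtain ⟨b, hb, hg⟩ := hp.exists_fn (le_trans (by
        simp only [Polynomial.eval_mul, Polynomial.eval_add, Polynomial.eval_X, Polynomial.eval_C,
          Polynomial.eval_one]
        gcongr
        omega) hn) f (fun i => v (.inl i)) hv
      exact ⟨_, fun _ => b, Finset.subset_insert _ _, by
        simpa using Finset.card_insert_le _ _, hg, fun _ => ⟨Finset.mem_insert_self _ _, hb⟩⟩
    · exact ⟨p, fun _ => 0, subset_rfl, Nat.le_add_right _ _, hp, fun h => absurd h hv⟩

/-- To verify a weak principle in the structure coded by a definable oracle. -/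
noncomputable def Req.verify [Fintype L.Symbols] [Infinite B] (κ : BasicSymbols)
    (hc : Function.Injective code) (hL : IsLarge S g) (hg : Monotone g)
    {K : FirstOrder.Language.{0, 0}} [Fintype K.Symbols] (code' : K.Symbols → ℕ)
    {φ : BasicSentence (K.sum PV)} (hφ : IsFinitaryPrinciple φ)
    (hweak : IsWeak φ) {k : ℕ} (f : PVα.Functions (k + 1)) : Req S g where
  b := k + 1
  l := 0
  Post n _ v q w := 0 < v (.inl 0) → ∃ i : Fin φ.I, (∀ j < φ.vars, w j < v (.inl 0)) ∧
    ∀ A, Compat code n A q → ∀ j, LitTrue code' (v (.inl 0))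
      (zeroNat f A fun i : Fin k => v (.inl i.succ)) (fun j => w j) (φ.lit i j)
  D := (exists_verifying (code' := code') κ hc hL hg hφ hweak f).choose_spec.choose
  Q := (exists_verifying (code' := code') κ hc hL hg hφ hweak f).choose
  solvable n p v hp hn := by
    have h := (exists_verifying (code' := code') κ hc hL hg hφ hweak f).choose_spec.choose_spec
    by_cases hm : 0 < v (.inl 0)
    · have hsz : sz v = (v (.inl 0)).size + sz fun i : Fin k => v (.inl i.succ) := by
        simp [sz, Fintype.sum_sum_type, Fin.sum_univ_succ]
      rw [hsz, ← add_assoc] at hn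
      obtain ⟨q, h1, h2, h3, w, i, hw, hA⟩ := h n p _ _ hm hp hn
      refine ⟨q, fun j => if hj : j < φ.vars then w ⟨j, hj⟩ else 0, h1, hsz ▸ h2, h3, fun _ =>
        ⟨i, fun j hj => ?_, fun A hA' j => ?_⟩⟩
      · simpa [hj] using hw ⟨j, hj⟩
      · simpa using hA A hA' j
    · exact ⟨p, fun _ => 0, subset_rfl, Nat.le_add_right _ _, hp, fun h => absurd h hm⟩

end Requirements

section GenericModels

open Filter

/-! ## Generic models -/

/-- `x` is `n^{o(1)}` in an ultrapower. -/
def Subpoly (U : Filter ℕ) (n x : ℕ → ℕ) : Prop := ∀ c : ℕ, ∀ᶠ k in U, x k ^ c ≤ n k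

namespace Subpoly

variable {U : Filter ℕ} {n x y : ℕ → ℕ}

theorem mono (h : Subpoly U n y) (hxy : ∀ᶠ k in U, x k ≤ y k) : Subpoly U n x := fun c => by
  filter_upwards [h c, hxy] with k h1 h2 using (Nat.pow_le_pow_left h2 c).trans h1

theorem const (hn : ∀ c, ∀ᶠ k in U, c ≤ n k) (a : ℕ) : Subpoly U n fun _ => a := fun c => hn (a ^ c)

theorem max (hx : Subpoly U n x) (hy : Subpoly U n y) : Subpoly U n fun k => Max.max (x k) (y k) :=
  fun c => by
    filter_upwards [hx c, hy c] with k h1 h2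
    rcases max_choice (x k) (y k) with h | h <;> rwa [h]

theorem mul (hx : Subpoly U n x) (hy : Subpoly U n y) : Subpoly U n fun k => x k * y k := by
  have h : Subpoly U n fun k => Max.max (x k) (y k) * Max.max (x k) (y k) := fun c => by
    -- The `c`-th power of a product of two factors is controlled by the `2c`-th power of their
    -- maximum.
    filter_upwards [(hx.max hy) (2 * c)] with k h1
    rwa [← pow_two, ← pow_mul]
  exact h.mono (Eventually.of_forall fun k =>
    Nat.mul_le_mul (le_max_left _ _) (le_max_right _ _))

theorem add (hn : ∀ c, ∀ᶠ k in U, c ≤ n k) (hx : Subpoly U n x) (hy : Subpoly U n y) :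
    Subpoly U n fun k => x k + y k :=
  ((const hn 2).mul (hx.max hy)).mono (Eventually.of_forall fun k => by
    have := le_max_left (x k) (y k)
    have := le_max_right (x k) (y k)
    change x k + y k ≤ 2 * Max.max (x k) (y k)
    omega)

theorem sum {α : Type} (hn : ∀ c, ∀ᶠ k in U, c ≤ n k) (s : Finset α) {f : α → ℕ → ℕ}
    (hf : ∀ i, Subpoly U n (f i)) : Subpoly U n fun k => ∑ i ∈ s, f i k := by
  classical
  induction s using Finset.induction_on with
  | empty => simpa using const hn 0
  | insert a s ha ih => simpa [Finset.sum_insert ha] using (hf a).add hn ih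

/-- Closure under polynomials is what guarantees room: evaluated at small arguments, the bound `Q`
of any requirement is almost everywhere below `n`. -/
theorem eval (hn : ∀ c, ∀ᶠ k in U, c ≤ n k) (hx : Subpoly U n x) (p : Polynomial ℕ) :
    Subpoly U n fun k => p.eval (x k) := by
  induction p using Polynomial.induction_on' with
  | add p q hp hq => simpa using hp.add hn hq
  | monomial d a =>
    have : Subpoly U n fun k => x k ^ d := fun c => by simpa [← pow_mul] using hx (d * c)
    simpa using (const hn a).mul this

end Subpoly

/-- A model on classes of sequences modulo an ultrafilter, together with a sequence of conditions
and an oracle that is generic for them. -/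
structure GenericModel {L : FirstOrder.Language.{0, 0}} (code : L.Symbols → ℕ) {B : Type}
    (S : L.Structure B) (N : Type) [PV.Structure N] [PVα.Structure N] where
  U : Ultrafilter ℕ
  n : ℕ → ℕ
  le_n : ∀ c, ∀ᶠ k in (U : Filter ℕ), c ≤ n k
  rep : N → ℕ → ℕ
  eq_of_rep : ∀ {a b : N}, (∀ᶠ k in (U : Filter ℕ), rep a k = rep b k) → a = b
  small : ∀ a : N, Subpoly U n fun k => (rep a k).size
  P : ℕ → ℕ → Finset (AtomFact L)
  P_mono : ∀ k, Monotone fun i => P i k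
  e : ℕ → ℕ → B
  e_inj : ∀ k, Set.InjOn (e k) (Set.Iio (n k))
  holds : ∀ i, ∀ᶠ k in (U : Filter ℕ), ∀ x ∈ P i k, x.Holds S (e k) ∧ ∀ i ∈ x.supp, i < n k
  rep_fn : ∀ {r : ℕ} (f : PVα.Functions r) (v : Fin r → N), ∀ᶠ k in (U : Filter ℕ),
    rep (Structure.funMap f v) k = f.1.eval (oracleOf code S (n k) (e k)) fun i => rep (v i) k
  lt_iff : ∀ {a b : N}, ltN a b ↔ ∀ᶠ k in (U : Filter ℕ), rep a k < rep b k
  mem_iff : ∀ {a : N}, a ∈ oracle N ↔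
    ∀ᶠ k in (U : Filter ℕ), rep a k ∈ oracleOf code S (n k) (e k)

namespace GenericModel

variable {L : FirstOrder.Language.{0, 0}} {code : L.Symbols → ℕ} {B : Type} {S : L.Structure B}
  {N : Type} [PV.Structure N] [PVα.Structure N] (G : GenericModel code S N)

/-- The components of a tuple of representatives. -/
def reps {α : Type} (v : α → N) (k : ℕ) : α → ℕ := fun i => G.rep (v i) k

/-- The standard oracles whose ultraproduct is the oracle of the model. -/
def A (k : ℕ) : Set ℕ := oracleOf code S (G.n k) (G.e k)

theorem reps_snoc {m : ℕ} (xs : Fin m → N) (x : N) (k : ℕ) :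
    G.reps (Fin.snoc xs x : Fin (m + 1) → N) k = Fin.snoc (G.reps xs k) (G.rep x k) := by
  funext i
  refine Fin.lastCases ?_ (fun i => ?_) i <;> simp [reps]

theorem reps_elim {α β : Type} (v : α → N) (w : β → N) (k : ℕ) :
    G.reps (Sum.elim v w) k = Sum.elim (G.reps v k) (G.reps w k) := by
  funext i
  rcases i with i | i <;> rfl

theorem small_reps {α : Type} [Fintype α] (v : α → N) : Subpoly G.U G.n fun k => sz (G.reps v k) :=
  Subpoly.sum G.le_n _ fun i => G.small (v i)

theorem compat (hc : Function.Injective code) (i : ℕ) : ∀ᶠ k in (G.U : Filter ℕ),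
    Compat code (G.n k) (G.A k) (G.P i k) := by
  filter_upwards [G.holds i] with k hk
  exact compat_oracleOf hc (G.e_inj k) hk

theorem good (i : ℕ) : ∀ᶠ k in (G.U : Filter ℕ), Good S (G.n k) (G.P i k) := by
  filter_upwards [G.holds i] with k hk using ⟨G.e k, G.e_inj k, hk⟩

/-- The requirement is met by the generic sequence of conditions. -/
def Meets {g : ℕ → ℕ} (ρ : Req S g) : Prop :=
  ∀ v : Fin ρ.b ⊕ Fin ρ.l → N, ∃ (i : ℕ) (s : ℕ → ℕ → ℕ),
    (∀ᶠ k in (G.U : Filter ℕ), ρ.Post (G.n k) (G.P i k) (G.reps v k) (G.P (i + 1) k) (s k)) ∧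
    ∀ j, Subpoly G.U G.n (fun k => (s k j).size) →
      ∃ a : N, ∀ᶠ k in (G.U : Filter ℕ), G.rep a k = s k j

theorem rep_term {α : Type} (t : PVα.Term α) (v : α → N) :
    ∀ᶠ k in (G.U : Filter ℕ), G.rep (t.realize v) k = tval (G.A k) t (G.reps v k) := by
  induction t with
  | var i => exact Eventually.of_forall fun k => rfl
  | func f ts ih =>
    filter_upwards [G.rep_fn f fun i => (ts i).realize v, eventually_all.2 ih] with k h1 h2
    rw [Term.realize_func, h1]
    change f.1.eval _ _ = f.1.eval _ _
    congr 1
    funext i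
    exact h2 i

theorem rep_pvTerm [PV.incl.IsExpansionOn N] {α : Type} (t : PV.Term α) (v : α → N) :
    ∀ᶠ k in (G.U : Filter ℕ), G.rep (t.realize v) k = t.realize (G.reps v k) := by
  filter_upwards [G.rep_term (PV.incl.onTerm t) v] with k h
  rwa [LHom.realize_onTerm, tval_incl] at h

theorem eq_iff {a b : N} : a = b ↔ ∀ᶠ k in (G.U : Filter ℕ), G.rep a k = G.rep b k :=
  ⟨fun h => h ▸ Eventually.of_forall fun _ => rfl, G.eq_of_rep⟩

theorem realize_atomic [PV.incl.IsExpansionOn N] {β : Type} {m : ℕ} {φ : PVα.BoundedFormula β m} (h : φ.IsAtomic)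
    (v : β → N) (xs : Fin m → N) : φ.Realize v xs ↔
      ∀ᶠ k in (G.U : Filter ℕ), fval (G.A k) φ (G.reps v k) (G.reps xs k) := by
  cases h with
  | equal t₁ t₂ =>
    rw [BoundedFormula.realize_bdEqual, eq_iff]
    refine eventually_congr ?_
    filter_upwards [G.rep_term t₁ (Sum.elim v xs), G.rep_term t₂ (Sum.elim v xs)] with k h1 h2
    rw [h1, h2, reps_elim]
    let := PVα.standard (G.A k)
    exact (BoundedFormula.realize_bdEqual (M := ℕ) t₁ t₂).symm
  | @rel l R ts =>
    rw [BoundedFormula.realize_rel]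
    have ht := eventually_all.2 fun i => G.rep_term (ts i) (Sum.elim v xs)
    cases R with
    | lt =>
      have h1 : Structure.RelMap (L := PVα) PVαRel.lt (fun i => (ts i).realize (Sum.elim v xs)) ↔
          ltN ((ts 0).realize (Sum.elim v xs)) ((ts 1).realize (Sum.elim v xs)) := by
        rw [← relMap_lt_iff]
        refine iff_of_eq (congrArg _ ?_)
        funext i
        fin_cases i <;> rfl
      rw [h1, G.lt_iff]
      refine eventually_congr ?_
      filter_upwards [ht] with k hk
      rw [hk, hk, reps_elim]
      rfl
    | alpha =>
      have h1 : Structure.RelMap (L := PVα) PVαRel.alpha (fun i => (ts i).realize (Sum.elim v xs)) ↔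
          (ts 0).realize (Sum.elim v xs) ∈ oracle N := by
        refine iff_of_eq (congrArg _ ?_)
        funext i
        fin_cases i; rfl
      rw [h1, G.mem_iff]
      refine eventually_congr ?_
      filter_upwards [ht] with k hk
      rw [hk, reps_elim]
      rfl

theorem realize_isQF [PV.incl.IsExpansionOn N] {β : Type} {m : ℕ} {φ : PVα.BoundedFormula β m} (h : φ.IsQF)
    (v : β → N) (xs : Fin m → N) : φ.Realize v xs ↔
      ∀ᶠ k in (G.U : Filter ℕ), fval (G.A k) φ (G.reps v k) (G.reps xs k) := by
  induction h with
  | falsum => exact iff_of_false id fun h => h.exists.elim fun _ hk => hk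
  | of_isAtomic h => exact G.realize_atomic h v xs
  | imp _ _ ih₁ ih₂ =>
    rw [BoundedFormula.realize_imp, ih₁, ih₂, ← Ultrafilter.eventually_imp]
    rfl

/-- In effect `N` is a substructure of the ultraproduct of the `⟨ℕ, A k⟩`, so the transfer is
one-directional: coordinatewise counterexamples to the quantifier need not be represented in `N`. -/
theorem realize_isUniversal [PV.incl.IsExpansionOn N] {β : Type} {m : ℕ} {φ : PVα.BoundedFormula β m}
    (h : BoundedFormula.IsUniversal φ) (v : β → N) (xs : Fin m → N)
    (hφ : ∀ᶠ k in (G.U : Filter ℕ), fval (G.A k) φ (G.reps v k) (G.reps xs k)) :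
    φ.Realize v xs := by
  induction h with
  | of_isQF h => exact (G.realize_isQF h v xs).2 hφ
  | all _ ih =>
    refine BoundedFormula.realize_all.2 fun a => ih _ ?_
    filter_upwards [hφ] with k hk
    rw [reps_snoc]
    exact hk (G.rep a k)

theorem models_forallPVα {L : FirstOrder.Language.{0, 0}} {code : L.Symbols → ℕ} {B : Type}
    {S : L.Structure B} {N : Type} [PV.Structure N] [PVα.Structure N] [PV.incl.IsExpansionOn N]
    (G : GenericModel code S N) : N ⊨ forallPVα := by
  rw [Theory.model_iff]
  intro σ hσ
  refine G.realize_isUniversal hσ.1 _ _ (Eventually.of_forall fun k => ?_)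
  have h := hσ.2 (G.A k)
  change @BoundedFormula.Realize PVα ℕ (PVα.standard (G.A k)) Empty 0 σ _ _ at h
  rw [fval]
  convert h

end GenericModel

end GenericModels

section Truth

open Filter

/-! ## Truth of bounded formulas in generic models -/

variable {L : FirstOrder.Language.{0, 0}} {code : L.Symbols → ℕ} {B : Type}
  {S : L.Structure B} {g : ℕ → ℕ} {κ : BasicSymbols}

/-- Values of functionals of polynomial query complexity exist in generic models. -/
theorem GenericModel.exists_rep_of_meets_decide [Fintype L.Symbols] (hc : Function.Injective code)
    {N : Type} [PV.Structure N] [PVα.Structure N] (G : GenericModel code S N) {b l : ℕ} {F : Set ℕ → (Fin b ⊕ Fin l → ℕ) → ℕ} {D : Polynomial ℕ}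
    {hF : ∀ v, QC (D.eval (sz v)) (fun A => F A v)} (h : G.Meets (.decide S g code b l F D hF))
    (v : Fin b ⊕ Fin l → N)
    (hs : Subpoly G.U G.n fun k => (F (G.A k) (G.reps v k)).size) :
    ∃ a : N, ∀ᶠ k in (G.U : Filter ℕ), G.rep a k = F (G.A k) (G.reps v k) := by
  obtain ⟨i, s, hP, ha⟩ := h v
  have hs' : ∀ᶠ k in (G.U : Filter ℕ), s k 0 = F (G.A k) (G.reps v k) := by
    filter_upwards [hP, G.compat hc (i + 1)] with k hk hA
    obtain ⟨p', hp', -, hF⟩ := hk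
    exact (hF _ (hA.mono hp')).symm
  obtain ⟨a, ha⟩ := ha 0 (hs.mono (by filter_upwards [hs'] with k hk using by rw [hk]))
  refine ⟨a, ?_⟩
  filter_upwards [ha, hs'] with k h1 h2 using h1.trans h2

theorem Nat.size_le_self (x : ℕ) : x.size ≤ x := Nat.size_le.2 Nat.lt_two_pow_self

/-- Sharply bounded search in generic models. -/
theorem exists_req_search [Fintype L.Symbols] (hc : Function.Injective code) (S : L.Structure B) (g : ℕ → ℕ) {b l : ℕ}
    (t : PV.Term (Fin b ⊕ Fin l)) {F : Set ℕ → (Fin b → ℕ) → (Fin (l + 1) → ℕ) → Prop}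
    {p : Polynomial ℕ} (hF : ∀ v xs, QC (p.eval (sz v + sz xs)) (fun A => F A v xs)) :
    ∃ ρ : Req S g, ∀ {N : Type} [PV.Structure N] [PVα.Structure N] [PV.incl.IsExpansionOn N]
      (G : GenericModel code S N), G.Meets ρ → ∀ v xs,
      (∀ᶠ k in (G.U : Filter ℕ), ∃ x < (κ.len.apply₁ t).realize
        (Sum.elim (G.reps v k) (G.reps xs k)), F (G.A k) (G.reps v k) (Fin.snoc (G.reps xs k) x)) →
      ∃ x : N, ltN x ((κ.len.apply₁ t).realize (Sum.elim v xs)) ∧ ∀ᶠ k in (G.U : Filter ℕ),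
        F (G.A k) (G.reps v k) (Fin.snoc (G.reps xs k) (G.rep x k)) := by
  classical
  obtain ⟨q, hq⟩ := PVTerm.exists_bound t
  let T : (Fin b ⊕ Fin l → ℕ) → ℕ := fun w => (κ.len.apply₁ t).realize w
  -- The least witness, with default `0`. It is found by evaluating `F` at all arguments below a
  -- polynomial bound, and it is small because it lies below a length.
  let H : Set ℕ → (Fin b ⊕ Fin l → ℕ) → ℕ := fun A w =>
    if h : ∃ x, ∃ hx : x < T w, F A (w ∘ Sum.inl) (Fin.snoc (w ∘ Sum.inr) x) then Nat.find h else 0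
  have hT : ∀ w, T w ≤ q.eval (sz w) := fun w => by
    simp only [T, realize_len]
    exact hq w
  have hsz : ∀ w : Fin b ⊕ Fin l → ℕ, sz (w ∘ Sum.inl) + sz (w ∘ Sum.inr) = sz w := fun w => by
    rw [← sz_elim, Sum.elim_comp_inl_inr]
  have hH : ∀ w, QC ((q * p.comp (Polynomial.X + q)).eval (sz w)) (fun A => H A w) := by
    intro w
    have h1 := QC.seq (F := fun x A => F A (w ∘ Sum.inl) (Fin.snoc (w ∘ Sum.inr) x))
      (d := p.eval (sz w + q.eval (sz w))) (T w) fun x hx => (hF _ _).mono (by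
        refine p.eval_mono_nat ?_
        rw [sz_snoc, ← add_assoc, hsz]
        have := Nat.size_le_self x
        have := hT w
        omega)
    have h2 := h1.map fun f : Fin (T w) → Prop =>
      if h : ∃ x, ∃ hx : x < T w, f ⟨x, hx⟩ then Nat.find h else 0
    refine h2.mono ?_
    rw [Polynomial.eval_mul, Polynomial.eval_comp]
    simpa using Nat.mul_le_mul_right _ (hT w)
  have hHs : ∀ A w, (∃ x < T w, F A (w ∘ Sum.inl) (Fin.snoc (w ∘ Sum.inr) x)) →
      H A w < T w ∧ F A (w ∘ Sum.inl) (Fin.snoc (w ∘ Sum.inr) (H A w)) := by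
    rintro A w ⟨x, hx, hF⟩
    have h : ∃ x, ∃ hx : x < T w, F A (w ∘ Sum.inl) (Fin.snoc (w ∘ Sum.inr) x) := ⟨x, hx, hF⟩
    have : H A w = Nat.find h := dif_pos h
    rw [this]
    obtain ⟨h1, h2⟩ := Nat.find_spec h
    exact ⟨h1, h2⟩
  refine ⟨.decide S g code b l H _ hH, fun {N} _ _ _ G hG v xs hex => ?_⟩
  have hk : ∀ᶠ k in (G.U : Filter ℕ), H (G.A k) (G.reps (Sum.elim v xs) k) <
      T (G.reps (Sum.elim v xs) k) ∧ F (G.A k) (G.reps v k) (Fin.snoc (G.reps xs k)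
        (H (G.A k) (G.reps (Sum.elim v xs) k))) := by
    filter_upwards [hex] with k hk
    rw [G.reps_elim]
    exact hHs (G.A k) (Sum.elim (G.reps v k) (G.reps xs k)) hk
  obtain ⟨x, hx⟩ := G.exists_rep_of_meets_decide hc hG (Sum.elim v xs)
    (((G.small_reps _).eval G.le_n q).mono (by
      filter_upwards [hk] with k hk
      exact (Nat.size_le_self _).trans (hk.1.le.trans (hT _))))
  refine ⟨x, G.lt_iff.2 ?_, ?_⟩
  · filter_upwards [hx, hk, G.rep_pvTerm (κ.len.apply₁ t) (Sum.elim v xs)] with k h1 h2 h3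
    rw [h1, h3]
    exact h2.1
  · filter_upwards [hx, hk] with k h1 h2
    rw [h1]
    exact h2.2

/-- For quantified formulas the transfer from coordinates needs the witnesses to form an element of
`N`. For sharply bounded quantifiers they are found by shallow trees, so one search requirement per
quantifier suffices. -/
theorem IsSharplyBounded.exists_realize_iff [Fintype L.Symbols] (hc : Function.Injective code) (S : L.Structure B)
    (g : ℕ → ℕ) {b l : ℕ} {φ : PVα.BoundedFormula (Fin b) l} (h : IsSharplyBounded κ φ) :
    ∃ C : Set (Req S g), C.Countable ∧ ∀ {N : Type} [PV.Structure N] [PVα.Structure N] [PV.incl.IsExpansionOn N]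
      (G : GenericModel code S N), (∀ ρ ∈ C, G.Meets ρ) →
      ∀ (v : Fin b → N) (xs : Fin l → N), φ.Realize v xs ↔
        ∀ᶠ k in (G.U : Filter ℕ), fval (G.A k) φ (G.reps v k) (G.reps xs k) := by
  induction h with
  | falsum => exact ⟨∅, Set.countable_empty, fun {N} _ _ _ G _ v xs => G.realize_isQF .falsum v xs⟩
  | atomic h => exact ⟨∅, Set.countable_empty, fun {N} _ _ _ G _ v xs => G.realize_atomic h v xs⟩
  | imp _ _ ih₁ ih₂ =>
    obtain ⟨C₁, hC₁, h₁⟩ := ih₁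
    obtain ⟨C₂, hC₂, h₂⟩ := ih₂
    refine ⟨C₁ ∪ C₂, hC₁.union hC₂, fun {N} _ _ _ G hG v xs => ?_⟩
    rw [BoundedFormula.realize_imp, h₁ G (fun ρ h => hG ρ (.inl h)),
      h₂ G (fun ρ h => hG ρ (.inr h)), ← Ultrafilter.eventually_imp]
    rfl
  | @all l t φ hφ ih =>
    obtain ⟨C, hC, h⟩ := ih
    obtain ⟨p, hp⟩ := hφ.exists_qc
    obtain ⟨ρ, hρ⟩ := exists_req_search (κ := κ) hc S g t
      (F := fun A v xs => ¬ fval A φ v xs) fun v xs => (hp v xs).map Not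
    refine ⟨insert ρ C, hC.insert ρ, fun {N} _ _ _ G hG v xs => ?_⟩
    rw [realize_allLt]
    constructor
    · intro hall
      by_contra hno
      rw [← Ultrafilter.eventually_not] at hno
      obtain ⟨x, hx, hx'⟩ := hρ G (hG ρ (.inl rfl)) v xs (by
        filter_upwards [hno] with k hk
        rw [fval_allLt] at hk
        push Not at hk
        exact hk)
      have := (h G (fun ρ h => hG ρ (.inr h)) v _).1 (hall x hx)
      obtain ⟨k, h1, h2⟩ := (this.and hx').exists
      rw [G.reps_snoc] at h1
      exact h2 h1
    · intro hall x hx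
      rw [h G (fun ρ h => hG ρ (.inr h))]
      filter_upwards [hall, G.lt_iff.1 hx, G.rep_pvTerm (κ.len.apply₁ t) (Sum.elim v xs)]
        with k h1 h2 h3
      rw [fval_allLt] at h1
      rw [G.reps_snoc]
      refine h1 _ ?_
      rw [← G.reps_elim, ← h3]
      exact h2
  | @ex l t φ hφ ih =>
    obtain ⟨C, hC, h⟩ := ih
    obtain ⟨p, hp⟩ := hφ.exists_qc
    obtain ⟨ρ, hρ⟩ := exists_req_search (κ := κ) hc S g t (F := fun A v xs => fval A φ v xs) hp
    refine ⟨insert ρ C, hC.insert ρ, fun {N} _ _ _ G hG v xs => ?_⟩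
    rw [realize_exLt]
    constructor
    · rintro ⟨x, hx, hφx⟩
      rw [h G (fun ρ h => hG ρ (.inr h))] at hφx
      filter_upwards [hφx, G.lt_iff.1 hx, G.rep_pvTerm (κ.len.apply₁ t) (Sum.elim v xs)]
        with k h1 h2 h3
      rw [fval_exLt]
      rw [G.reps_snoc] at h1
      refine ⟨_, ?_, h1⟩
      rw [← G.reps_elim, ← h3]
      exact h2
    · intro hex
      obtain ⟨x, hx, hx'⟩ := hρ G (hG ρ (.inl rfl)) v xs (by
        filter_upwards [hex] with k hk
        rwa [fval_exLt] at hk)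
      refine ⟨x, hx, (h G (fun ρ h => hG ρ (.inr h)) v _).2 ?_⟩
      filter_upwards [hx'] with k hk
      rwa [G.reps_snoc]

/-- A verification predicate on conditions, which is monotone and has small support. -/
structure IsVerification {b l : ℕ} (V : ℕ → Finset (AtomFact L) → (Fin b → ℕ) → (Fin l → ℕ) → Prop)
    (D : Polynomial ℕ) : Prop where
  mono : ∀ {n p q v xs}, V n p v xs → p ⊆ q → V n q v xs
  support : ∀ {n p v xs}, V n p v xs → ∃ p' ⊆ p, p'.card ≤ D.eval (sz v + sz xs) ∧ V n p' v xs

/-- Truth in the generic models that meet the requirements is equivalent to verification by some of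
the conditions. -/
def TruthLemma {b l : ℕ} (code : L.Symbols → ℕ) (S : L.Structure B) (g : ℕ → ℕ)
    (φ : PVα.BoundedFormula (Fin b) l)
    (V : ℕ → Finset (AtomFact L) → (Fin b → ℕ) → (Fin l → ℕ) → Prop) (C : Set (Req S g)) : Prop :=
  ∀ {N : Type} [PV.Structure N] [PVα.Structure N] [PV.incl.IsExpansionOn N]
      (G : GenericModel code S N), (∀ ρ ∈ C, G.Meets ρ) → ∀ (v : Fin b → N) (xs : Fin l → N),
    φ.Realize v xs ↔ ∃ i, ∀ᶠ k in (G.U : Filter ℕ), V (G.n k) (G.P i k) (G.reps v k) (G.reps xs k)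

/-- Witnesses found coordinate by coordinate need not be represented in `N`. The minimum requirement
produces one that is: its other alternative, that no good extension verifies anything, is refuted by
a later condition of the chain. -/
theorem IsVerification.ex {b l : ℕ} {φ : PVα.BoundedFormula (Fin b) (l + 1)}
    {V : ℕ → Finset (AtomFact L) → (Fin b → ℕ) → (Fin (l + 1) → ℕ) → Prop}
    {D : Polynomial ℕ} (hV : IsVerification V D) {C : Set (Req S g)} (hC : C.Countable)
    (h : TruthLemma code S g φ V C) (t : PV.Term (Fin b ⊕ Fin l)) :
    ∃ (V' : _) (D' : _) (C' : Set (Req S g)), C'.Countable ∧ IsVerification V' D' ∧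
      TruthLemma code S g (exLt t φ) V' C' := by
  obtain ⟨q, hq⟩ := PVTerm.exists_bound t
  have hD : ∀ (v : Fin b → ℕ) (xs : Fin l → ℕ) x, x < t.realize (Sum.elim v xs) →
      D.eval (sz v + sz (Fin.snoc xs x : Fin (l + 1) → ℕ)) ≤
        (D.comp (Polynomial.X + q)).eval (sz v + sz xs) := fun v xs x hx => by
    rw [Polynomial.eval_comp, Polynomial.eval_add, Polynomial.eval_X, sz_snoc]
    refine D.eval_mono_nat ?_
    have := (Nat.size_le_size hx.le).trans (hq _)
    rw [sz_elim] at this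
    omega
  have hsz : ∀ w : Fin b ⊕ Fin l → ℕ, sz (w ∘ Sum.inl) + sz (w ∘ Sum.inr) = sz w := fun w => by
    rw [← sz_elim, Sum.elim_comp_inl_inr]
  let ρ : Req S g := .min S g b l
    (fun n p w y => V n p (w ∘ Sum.inl) (Fin.snoc (w ∘ Sum.inr) y)) (fun w => t.realize w)
    (D.comp (Polynomial.X + q)) (fun n p q v y h1 h2 => hV.mono h1 h2) (fun n p w y hy h1 => by
      obtain ⟨p', hp', hc, h2⟩ := hV.support h1
      refine ⟨p', hp', hc.trans ?_, h2⟩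
      rw [← hsz w]
      exact hD _ _ _ (by rwa [Sum.elim_comp_inl_inr]))
  refine ⟨fun n p v xs => ∃ x < t.realize (Sum.elim v xs), V n p v (Fin.snoc xs x),
    D.comp (Polynomial.X + q), insert ρ C, hC.insert ρ, ⟨?_, ?_⟩, fun {N} _ _ _ G hG v xs => ?_⟩
  · rintro n p q v xs ⟨x, hx, h⟩ hpq
    exact ⟨x, hx, hV.mono h hpq⟩
  · rintro n p v xs ⟨x, hx, h⟩
    obtain ⟨p', hp', hc, h2⟩ := hV.support h
    exact ⟨p', hp', hc.trans (hD _ _ _ hx), x, hx, h2⟩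
  have h := h G fun ρ hρ => hG ρ (.inr hρ)
  rw [realize_exLt]
  constructor
  · rintro ⟨x, hx, hφx⟩
    obtain ⟨i, hi⟩ := (h v _).1 hφx
    refine ⟨i, ?_⟩
    filter_upwards [hi, G.lt_iff.1 hx, G.rep_pvTerm t (Sum.elim v xs)] with k h1 h2 h3
    rw [G.reps_snoc] at h1
    refine ⟨_, ?_, h1⟩
    rwa [← G.reps_elim, ← h3]
  · rintro ⟨i, hi⟩
    obtain ⟨j, s, hP, ha⟩ := hG ρ (.inl rfl) (Sum.elim v xs)
    have hs : ∀ᶠ k in (G.U : Filter ℕ), s k 0 < t.realize (Sum.elim (G.reps v k) (G.reps xs k)) ∧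
        V (G.n k) (G.P (j + 1) k) (G.reps v k) (Fin.snoc (G.reps xs k) (s k 0)) := by
      filter_upwards [hP, hi, G.good (max i j)] with k h1 h2 h3
      replace h1 := (congrArg (fun w => ρ.Post (G.n k) (G.P j k) w (G.P (j + 1) k) (s k))
        (G.reps_elim v xs k)).mp h1
      rcases h1 with h1 | h1
      · exact ⟨h1.1, h1.2.1⟩
      · obtain ⟨x, hx, h2⟩ := h2
        exact absurd (hV.mono h2 (G.P_mono k (le_max_left i j)))
          (h1 x hx _ (G.P_mono k (le_max_right i j)) h3)
    obtain ⟨x, hx⟩ := ha 0 (((G.small_reps (Sum.elim v xs)).eval G.le_n q).mono (by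
      filter_upwards [hs] with k hk
      rw [G.reps_elim]
      exact (Nat.size_le_size hk.1.le).trans (hq _)))
    refine ⟨x, G.lt_iff.2 ?_, (h v _).2 ⟨j + 1, ?_⟩⟩
    · filter_upwards [hs, hx, G.rep_pvTerm t (Sum.elim v xs)] with k h1 h2 h3
      rw [h2, h3, G.reps_elim]
      exact h1.1
    · filter_upwards [hs, hx] with k h1 h2
      rw [G.reps_snoc, h2]
      exact h1.2

/-- Truth at every `x` gives verification at stages depending on `x`; a single stage is needed. If
the maximal verified initial segment stopped below the bound, its end would be an element of `N`,
true there and hence verified at some stage, contrary to maximality. -/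
theorem IsVerification.allSharp {b l : ℕ} {φ : PVα.BoundedFormula (Fin b) (l + 1)}
    {V : ℕ → Finset (AtomFact L) → (Fin b → ℕ) → (Fin (l + 1) → ℕ) → Prop}
    {D : Polynomial ℕ} (hV : IsVerification V D) {C : Set (Req S g)} (hC : C.Countable)
    (h : TruthLemma code S g φ V C) (t : PV.Term (Fin b ⊕ Fin l)) :
    ∃ (V' : _) (D' : _) (C' : Set (Req S g)), C'.Countable ∧ IsVerification V' D' ∧
      TruthLemma code S g (allLt (κ.len.apply₁ t) φ) V' C' := by
  classical
  obtain ⟨q, hq⟩ := PVTerm.exists_bound t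
  let T : (Fin b ⊕ Fin l → ℕ) → ℕ := fun w => (κ.len.apply₁ t).realize w
  have hT : ∀ w, T w ≤ q.eval (sz w) := fun w => by
    simp only [T, realize_len]
    exact hq w
  have hD : ∀ (v : Fin b → ℕ) (xs : Fin l → ℕ) x, x < T (Sum.elim v xs) →
      D.eval (sz v + sz (Fin.snoc xs x : Fin (l + 1) → ℕ)) ≤
        (D.comp (Polynomial.X + q)).eval (sz v + sz xs) := fun v xs x hx => by
    rw [Polynomial.eval_comp, Polynomial.eval_add, Polynomial.eval_X, sz_snoc]
    refine D.eval_mono_nat ?_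
    have := hT (Sum.elim v xs)
    rw [sz_elim] at this
    have := Nat.size_le_self x
    omega
  have hsz : ∀ w : Fin b ⊕ Fin l → ℕ, sz (w ∘ Sum.inl) + sz (w ∘ Sum.inr) = sz w := fun w => by
    rw [← sz_elim, Sum.elim_comp_inl_inr]
  let ρ : Req S g := .all S g b l
    (fun n p w y => V n p (w ∘ Sum.inl) (Fin.snoc (w ∘ Sum.inr) y)) T
    (D.comp (Polynomial.X + q)) q hT (fun n p q v y h1 h2 => hV.mono h1 h2)
    (fun n p w y hy h1 => by
      obtain ⟨p', hp', hc, h2⟩ := hV.support h1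
      refine ⟨p', hp', hc.trans ?_, h2⟩
      rw [← hsz w]
      exact hD _ _ _ (by rwa [Sum.elim_comp_inl_inr]))
  refine ⟨fun n p v xs => ∀ x < T (Sum.elim v xs), V n p v (Fin.snoc xs x),
    q * D.comp (Polynomial.X + q), insert ρ C, hC.insert ρ, ⟨?_, ?_⟩, fun {N} _ _ _ G hG v xs => ?_⟩
  · exact fun h hpq x hx => hV.mono (h x hx) hpq
  · intro n p v xs h
    choose! p' hp' hc h2 using fun x hx => hV.support (h x hx)
    refine ⟨(Finset.range (T (Sum.elim v xs))).biUnion p', ?_, ?_, ?_⟩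
    · exact Finset.biUnion_subset.2 fun x hx => hp' x (Finset.mem_range.1 hx)
    · rw [Polynomial.eval_mul]
      refine (Finset.card_biUnion_le_card_mul _ _ _ fun x hx =>
        (hc x (Finset.mem_range.1 hx)).trans (hD _ _ _ (Finset.mem_range.1 hx))).trans ?_
      rw [Finset.card_range, ← sz_elim]
      exact Nat.mul_le_mul_right _ (hT _)
    · exact fun x hx => hV.mono (h2 x hx)
        (Finset.subset_biUnion_of_mem p' (Finset.mem_range.2 hx))
  have h := h G fun ρ hρ => hG ρ (.inr hρ)
  rw [realize_allLt]
  constructor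
  · intro hall
    obtain ⟨j, s, hP, ha⟩ := hG ρ (.inl rfl) (Sum.elim v xs)
    refine ⟨j + 1, ?_⟩
    by_contra hno
    rw [← Ultrafilter.eventually_not] at hno
    have hs : ∀ᶠ k in (G.U : Filter ℕ), s k 0 < T (Sum.elim (G.reps v k) (G.reps xs k)) ∧
        ∀ r, G.P (j + 1) k ⊆ r → Good S (G.n k) r →
          ¬ V (G.n k) r (G.reps v k) (Fin.snoc (G.reps xs k) (s k 0)) := by
      filter_upwards [hP, hno] with k h1 h2
      replace h1 := (congrArg (fun w => ρ.Post (G.n k) (G.P j k) w (G.P (j + 1) k) (s k))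
        (G.reps_elim v xs k)).mp h1
      obtain ⟨h3, h4, h5⟩ := h1
      rcases h3.lt_or_eq with h3 | h3
      · exact ⟨h3, h5 h3⟩
      · rw [h3] at h4
        exact absurd h4 h2
    obtain ⟨x, hx⟩ := ha 0 (((G.small_reps (Sum.elim v xs)).eval G.le_n q).mono (by
      filter_upwards [hs] with k hk
      rw [G.reps_elim]
      exact (Nat.size_le_self _).trans (hk.1.le.trans (hT _))))
    have hxT : ltN x ((κ.len.apply₁ t).realize (Sum.elim v xs)) := by
      rw [G.lt_iff]
      filter_upwards [hs, hx, G.rep_pvTerm (κ.len.apply₁ t) (Sum.elim v xs)] with k h1 h2 h3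
      rw [h2, h3, G.reps_elim]
      exact h1.1
    obtain ⟨i, hi⟩ := (h v _).1 (hall x hxT)
    obtain ⟨k, h1, h2, h3, h4⟩ := (hs.and (hi.and (hx.and (G.good (max i (j + 1)))))).exists
    rw [G.reps_snoc, h3] at h2
    exact h1.2 _ (G.P_mono k (le_max_right i (j + 1))) h4
      (hV.mono h2 (G.P_mono k (le_max_left i (j + 1))))
  · rintro ⟨i, hi⟩ x hx
    refine (h v _).2 ⟨i, ?_⟩
    filter_upwards [hi, G.lt_iff.1 hx, G.rep_pvTerm (κ.len.apply₁ t) (Sum.elim v xs)]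
      with k h1 h2 h3
    rw [G.reps_snoc]
    refine h1 _ ?_
    rw [h3, G.reps_elim] at h2
    exact h2

/-- At the base, a decided formula is verified by the facts that decide it. Conjunction passes to a
common later stage, and disjunction uses that `U` is an ultrafilter. -/
theorem IsSigmaB1.exists_truthLemma [Fintype L.Symbols] (hc : Function.Injective code) (S : L.Structure B)
    (g : ℕ → ℕ) {b l : ℕ} {φ : PVα.BoundedFormula (Fin b) l} (h : IsSigmaB1 κ φ) :
    ∃ (V : _) (D : _) (C : Set (Req S g)), C.Countable ∧ IsVerification V D ∧
      TruthLemma code S g φ V C := by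
  classical
  induction h with
  | @of l φ h =>
    obtain ⟨p, hp⟩ := h.exists_qc
    obtain ⟨C, hC, hφ⟩ := h.exists_realize_iff hc S g
    have hF : ∀ w : Fin b ⊕ Fin l → ℕ, QC (p.eval (sz w))
        (fun A => if fval A φ (w ∘ Sum.inl) (w ∘ Sum.inr) then 1 else 0) := fun w => by
      have := (hp (w ∘ Sum.inl) (w ∘ Sum.inr)).map fun c : Prop => if c then 1 else 0
      rwa [← sz_elim, Sum.elim_comp_inl_inr] at this
    let ρ : Req S g := .decide S g code b l _ p hF
    refine ⟨fun n q v xs => ∃ q' ⊆ q, q'.card ≤ p.eval (sz v + sz xs) ∧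
      Forces code n q' (fun A => fval A φ v xs) True, p, insert ρ C, hC.insert ρ, ⟨?_, ?_⟩,
      fun {N} _ _ _ G hG v xs => ?_⟩
    · rintro n q r v xs ⟨q', h1, h2, h3⟩ h4
      exact ⟨q', h1.trans h4, h2, h3⟩
    · rintro n q v xs ⟨q', h1, h2, h3⟩
      exact ⟨q', h1, h2, q', subset_rfl, h2, h3⟩
    rw [hφ G fun ρ hρ => hG ρ (.inr hρ)]
    constructor
    · intro ht
      obtain ⟨i, s, hP, -⟩ := hG ρ (.inl rfl) (Sum.elim v xs)
      refine ⟨i + 1, ?_⟩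
      filter_upwards [ht, hP, G.compat hc (i + 1)] with k h1 h2 h3
      replace h2 := (congrArg (fun w => ρ.Post (G.n k) (G.P i k) w (G.P (i + 1) k) (s k))
        (G.reps_elim v xs k)).mp h2
      obtain ⟨q', hq', hcard, h4⟩ := h2
      rw [sz_elim] at hcard
      -- The oracle of this coordinate is compatible with `q'` and satisfies the formula, so the
      -- forced value is `1` for every compatible oracle.
      refine ⟨q', hq', hcard, fun A hA => eq_true (by_contra fun hne => ?_)⟩
      have h5 := (h4 _ (h3.mono hq')).symm.trans (if_pos h1)
      exact absurd ((if_neg hne).symm.trans ((h4 A hA).trans h5)) (by norm_num)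
    · rintro ⟨i, hi⟩
      filter_upwards [hi, G.compat hc i] with k h1 h2
      obtain ⟨q', hq', -, h3⟩ := h1
      exact of_eq_true (h3 _ (h2.mono hq'))
  | inf _ _ ih₁ ih₂ =>
    obtain ⟨V₁, D₁, C₁, hC₁, hV₁, h₁⟩ := ih₁
    obtain ⟨V₂, D₂, C₂, hC₂, hV₂, h₂⟩ := ih₂
    refine ⟨fun n q v xs => V₁ n q v xs ∧ V₂ n q v xs, D₁ + D₂, C₁ ∪ C₂, hC₁.union hC₂,
      ⟨fun h hq => ⟨hV₁.mono h.1 hq, hV₂.mono h.2 hq⟩, ?_⟩, fun {N} _ _ _ G hG v xs => ?_⟩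
    · rintro n p v xs ⟨h1, h2⟩
      obtain ⟨p₁, hp₁, hc₁, hW₁⟩ := hV₁.support h1
      obtain ⟨p₂, hp₂, hc₂, hW₂⟩ := hV₂.support h2
      refine ⟨p₁ ∪ p₂, Finset.union_subset hp₁ hp₂, ?_, hV₁.mono hW₁ Finset.subset_union_left,
        hV₂.mono hW₂ Finset.subset_union_right⟩
      rw [Polynomial.eval_add]
      exact (Finset.card_union_le _ _).trans (Nat.add_le_add hc₁ hc₂)
    · rw [BoundedFormula.realize_inf, h₁ G fun ρ h => hG ρ (.inl h),
        h₂ G fun ρ h => hG ρ (.inr h)]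
      constructor
      · rintro ⟨⟨i, hi⟩, j, hj⟩
        refine ⟨max i j, ?_⟩
        filter_upwards [hi, hj] with k h1 h2
        exact ⟨hV₁.mono h1 (G.P_mono k (le_max_left i j)),
          hV₂.mono h2 (G.P_mono k (le_max_right i j))⟩
      · rintro ⟨i, hi⟩
        exact ⟨⟨i, hi.mono fun k h => h.1⟩, i, hi.mono fun k h => h.2⟩
  | sup _ _ ih₁ ih₂ =>
    obtain ⟨V₁, D₁, C₁, hC₁, hV₁, h₁⟩ := ih₁
    obtain ⟨V₂, D₂, C₂, hC₂, hV₂, h₂⟩ := ih₂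
    refine ⟨fun n q v xs => V₁ n q v xs ∨ V₂ n q v xs, D₁ + D₂, C₁ ∪ C₂, hC₁.union hC₂,
      ⟨fun h hq => h.imp (hV₁.mono · hq) (hV₂.mono · hq), ?_⟩, fun {N} _ _ _ G hG v xs => ?_⟩
    · rintro n p v xs (h | h)
      · obtain ⟨p', hp', hc, hW⟩ := hV₁.support h
        exact ⟨p', hp', hc.trans (by simp), .inl hW⟩
      · obtain ⟨p', hp', hc, hW⟩ := hV₂.support h
        exact ⟨p', hp', hc.trans (by simp), .inr hW⟩
    · rw [BoundedFormula.realize_sup, h₁ G fun ρ h => hG ρ (.inl h),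
        h₂ G fun ρ h => hG ρ (.inr h)]
      constructor
      · rintro (⟨i, hi⟩ | ⟨i, hi⟩)
        · exact ⟨i, hi.mono fun k h => .inl h⟩
        · exact ⟨i, hi.mono fun k h => .inr h⟩
      · rintro ⟨i, hi⟩
        rcases Ultrafilter.eventually_or.1 hi with h | h
        exacts [.inl ⟨i, h⟩, .inr ⟨i, h⟩]
  | allSharp t _ ih =>
    obtain ⟨V, D, C, hC, hV, h⟩ := ih
    exact hV.allSharp hC h t
  | exSharp t _ ih =>
    obtain ⟨V, D, C, hC, hV, h⟩ := ih
    exact hV.ex hC h _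
  | ex t _ ih =>
    obtain ⟨V, D, C, hC, hV, h⟩ := ih
    exact hV.ex hC h t

end Truth

/-! ## Countability -/

instance : Countable Turing.Dir :=
  (show Function.Injective (fun d : Turing.Dir => match d with | .left => true | .right => false) by
    intro a b h
    cases a <;> cases b <;> simp_all).countable

instance (r : ℕ) : Countable (OracleTM r) := by
  have h (w s : ℕ) : Countable (Fin s × Fin s × Fin s × Fin s × Fin s × (Fin s →
      (Fin r ⊕ Fin (w + 2) → Option Bool) →
        Fin s × (Fin r ⊕ Fin (w + 2) → Option Bool × Option Turing.Dir))) := by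
    have : Countable (Option Bool × Option Turing.Dir) := inferInstance
    infer_instance
  exact (show Function.Surjective (fun x : Σ w s : ℕ, Fin s × Fin s × Fin s × Fin s × Fin s ×
      (Fin s → (Fin r ⊕ Fin (w + 2) → Option Bool) →
        Fin s × (Fin r ⊕ Fin (w + 2) → Option Bool × Option Turing.Dir)) =>
      OracleTM.mk x.1 x.2.1 x.2.2.1 x.2.2.2.1 x.2.2.2.2.1 x.2.2.2.2.2.1 x.2.2.2.2.2.2.1
        x.2.2.2.2.2.2.2) from fun m =>
    ⟨⟨m.work, m.states, m.start, m.halt, m.query, m.yes, m.no, m.next⟩, rfl⟩).countable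

instance (r : ℕ) : Countable (PV.Functions r) :=
  inferInstanceAs (Countable {m : OracleTM r // m.PolyTime ∧ m.QueryFree})

instance (r : ℕ) : Countable (PVα.Functions r) :=
  inferInstanceAs (Countable {m : OracleTM r // m.PolyTime})

instance (r : ℕ) : Countable (PV.Relations r) :=
  (show Function.Injective (fun _ : PVRel r => ()) by
    intro a b _
    cases a; cases b; rfl).countable

instance (r : ℕ) : Countable (PVα.Relations r) :=
  (show Function.Injective (fun R : PVαRel r => match R with | .lt => true | .alpha => false) by
    intro a b h
    cases a <;> cases b <;> simp_all).countable

/-- Formulas index the minimum axioms and the Skolem functions of the hull; both families have to be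
countable. -/
instance FirstOrder.Language.countable_formulas (K : FirstOrder.Language.{0, 0})
    [∀ r, Countable (K.Functions r)] [∀ r, Countable (K.Relations r)] (α : Type) [Countable α]
    (n : ℕ) : Countable (K.BoundedFormula α n) := by
  have : Countable (Σ n, K.BoundedFormula α n) := by
    rw [← Cardinal.mk_le_aleph0_iff]
    refine BoundedFormula.card_le.trans ?_
    have : Countable K.Symbols := by unfold Language.Symbols; infer_instance
    have h : Cardinal.mk K.Symbols ≤ Cardinal.aleph0 := Cardinal.mk_le_aleph0
    have hα : Cardinal.mk α ≤ Cardinal.aleph0 := Cardinal.mk_le_aleph0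
    simpa [Language.card, hα] using h
  exact (sigma_mk_injective (i := n)).countable

/-! ## Minimum axioms in generic models -/

section

variable {N : Type} [PVα.Structure N]

theorem realize_plug {k m : ℕ} (φ : PVα.Formula (Fin (k + 1))) (hk : k ≤ m) (j : Fin m)
    (v : Empty → N) (xs : Fin m → N) : (plug φ hk j).Realize v xs ↔
      φ.Realize (Fin.snoc (fun i => xs (Fin.castLE hk i)) (xs j) : Fin (k + 1) → N) := by
  rw [plug, BoundedFormula.realize_relabel, Formula.Realize]
  refine iff_of_eq ?_
  congr 1
  · funext i
    refine Fin.lastCases ?_ (fun i => ?_) i <;> simp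
  · exact Subsingleton.elim _ _

theorem realize_minAxiom [PV.Structure N] [PV.incl.IsExpansionOn N] {k : ℕ} (φ : PVα.Formula (Fin (k + 1))) : N ⊨ minAxiom φ ↔
    ∀ (xs : Fin k → N) (x : N), φ.Realize (Fin.snoc xs x : Fin (k + 1) → N) →
      ∃ y, (ltN y x ∨ y = x) ∧ φ.Realize (Fin.snoc xs y : Fin (k + 1) → N) ∧
        ∀ z, ltN z y → ¬ φ.Realize (Fin.snoc xs z : Fin (k + 1) → N) := by
  have e2 (xs : Fin (k + 1) → N) (y : N) : (fun i : Fin k =>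
      (Fin.snoc xs y : Fin (k + 2) → N) (Fin.castLE (by omega) i)) = Fin.init xs := by
    funext i
    exact Fin.snoc_castSucc (α := fun _ => N) _ _ i.castSucc
  have e3 (xs : Fin (k + 1) → N) (y z : N) : (fun i : Fin k =>
      (Fin.snoc (Fin.snoc xs y : Fin (k + 2) → N) z : Fin (k + 3) → N)
        (Fin.castLE (by omega) i)) = Fin.init xs := by
    rw [← e2 xs y]
    funext i
    exact Fin.snoc_castSucc (α := fun _ => N) _ _ i.castSucc.castSucc
  have x2 (xs : Fin (k + 1) → N) (y : N) : (Fin.snoc xs y : Fin (k + 2) → N) ⟨k, by omega⟩ =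
      xs (Fin.last k) := Fin.snoc_castSucc (α := fun _ => N) _ _ (Fin.last k)
  have y2 (xs : Fin (k + 1) → N) (y : N) : (Fin.snoc xs y : Fin (k + 2) → N) ⟨k + 1, by omega⟩ =
      y := Fin.snoc_last (α := fun _ => N) _ _
  have y3 (xs : Fin (k + 1) → N) (y z : N) : (Fin.snoc (Fin.snoc xs y : Fin (k + 2) → N) z :
      Fin (k + 3) → N) ⟨k + 1, by omega⟩ = y :=
    (Fin.snoc_castSucc (α := fun _ => N) _ _ (Fin.last (k + 1))).trans
      (Fin.snoc_last (α := fun _ => N) _ _)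
  have z3 (xs : Fin (k + 2) → N) (z : N) : (Fin.snoc xs z : Fin (k + 3) → N) ⟨k + 2, by omega⟩ =
      z := Fin.snoc_last (α := fun _ => N) _ _
  have e1 (xs : Fin (k + 1) → N) : (fun i : Fin k => xs (Fin.castLE (by omega) i)) = Fin.init xs :=
    rfl
  rw [Sentence.Realize, minAxiom, BoundedFormula.realize_alls]
  simp only [BoundedFormula.realize_imp, BoundedFormula.realize_ex, BoundedFormula.realize_all,
    BoundedFormula.realize_inf, BoundedFormula.realize_sup, BoundedFormula.realize_bdEqual,
    BoundedFormula.realize_not, realize_ltF, realize_plug, Function.comp_apply, Term.realize_var,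
    Sum.elim_inr,
    e1, e2, e3, x2, y2, y3, z3]
  refine ⟨fun h xs x => ?_, fun h xs => h (Fin.init xs) (xs (Fin.last k))⟩
  simpa only [Fin.init_snoc, Fin.snoc_last] using h (Fin.snoc xs x)

end

section

open Filter

variable {L : FirstOrder.Language.{0, 0}} {code : L.Symbols → ℕ} {B : Type}
  {S : L.Structure B} {g : ℕ → ℕ} {κ : BasicSymbols}

/-- The least number verifiable by a good extension becomes the minimum. A smaller number true in
`N` would be verified by a good condition of the chain, which the requirement excludes. -/
theorem TruthLemma.exists_meets_minAxiom {k : ℕ} {φ : PVα.Formula (Fin (k + 1))} {V D}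
    {C : Set (Req S g)} (hV : IsVerification V D) (h : TruthLemma code S g φ V C) :
    ∃ ρ : Req S g, ∀ {N : Type} [PV.Structure N] [PVα.Structure N] [PV.incl.IsExpansionOn N]
      (G : GenericModel code S N), (∀ ρ ∈ C, G.Meets ρ) → G.Meets ρ →
      N ⊨ minAxiom φ := by
  let T : (Fin (k + 1) ⊕ Fin 0 → ℕ) → Fin (k + 1) → ℕ := fun w => w ∘ Sum.inl
  let W : ℕ → Finset (AtomFact L) → (Fin (k + 1) ⊕ Fin 0 → ℕ) → ℕ → Prop := fun n p w y =>
    V n p (Fin.snoc (Fin.init (T w)) y : Fin (k + 1) → ℕ) default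
  -- The bound is one more than the last component `x`, because `x` itself may be the minimum.
  let ρ : Req S g := .min S g (k + 1) 0 W (fun w => T w (Fin.last k) + 1) D
    (fun n p q v y h1 h2 => hV.mono h1 h2) (fun n p w y hy h1 => by
      obtain ⟨p', hp', hc, h2⟩ := hV.support h1
      refine ⟨p', hp', hc.trans (D.eval_mono_nat ?_), h2⟩
      have e1 : sz w = sz (T w) := by simp [sz, T, Fintype.sum_sum_type]
      have e2 := sz_snoc (Fin.init (T w)) (T w (Fin.last k))
      rw [Fin.snoc_init_self] at e2
      rw [e1, e2, sz_snoc]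
      have := Nat.size_le_size (Nat.lt_succ_iff.1 hy)
      simpa [sz] using this)
  refine ⟨ρ, fun {N} _ _ _ G hC hG => (realize_minAxiom φ).2 fun xs x hx => ?_⟩
  have h := fun v => h G hC v default
  obtain ⟨i, hi⟩ := (h _).1 hx
  obtain ⟨j, s, hP, ha⟩ := hG (Sum.elim (Fin.snoc xs x) Fin.elim0)
  have hT : ∀ k, T (G.reps (Sum.elim (Fin.snoc xs x) Fin.elim0) k) =
    Fin.snoc (G.reps xs k) (G.rep x k) := fun k => G.reps_snoc xs x k
  have hW : ∀ n p k y, W n p (G.reps (Sum.elim (Fin.snoc xs x) Fin.elim0) k) y ↔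
      V n p (Fin.snoc (G.reps xs k) y : Fin (_ + 1) → ℕ) default := fun n p k y => by
    simp only [W]
    rw [hT, Fin.init_snoc]
  have hs : ∀ᶠ k in (G.U : Filter ℕ), s k 0 ≤ G.rep x k ∧
      V (G.n k) (G.P (j + 1) k) (Fin.snoc (G.reps xs k) (s k 0) : Fin (_ + 1) → ℕ) default ∧
      ∀ z < s k 0, ∀ r, G.P j k ⊆ r → Good S (G.n k) r →
        ¬ V (G.n k) r (Fin.snoc (G.reps xs k) z : Fin (_ + 1) → ℕ) default := by
    filter_upwards [hP, hi, G.good (max i j)] with k h1 h2 h3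
    have hl : T (G.reps (Sum.elim (Fin.snoc xs x) Fin.elim0) k) (Fin.last _) = G.rep x k := by
      rw [hT, Fin.snoc_last]
    rcases h1 with ⟨h4, h5, h6⟩ | h1
    · refine ⟨?_, (hW _ _ _ _).1 h5, fun z hz r h7 h8 h9 => h6 z hz r h7 h8 ((hW _ _ _ _).2 h9)⟩
      have h4 : s k 0 < T (G.reps (Sum.elim (Fin.snoc xs x) Fin.elim0) k) (Fin.last _) + 1 := h4
      omega
    · refine absurd ((hW _ _ _ (G.rep x k)).2 ?_) (h1 (G.rep x k) (Nat.lt_succ_iff.2 hl.ge) _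
        (G.P_mono k (le_max_right i j)) h3)
      rw [G.reps_snoc] at h2
      have h2 := hV.mono h2 (G.P_mono k (le_max_left i j))
      convert h2
  obtain ⟨y, hy⟩ := ha 0 ((G.small x).mono (by
    filter_upwards [hs] with k hk using Nat.size_le_size hk.1))
  refine ⟨y, ?_, (h _).2 ⟨j + 1, ?_⟩, fun z hz hφz => ?_⟩
  · have : ∀ᶠ k in (G.U : Filter ℕ), G.rep y k < G.rep x k ∨ G.rep y k = G.rep x k := by
      filter_upwards [hs, hy] with k h1 h2
      rw [h2]
      exact h1.1.lt_or_eq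
    rcases Ultrafilter.eventually_or.1 this with h | h
    exacts [.inl (G.lt_iff.2 h), .inr (G.eq_of_rep h)]
  · filter_upwards [hs, hy] with k h1 h2
    rw [G.reps_snoc, h2]
    convert h1.2.1
  · obtain ⟨i', hi'⟩ := (h _).1 hφz
    obtain ⟨k, h1, h2, h3, h4, h5⟩ :=
      (hs.and (hi'.and (hy.and ((G.lt_iff.1 hz).and (G.good (max i' j)))))).exists
    rw [G.reps_snoc] at h2
    rw [h3] at h4
    have h2 := hV.mono h2 (G.P_mono k (le_max_left i' j))
    refine h1.2.2 _ h4 _ (G.P_mono k (le_max_right i' j)) h5 ?_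
    convert h2

theorem exists_models_forallT12 [Fintype L.Symbols] (hc : Function.Injective code)
    (κ : BasicSymbols) (S : L.Structure B) (g : ℕ → ℕ) :
    ∃ C : Set (Req S g), C.Countable ∧ ∀ {N : Type} [PV.Structure N] [PVα.Structure N] [PV.incl.IsExpansionOn N]
      (G : GenericModel code S N), (∀ ρ ∈ C, G.Meets ρ) →
      N ⊨ forallT12 κ := by
  have : ∀ φ : Σ k, {φ : PVα.Formula (Fin (k + 1)) // IsSigmaB1 κ φ}, ∃ C : Set (Req S g),
      C.Countable ∧ ∀ {N : Type} [PV.Structure N] [PVα.Structure N] [PV.incl.IsExpansionOn N]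
      (G : GenericModel code S N), (∀ ρ ∈ C, G.Meets ρ) →
        N ⊨ minAxiom φ.2.1 := by
    rintro ⟨k, φ, hφ⟩
    obtain ⟨V, D, C, hC, hV, h⟩ := hφ.exists_truthLemma hc S g
    obtain ⟨ρ, hρ⟩ := h.exists_meets_minAxiom hV
    exact ⟨insert ρ C, hC.insert ρ, fun {N} _ _ _ G hG => hρ G (fun ρ h => hG ρ (.inr h)) (hG ρ (.inl rfl))⟩
  choose C hC h using this
  refine ⟨⋃ φ, C φ, Set.countable_iUnion hC, fun {N} _ _ _ G hG => (Theory.model_iff _).2 ?_⟩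
  rintro σ (hσ | ⟨k, φ, hφ, rfl⟩)
  · exact (Theory.model_iff _).1 G.models_forallPVα σ hσ
  · exact h ⟨k, φ, hφ⟩ G fun ρ hρ => hG ρ (Set.mem_iUnion.2 ⟨_, hρ⟩)

end

section Hulls

open Filter

/-! ## Countable elementary submodels of ultrapowers of `ℕ` -/

/-- The closure consists of the values of well-founded terms, of which there are countably many
because all arities are finite. -/
theorem exists_countable_closed {ι : Type} [Countable ι] (α : ι → Type) [∀ i, Finite (α i)]
    (F : ∀ i, ℕ → (α i → ℕ) → ℕ) : ∃ X : Set (ℕ → ℕ), X.Countable ∧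
      ∀ i (x : α i → ℕ → ℕ), (∀ j, x j ∈ X) → (fun k => F i k fun j => x j k) ∈ X := by
  classical
  have := fun i => Fintype.ofFinite (α i)
  have := Encodable.ofCountable ι
  have := fun i => Encodable.ofCountable (α i)
  refine ⟨Set.range (WType.elim (ℕ → ℕ) fun s : Σ i, α i → ℕ → ℕ => fun k =>
    F s.1 k fun j => s.2 j k), Set.countable_range _, fun i x hx => ?_⟩
  choose t ht using hx
  exact ⟨⟨i, t⟩, by simp only [WType.elim, ht]⟩

/-- The ultrapower of `ℕ`. -/
abbrev UltraNat (U : Ultrafilter ℕ) : Type := (U : Filter ℕ).Product fun _ : ℕ => ℕ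

/-- The class of a sequence. -/
def UltraNat.mk (U : Ultrafilter ℕ) (x : ℕ → ℕ) : UltraNat U :=
  @Quotient.mk' _ ((U : Filter ℕ).productSetoid _) x

/-- A representative. -/
noncomputable def UltraNat.rep {U : Ultrafilter ℕ} (a : UltraNat U) : ℕ → ℕ :=
  @Quotient.out _ ((U : Filter ℕ).productSetoid _) a

namespace UltraNat

variable {U : Ultrafilter ℕ}

theorem mk_rep (a : UltraNat U) : mk U a.rep = a :=
  @Quotient.out_eq _ ((U : Filter ℕ).productSetoid _) a

theorem mk_eq {x y : ℕ → ℕ} : mk U x = mk U y ↔ ∀ᶠ k in (U : Filter ℕ), x k = y k :=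
  Quotient.eq''

theorem rep_mk (x : ℕ → ℕ) : ∀ᶠ k in (U : Filter ℕ), (mk U x).rep k = x k :=
  mk_eq.1 (mk_rep _)

theorem funMap_mk {r : ℕ} (f : PV.Functions r) (x : Fin r → ℕ → ℕ) :
    Structure.funMap f (fun i => mk U (x i)) = mk U fun k => f.1.eval ∅ fun i => x i k :=
  Ultraproduct.funMap_cast f x

theorem realize_mk {β : Type} (φ : PV.Formula β) (x : β → ℕ → ℕ) :
    (φ.Realize fun i => mk U (x i)) ↔ ∀ᶠ k in (U : Filter ℕ), φ.Realize fun i => x i k :=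
  Ultraproduct.realize_formula_cast φ x

theorem realize_iff {β : Type} (φ : PV.Formula β) (a : β → UltraNat U) :
    φ.Realize a ↔ ∀ᶠ k in (U : Filter ℕ), φ.Realize fun i => (a i).rep k := by
  rw [← realize_mk]
  simp only [mk_rep]

theorem boundedFormula_realize_mk {n : ℕ} (φ : PV.BoundedFormula Empty n) (x : Fin n → ℕ → ℕ)
    (v : Empty → UltraNat U) (w : Empty → ℕ) : φ.Realize v (fun i => mk U (x i)) ↔
      ∀ᶠ k in (U : Filter ℕ), φ.Realize w fun i => x i k := by
  obtain rfl : v = fun i => mk U i.elim := Subsingleton.elim _ _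
  have hw (k : ℕ) : w = fun i => (i.elim : ℕ → ℕ) k := Subsingleton.elim _ _
  have h : φ.Realize (fun i => mk U i.elim) (fun i => mk U (x i)) ↔
      ∀ᶠ k in (U : Filter ℕ), φ.Realize (fun i => (i.elim : ℕ → ℕ) k) fun i => x i k :=
    Ultraproduct.boundedFormula_realize_cast (u := U) φ (fun i => i.elim) x
  simpa only [← hw] using h

/-- Skolem functions of the standard model, applied coordinatewise, give the Tarski–Vaught property.
Countability allows the requirements with all their parameters to be listed in order type `ω`. -/
theorem exists_hull (U : Ultrafilter ℕ) {ι : Type} [Countable ι] (α : ι → Type)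
    [∀ i, Finite (α i)] (F : ∀ i, ℕ → (α i → ℕ) → ℕ) :
    ∃ M : PV.ElementarySubstructure (UltraNat U), Countable M ∧
      (∀ c : ℕ, mk U (fun _ => c) ∈ M) ∧ ∀ i (x : α i → ℕ → ℕ), (∀ j, mk U (x j) ∈ M) →
        mk U (fun k => F i k fun j => x j k) ∈ M := by
  classical
  let ι' : Type := ι ⊕ (Σ r, PV.Functions r) ⊕ (Σ n, PV.BoundedFormula Empty (n + 1)) ⊕ ℕ
  let α' : ι' → Type := Sum.elim α (Sum.elim (fun f => Fin f.1) (Sum.elim (fun φ => Fin φ.1)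
    fun _ => Empty))
  have hα' : ∀ i, Finite (α' i) := by
    rintro (i | i | i | i)
    · exact inferInstanceAs (Finite (α i))
    · exact inferInstanceAs (Finite (Fin i.1))
    · exact inferInstanceAs (Finite (Fin i.1))
    · exact inferInstanceAs (Finite Empty)
  let F' : ∀ i, ℕ → (α' i → ℕ) → ℕ := fun i => match i with
    | .inl i => F i
    | .inr (.inl f) => fun _ x => f.2.1.eval ∅ x
    | .inr (.inr (.inl φ)) => fun _ x =>
      if h : ∃ a : ℕ, φ.2.Realize default (Fin.snoc (α := fun _ => ℕ) x a) then h.choose else 0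
    | .inr (.inr (.inr c)) => fun _ _ => c
  obtain ⟨X, hX, hcl⟩ := exists_countable_closed α' F'
  -- The operations act coordinatewise and so respect equality almost everywhere; closure passes
  -- from sequences to their classes.
  have hcl' : ∀ i (x : α' i → ℕ → ℕ), (∀ j, mk U (x j) ∈ mk U '' X) →
      mk U (fun k => F' i k fun j => x j k) ∈ mk U '' X := by
    intro i x hx
    choose y hy hxy using hx
    refine ⟨_, hcl i y hy, mk_eq.2 ?_⟩
    filter_upwards [eventually_all.2 fun j => mk_eq.1 (hxy j)] with k hk
    simp only [hk]
  let N : PV.Substructure (UltraNat U) := {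
    carrier := mk U '' X
    fun_mem := fun {r} f a ha => by
      have h : mk U (fun k => f.1.eval ∅ fun j => (a j).rep k) ∈ mk U '' X :=
        hcl' (.inr (.inl ⟨r, f⟩)) (fun j => (a j).rep) fun j => by
          rw [mk_rep]
          exact ha j
      rw [← funMap_mk] at h
      simpa only [mk_rep] using h }
  refine ⟨N.toElementarySubstructure fun n φ x a ha => ?_, (hX.image _).to_subtype,
    fun c => hcl' (.inr (.inr (.inr c))) Empty.elim (fun j => j.elim), fun i => hcl' (.inl i)⟩
  refine ⟨⟨_, hcl' (.inr (.inr (.inl ⟨n, φ⟩))) (fun j => (x j).1.rep) fun j => ?_⟩, ?_⟩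
  · rw [mk_rep]
    exact (x j).2
  · have e (a : ℕ → ℕ) : (Fin.snoc ((↑) ∘ x) (mk U a) : Fin (n + 1) → UltraNat U) =
        fun i => mk U ((Fin.snoc (fun j => (x j).1.rep) a : Fin (n + 1) → ℕ → ℕ) i) := by
      funext i
      refine Fin.lastCases ?_ (fun i => ?_) i <;> simp [mk_rep]
    have e' (a : ℕ → ℕ) (k : ℕ) : (fun i => (Fin.snoc (fun j => (x j).1.rep) a :
        Fin (n + 1) → ℕ → ℕ) i k) = Fin.snoc (fun j => (x j).1.rep k) (a k) := by
      funext i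
      refine Fin.lastCases ?_ (fun i => ?_) i <;> simp
    rw [← mk_rep a, e, boundedFormula_realize_mk _ _ _ default] at ha
    rw [e, boundedFormula_realize_mk _ _ _ default]
    filter_upwards [ha] with k hk
    rw [e'] at hk ⊢
    have h : ∃ a : ℕ, φ.Realize default
      (Fin.snoc (fun j => (x j).1.rep k) a : Fin (n + 1) → ℕ) := ⟨_, hk⟩
    have h1 : F' (.inr (.inr (.inl ⟨n, φ⟩))) k (fun j => (x j).1.rep k) = h.choose := dif_pos h
    rw [h1]
    exact h.choose_spec

variable (M : PV.ElementarySubstructure (UltraNat U))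

theorem realize_hull {β : Type} (φ : PV.Formula β) (a : β → M) :
    φ.Realize a ↔ ∀ᶠ k in (U : Filter ℕ), φ.Realize fun i => (a i).1.rep k := by
  rw [← realize_iff, ← M.subtype.map_formula]
  rfl

/-- The embedding of `ℕ` by constant sequences. -/
def natEmbedding (h : ∀ c : ℕ, mk U (fun _ => c) ∈ M) : ℕ ↪ₑ[PV] M where
  toFun c := ⟨_, h c⟩
  map_formula' n φ x := by
    rw [← M.subtype.map_formula]
    exact (realize_mk φ fun i _ => x i).trans eventually_const

end UltraNat

end Hulls

section Chains

open Filter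

/-! ## Growth -/

theorem Subpoly.of_rpow {U : Filter ℕ} {n x : ℕ → ℕ}
    (h : ∀ ε : ℝ, 0 < ε → ∀ᶠ k in U, (x k : ℝ) ≤ (n k : ℝ) ^ ε) (hn : ∀ c, ∀ᶠ k in U, c ≤ n k) :
    Subpoly U n x := fun c => by
  rcases Nat.eq_zero_or_pos c with rfl | hc
  · simpa using hn 1
  have hc' : (c : ℝ) ≠ 0 := by positivity
  filter_upwards [h ((c : ℝ)⁻¹) (by positivity)] with k hk
  have := pow_le_pow_left₀ (Nat.cast_nonneg _) hk c
  rw [← Real.rpow_natCast (_ ^ _), ← Real.rpow_mul (Nat.cast_nonneg _), inv_mul_cancel₀ hc',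
    Real.rpow_one] at this
  exact_mod_cast this

/-- This places the class of `n` itself in the cut. -/
theorem eventually_size_pow_le (c : ℕ) : ∀ᶠ n : ℕ in atTop, n.size ^ c ≤ n := by
  have h : ∀ᶠ s : ℕ in atTop, 2 * s ^ c ≤ 2 ^ s := by
    have := (tendsto_pow_const_div_const_pow_of_one_lt c (one_lt_two (α := ℝ))).eventually_lt_const
      (show (0 : ℝ) < 2⁻¹ by norm_num)
    filter_upwards [this] with s hs
    rw [div_lt_iff₀ (by positivity), inv_mul_eq_div, lt_div_iff₀ (by norm_num)] at hs
    have : (2 * s ^ c : ℝ) ≤ 2 ^ s := by linarith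
    exact_mod_cast this
  obtain ⟨s₀, h⟩ := eventually_atTop.1 h
  filter_upwards [eventually_ge_atTop (2 ^ s₀)] with n hn
  have h1 : s₀ ≤ n.size := (Nat.lt_size.2 hn).le
  have h2 : 0 < n.size := Nat.size_pos.2 ((Nat.two_pow_pos _).trans_le hn)
  have h3 : 2 ^ (n.size - 1) ≤ n := Nat.lt_size.1 (Nat.sub_lt h2 one_pos)
  have h4 := h _ h1
  have h5 : 2 ^ n.size = 2 * 2 ^ (n.size - 1) := by
    rw [← pow_succ', Nat.sub_add_cancel h2]
  omega

theorem IsSubexponential.subpoly {f : ℕ → ℕ} (h : IsSubexponential f) {U : Filter ℕ} {n : ℕ → ℕ}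
    (hn : Tendsto n U atTop) : Subpoly U n fun k => (f (n k)).size := by
  have hn' : ∀ c, ∀ᶠ k in U, c ≤ n k := fun c => hn.eventually_ge_atTop c
  -- A positive number is at least `2` to its length minus one, so it is the length minus one that
  -- the exponent bounds.
  have h1 : Subpoly U n fun k => (f (n k)).size - 1 := .of_rpow (fun ε hε => by
    filter_upwards [hn.eventually (h ε hε)] with k hk
    rcases Nat.eq_zero_or_pos (f (n k)) with h0 | h0
    · rw [h0]
      simpa using Real.rpow_nonneg (Nat.cast_nonneg _) _
    have h2 : 2 ^ ((f (n k)).size - 1) ≤ f (n k) :=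
      Nat.lt_size.1 (Nat.sub_lt (Nat.size_pos.2 h0) one_pos)
    have h3 : (2 : ℝ) ^ (((f (n k)).size - 1 : ℕ) : ℝ) ≤ 2 ^ ((n k : ℝ) ^ ε) := by
      rw [Real.rpow_natCast]
      exact le_trans (by exact_mod_cast h2) hk
    exact (Real.rpow_le_rpow_left_iff one_lt_two).1 h3) hn'
  exact (h1.add hn' (.const hn' 1)).mono (Eventually.of_forall fun k => by omega)

/-! ## The cut of small elements -/

variable {U : Ultrafilter ℕ} (M : PV.ElementarySubstructure (UltraNat U))

theorem UltraNat.rep_funMap {r : ℕ} (f : PV.Functions r) (a : Fin r → M) :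
    ∀ᶠ k in (U : Filter ℕ), (Structure.funMap f a : M).1.rep k =
      f.1.eval ∅ fun i => (a i).1.rep k := by
  have h := UltraNat.funMap_mk (U := U) f fun i => (a i).1.rep
  simp only [UltraNat.mk_rep] at h
  have h' : (Structure.funMap f a : M).1 = Structure.funMap f fun i => (a i).1 := rfl
  rw [h', h]
  exact UltraNat.rep_mk _

theorem UltraNat.ltN_iff (a b : M) :
    ltN a b ↔ ∀ᶠ k in (U : Filter ℕ), a.1.rep k < b.1.rep k := by
  have R : ∃ R : PV.Relations 2, R = PVRel.lt := ⟨_, rfl⟩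
  obtain ⟨R, hR⟩ := R
  have h := UltraNat.realize_hull M (R.formula₂ (Term.var (0 : Fin 2)) (Term.var 1)) ![a, b]
  simp only [Formula.realize_rel₂] at h
  rw [hR] at h
  exact h

/-- The cut of the elements whose length is `n^{o(1)}`. -/
def UltraNat.cut (n : ℕ → ℕ) (hn : ∀ c, ∀ᶠ k in (U : Filter ℕ), c ≤ n k) : PV.Substructure M where
  carrier := {a | Subpoly U n fun k => (a.1.rep k).size}
  fun_mem {r} f a ha := by
    obtain ⟨p, hp⟩ := OracleTM.PolyTime.exists_bound f.2.1
    refine ((Subpoly.sum hn Finset.univ ha).eval hn p).mono ?_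
    filter_upwards [UltraNat.rep_funMap M f a] with k hk
    rw [hk]
    exact (hp _).2 _

variable {M} {n : ℕ → ℕ} {hn : ∀ c, ∀ᶠ k in (U : Filter ℕ), c ≤ n k}

theorem UltraNat.mem_cut {a : M} : a ∈ cut M n hn ↔ Subpoly U n fun k => (a.1.rep k).size := Iff.rfl

theorem UltraNat.isCut_cut : IsCut (cut M n hn) := fun a b hab hb => by
  refine Subpoly.mono (mem_cut.1 hb) ?_
  filter_upwards [(ltN_iff M a b).1 hab] with k hk using Nat.size_le_size hk.le

/-- The class of the sequence `f (n k)` is a value in the ultrapower, and elementarity yields a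
value in `M`. The formula determines it coordinatewise, so its length is that of `f (n k)`. -/
theorem UltraNat.isSubexponentialIn_cut {m : M} (hm : ∀ᶠ k in (U : Filter ℕ), m.1.rep k = n k) :
    IsSubexponentialIn (cut M n hn) m := by
  intro f θ hf hθ
  have h1 : θ.Realize ![m.1, mk U fun k => f (n k)] := by
    rw [realize_iff]
    filter_upwards [hm, rep_mk (U := U) fun k => f (n k)] with k h1 h2
    have := (hθ (n k) (f (n k))).2 rfl
    convert this using 1
    funext i
    fin_cases i
    exacts [h1, h2]
  have h2 : (Formula.iExs (α := Fin 1) Unit (θ.relabel ![Sum.inl 0, Sum.inr ()])).Realize ![m.1] := by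
    rw [Formula.realize_iExs]
    refine ⟨fun _ => mk U fun k => f (n k), ?_⟩
    rw [Formula.realize_relabel]
    convert h1 using 1
    funext i
    fin_cases i <;> rfl
  have h3 : (Formula.iExs (α := Fin 1) Unit (θ.relabel ![Sum.inl 0, Sum.inr ()])).Realize ![m] := by
    rw [← M.subtype.map_formula]
    convert h2 using 1
    funext i
    fin_cases i; rfl
  rw [Formula.realize_iExs] at h3
  obtain ⟨b, hb⟩ := h3
  have hb : θ.Realize ![m, b ()] := by
    rw [Formula.realize_relabel] at hb
    convert hb using 1
    funext i
    fin_cases i <;> rfl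
  refine ⟨b (), mem_cut.2 ?_, hb⟩
  refine (hf.subpoly (U := U) (n := n) (tendsto_atTop.2 hn)).mono ?_
  rw [realize_hull] at hb
  filter_upwards [hb, hm] with k h1 h2
  refine (congrArg Nat.size ?_).le
  rw [← h2]
  refine ((hθ _ _).1 ?_).symm
  convert h1 using 1
  funext i
  fin_cases i <;> rfl

/-! ## Chains of conditions -/

variable {L : FirstOrder.Language.{0, 0}} {B : Type} {S : L.Structure B} {g : ℕ → ℕ}

/-- The conditions obtained by solving a sequence of requirements with parameters. -/
noncomputable def chain (n : ℕ → ℕ)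
    (t : ℕ → Option (Σ ρ : Req S g, Fin ρ.b ⊕ Fin ρ.l → ℕ → ℕ)) : ℕ → ℕ → Finset (AtomFact L)
  | 0, _ => ∅
  | i + 1, k => match t i with
    | none => chain n t i k
    | some s => (s.1.sol (n k) (chain n t i k) fun j => s.2 j k).1

variable {t : ℕ → Option (Σ ρ : Req S g, Fin ρ.b ⊕ Fin ρ.l → ℕ → ℕ)}

theorem chain_mono (k : ℕ) : Monotone fun i => chain n t i k := by
  refine monotone_nat_of_le_succ fun i => ?_
  rw [chain]
  split
  · exact subset_rfl
  · exact (Req.sol_spec _ _ _ _).1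

/-- Smallness and goodness are proved together: a solution is guaranteed to be good only if the
preceding condition leaves enough room. -/
theorem chain_good [Infinite B] (hn : ∀ c, ∀ᶠ k in (U : Filter ℕ), c ≤ n k)
    (hg : Subpoly U n fun k => g (n k))
    (ht : ∀ i s, t i = some s → ∀ j, Subpoly U n fun k => (s.2 j k).size) (i : ℕ) :
    (Subpoly U n fun k => (chain n t i k).card) ∧
      ∀ᶠ k in (U : Filter ℕ), Good S (n k) (chain n t i k) := by
  induction i with
  | zero =>
    refine ⟨.const hn 0, Eventually.of_forall fun k => ?_⟩
    exact good_empty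
  | succ i ih =>
    have e (k : ℕ) : chain n t (i + 1) k = match t i with
      | none => chain n t i k
      | some s => (s.1.sol (n k) (chain n t i k) fun j => s.2 j k).1 := rfl
    rcases h : t i with _ | s
    · simpa only [e, h] using ih
    · simp only [e, h]
      have hs : Subpoly U n fun k => sz fun j => s.2 j k := Subpoly.sum hn _ (ht i s h)
      refine ⟨(ih.1.add hn (hs.eval hn s.1.D)).mono (Eventually.of_forall fun k =>
        (Req.sol_spec _ _ _ _).2.1), ?_⟩
      filter_upwards [ih.2, (((ih.1.add hn hs).add hn hg).eval hn s.1.Q) 1] with k h1 h2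
      exact ((Req.sol_spec _ _ _ _).2.2 h1 (by simpa using h2)).1

theorem chain_post [Infinite B] (hn : ∀ c, ∀ᶠ k in (U : Filter ℕ), c ≤ n k)
    (hg : Subpoly U n fun k => g (n k))
    (ht : ∀ i s, t i = some s → ∀ j, Subpoly U n fun k => (s.2 j k).size) {i : ℕ} {s}
    (h : t i = some s) : ∀ᶠ k in (U : Filter ℕ), s.1.Post (n k) (chain n t i k)
      (fun j => s.2 j k) (chain n t (i + 1) k)
      (s.1.sol (n k) (chain n t i k) fun j => s.2 j k).2 := by
  have ih := chain_good hn hg ht i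
  have hs : Subpoly U n fun k => sz fun j => s.2 j k := Subpoly.sum hn _ (ht i s h)
  have e (k : ℕ) : chain n t (i + 1) k = (s.1.sol (n k) (chain n t i k) fun j => s.2 j k).1 := by
    simp only [chain, h]
  filter_upwards [ih.2, (((ih.1.add hn hs).add hn hg).eval hn s.1.Q) 1] with k h1 h2
  rw [e]
  exact ((Req.sol_spec _ _ _ _).2.2 h1 (by simpa using h2)).2

/-- Diagonalization: in coordinate `k` the embedding serves the last good condition of index at most
`k`, and by monotonicity all earlier ones. Each fixed index is among these for almost all `k`. -/
theorem exists_chain_embedding [Infinite B] (hU : ∀ c, ∀ᶠ k in (U : Filter ℕ), c ≤ k)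
    (hn : ∀ c, ∀ᶠ k in (U : Filter ℕ), c ≤ n k) (hg : Subpoly U n fun k => g (n k))
    (ht : ∀ i s, t i = some s → ∀ j, Subpoly U n fun k => (s.2 j k).size) :
    ∃ e : ℕ → ℕ → B, (∀ k, Set.InjOn (e k) (Set.Iio (n k))) ∧ ∀ i, ∀ᶠ k in (U : Filter ℕ),
      ∀ x ∈ chain n t i k, x.Holds S (e k) ∧ ∀ i ∈ x.supp, i < n k := by
  classical
  have h (k : ℕ) : Good S (n k)
      (chain n t (Nat.findGreatest (fun i => Good S (n k) (chain n t i k)) k) k) :=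
    Nat.findGreatest_spec (P := fun i => Good S (n k) (chain n t i k)) (Nat.zero_le k) good_empty
  choose e he1 he2 using h
  refine ⟨e, he1, fun i => ?_⟩
  filter_upwards [hU i, (chain_good hn hg ht i).2] with k h1 h2 x hx
  exact he2 k x (chain_mono k (Nat.le_findGreatest h1 h2) hx)

end Chains

section Construction

open Filter

variable {L : FirstOrder.Language.{0, 0}} {B : Type}

/-- To decide the value of a function symbol of `PV(α)`. -/
noncomputable def Req.eval [Fintype L.Symbols] (S : L.Structure B) (g : ℕ → ℕ)
    (code : L.Symbols → ℕ) {r : ℕ} (f : PVα.Functions r) : Req S g :=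
  .decide S g code r 0 (fun A v => f.1.eval A (v ∘ Sum.inl))
    (OracleTM.PolyTime.exists_bound f.2).choose fun v =>
      (((OracleTM.PolyTime.exists_bound f.2).choose_spec (v ∘ Sum.inl)).1).mono
        (Polynomial.eval_mono_nat _ (by simp [sz, Fintype.sum_sum_type]))

/-! ## Existence of generic models -/

/-- The hull has to be fixed before the chain, which takes its parameters from the cut of the hull.
Therefore the hull is closed under solving requirements, viewed as an operation on codes of
conditions. By induction the hull contains the codes of all conditions of the chain, and with them
the witnesses; small witnesses lie in the cut. -/
theorem exists_genericModel [Fintype L.Symbols] [Infinite B] {code : L.Symbols → ℕ}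
    (hc : Function.Injective code) (S : L.Structure B) {g : ℕ → ℕ}
    (hg : ∀ ε : ℝ, 0 < ε → ∀ᶠ n : ℕ in atTop, (g n : ℝ) ≤ (n : ℝ) ^ ε) {C : Set (Req S g)}
    (hC : C.Countable) {ψ : PV.Formula (Fin 1)} (hψ : ∀ b : ℕ, ∃ x : ℕ, b ≤ x ∧ ψ.Realize ![x]) :
    ∃ (M : Type) (_ : PV.Structure M) (_ : ℕ ↪ₑ[PV] M) (N : PV.Substructure M)
      (_ : PVα.Structure N) (_ : PV.incl.IsExpansionOn N) (n : N) (G : GenericModel code S N),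
      IsCut N ∧ IsSubexponentialIn N (n : M) ∧ ψ.Realize ![(n : M)] ∧
      (∀ᶠ k in (G.U : Filter ℕ), G.rep n k = G.n k) ∧ ∀ ρ ∈ C, G.Meets ρ := by
  classical
  -- The sequence satisfies `ψ` in every coordinate and dominates the identity, so its class is
  -- nonstandard.
  choose n hnk hnψ using hψ
  let U : Ultrafilter ℕ := hyperfilter ℕ
  have hU : ∀ c, ∀ᶠ k in (U : Filter ℕ), c ≤ k := fun c =>
    Nat.hyperfilter_le_atTop (eventually_ge_atTop c)
  have hn : ∀ c, ∀ᶠ k in (U : Filter ℕ), c ≤ n k := fun c =>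
    (hU c).mono fun k hk => hk.trans (hnk k)
  have hnt : Tendsto n U atTop := tendsto_atTop.2 hn
  have hgn : Subpoly U n fun k => g (n k) := .of_rpow (fun ε hε => hnt.eventually (hg ε hε)) hn
  -- Evaluation requirements are added so that the cut is closed under all function symbols of
  -- `PV(α)`.
  let C' : Set (Req S g) := C ∪ ⋃ f : Σ r, PVα.Functions r, {Req.eval S g code f.2}
  have hC' : C'.Countable := hC.union (Set.countable_iUnion fun f => Set.countable_singleton _)
  have : Countable C' := hC'.to_subtype
  have : Countable L.Symbols := inferInstance
  let := Encodable.ofCountable (Finset (AtomFact L))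
  let ι : Type := Unit ⊕ C' × Option ℕ
  let α : ι → Type := Sum.elim (fun _ => Empty) fun s => Option (Fin s.1.1.b ⊕ Fin s.1.1.l)
  have hα : ∀ i, Finite (α i) := by
    rintro (i | i)
    · exact inferInstanceAs (Finite Empty)
    · exact inferInstanceAs (Finite (Option (Fin i.1.1.b ⊕ Fin i.1.1.l)))
  -- Argument `none` carries the code of the current condition. Output index `none` returns the code
  -- of the solution's condition, and `some j` returns its witness number `j`.
  let F : ∀ i, ℕ → (α i → ℕ) → ℕ := fun i => match i with
    | .inl _ => fun k _ => n k
    | .inr (ρ, o) => fun k x =>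
      let s := ρ.1.sol (n k) ((Encodable.decode (x none)).getD ∅) fun j => x (some j)
      o.elim (Encodable.encode s.1) s.2
  obtain ⟨M, hM, hconst, hF⟩ := UltraNat.exists_hull U α F
  have hnM : UltraNat.mk U n ∈ M := hF (.inl ()) Empty.elim fun j => j.elim
  let N : PV.Substructure M := UltraNat.cut M n hn
  have : Countable (Σ ρ : C', Fin ρ.1.b ⊕ Fin ρ.1.l → N) := inferInstance
  let := Encodable.ofCountable (Σ ρ : C', Fin ρ.1.b ⊕ Fin ρ.1.l → N)
  let t : ℕ → Option (Σ ρ : Req S g, Fin ρ.b ⊕ Fin ρ.l → ℕ → ℕ) := fun i =>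
    (Encodable.decode (α := Σ ρ : C', Fin ρ.1.b ⊕ Fin ρ.1.l → N) i).map
      fun s => ⟨s.1.1, fun j => (s.2 j).1.1.rep⟩
  have ht : ∀ i s, t i = some s → ∀ j, Subpoly U n fun k => (s.2 j k).size := by
    intro i s hs j
    obtain ⟨s, -, rfl⟩ := Option.map_eq_some_iff.1 hs
    exact (s.2 j).2
  have hsol (ρ : C') (v : Fin ρ.1.b ⊕ Fin ρ.1.l → N) (o : Option ℕ) {p : ℕ → Finset (AtomFact L)}
      (hp : UltraNat.mk U (fun k => Encodable.encode (p k)) ∈ M) :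
      UltraNat.mk U (fun k => o.elim
        (Encodable.encode (ρ.1.sol (n k) (p k) fun j => (v j).1.1.rep k).1)
        (ρ.1.sol (n k) (p k) fun j => (v j).1.1.rep k).2) ∈ M := by
    have h := hF (.inr (ρ, o)) (fun i : Option (Fin ρ.1.b ⊕ Fin ρ.1.l) => match i with
      | none => fun k => Encodable.encode (p k)
      | some j => (v j).1.1.rep) (by
        rintro (_ | j)
        · exact hp
        · rw [UltraNat.mk_rep]
          exact (v j).1.2)
    simpa [F] using h
  have hP (i : ℕ) : UltraNat.mk U (fun k => Encodable.encode (chain n t i k)) ∈ M := by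
    induction i with
    | zero => exact hconst (Encodable.encode (∅ : Finset (AtomFact L)))
    | succ i ih =>
      simp only [chain, t]
      rcases (Encodable.decode (α := Σ ρ : C', Fin ρ.1.b ⊕ Fin ρ.1.l → N) i) with _ | s
      · exact ih
      · exact hsol s.1 s.2 none ih
  obtain ⟨e, he, hholds⟩ := exists_chain_embedding hU hn hgn ht
  let A : ℕ → Set ℕ := fun k => oracleOf code S (n k) (e k)
  -- The stage that meets a requirement is the code of the requirement together with its parameters.
  have hmeets (ρ : C') (v : Fin ρ.1.b ⊕ Fin ρ.1.l → N) : ∃ (i : ℕ) (s : ℕ → ℕ → ℕ),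
      (∀ᶠ k in (U : Filter ℕ), ρ.1.Post (n k) (chain n t i k) (fun j => (v j).1.1.rep k)
        (chain n t (i + 1) k) (s k)) ∧
      ∀ j, Subpoly U n (fun k => (s k j).size) →
        ∃ a : N, ∀ᶠ k in (U : Filter ℕ), a.1.1.rep k = s k j := by
    have hti : t (Encodable.encode (⟨ρ, v⟩ : Σ ρ : C', Fin ρ.1.b ⊕ Fin ρ.1.l → N)) =
        some ⟨ρ.1, fun j => (v j).1.1.rep⟩ := by simp [t]
    refine ⟨_, _, chain_post hn hgn ht hti, fun j hj => ?_⟩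
    refine ⟨⟨⟨_, hsol ρ v (some j) (hP _)⟩, ?_⟩, UltraNat.rep_mk _⟩
    refine UltraNat.mem_cut.2 (hj.mono ?_)
    filter_upwards [UltraNat.rep_mk (U := U) _] with k hk
    exact (congrArg Nat.size hk).le
  have hval {r : ℕ} (f : PVα.Functions r) (v : Fin r → N) : ∃ a : N, ∀ᶠ k in (U : Filter ℕ),
      a.1.1.rep k = f.1.eval (A k) fun i => (v i).1.1.rep k := by
    obtain ⟨i, s, hs, h⟩ := hmeets ⟨Req.eval S g code f, .inr (Set.mem_iUnion.2 ⟨⟨r, f⟩, rfl⟩)⟩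
      (Sum.elim v Fin.elim0)
    obtain ⟨p, hp⟩ := OracleTM.PolyTime.exists_bound f.2
    have h1 : ∀ᶠ k in (U : Filter ℕ), s k 0 = f.1.eval (A k) fun i => (v i).1.1.rep k := by
      filter_upwards [hs, hholds (i + 1)] with k h1 h2
      obtain ⟨p', hp', -, h3⟩ := h1
      exact (h3 _ ((compat_oracleOf hc (he k) h2).mono hp')).symm
    obtain ⟨a, ha⟩ := h 0 (((Subpoly.sum hn Finset.univ fun i => (v i).2).eval hn p).mono (by
      filter_upwards [h1] with k hk
      rw [hk]
      exact (hp _).2 _))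
    exact ⟨a, by filter_upwards [ha, h1] with k h1 h2 using h1.trans h2⟩
  choose val hval using @hval
  let sα : PVα.Structure N := {
    funMap := fun f v => val f v
    RelMap := fun R v => match R, v with
      | PVαRel.lt, v => ltN (v 0) (v 1)
      | PVαRel.alpha, v => ∀ᶠ k in (U : Filter ℕ), (v 0).1.1.rep k ∈ A k }
  have hrep {a b : N} (h : ∀ᶠ k in (U : Filter ℕ), a.1.1.rep k = b.1.1.rep k) : a = b := by
    refine Subtype.ext (Subtype.ext ?_)
    rw [← UltraNat.mk_rep a.1.1, ← UltraNat.mk_rep b.1.1]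
    exact UltraNat.mk_eq.2 h
  have hexp : PV.incl.IsExpansionOn N := by
    refine ⟨fun {r} f v => hrep ?_, fun {r} R v => ?_⟩
    · filter_upwards [hval (PV.incl.onFunction f) v,
        UltraNat.rep_funMap M f fun i => (v i).1] with k h1 h2
      refine h1.trans (Eq.trans ?_ h2.symm)
      exact f.2.2.eval_eq _ _ _
    · cases R
      change Structure.RelMap (L := PV) PVRel.lt ![v 0, v 1] = Structure.RelMap (L := PV) PVRel.lt v
      congr 1
      funext i
      fin_cases i <;> rfl
  have hnN : (⟨_, hnM⟩ : M) ∈ N := by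
    refine UltraNat.mem_cut.2 fun c => ?_
    filter_upwards [UltraNat.rep_mk (U := U) n, hnt.eventually (eventually_size_pow_le c)]
      with k h1 h2
    exact (congrArg (fun x => Nat.size x ^ c) h1).trans_le h2
  let G : GenericModel code S N := {
    U := U, n := n, le_n := hn, rep := fun a => a.1.1.rep, eq_of_rep := hrep
    small := fun a => a.2
    P := chain n t, P_mono := chain_mono, e := e, e_inj := he, holds := hholds
    rep_fn := hval
    lt_iff := fun {a b} => by
      refine Iff.trans ?_ (UltraNat.ltN_iff M a.1 b.1)
      refine iff_of_eq (congrArg (Structure.RelMap (L := PV) (M := M) PVRel.lt) ?_)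
      funext i
      fin_cases i <;> rfl
    mem_iff := Iff.rfl }
  refine ⟨M, inferInstance, UltraNat.natEmbedding M hconst, N, sα, hexp, ⟨⟨_, hnM⟩, hnN⟩, G,
    UltraNat.isCut_cut, UltraNat.isSubexponentialIn_cut (UltraNat.rep_mk n), ?_,
    UltraNat.rep_mk n, fun ρ hρ => hmeets ⟨ρ, .inl hρ⟩⟩
  rw [UltraNat.realize_hull]
  filter_upwards [UltraNat.rep_mk (U := U) n] with k hk
  convert hnψ k using 1
  funext i
  fin_cases i
  exact hk

end Construction

/-! ### Coordinatewise description of elements and of coded structures. -/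

section CodedStructures

open Filter

variable {L : FirstOrder.Language.{0, 0}} {code : L.Symbols → ℕ} {B : Type} {S : L.Structure B}
  {N : Type} [PV.Structure N] [PVα.Structure N] (G : GenericModel code S N)

namespace GenericModel

theorem ne_iff {a b : N} : a ≠ b ↔ ∀ᶠ k in (G.U : Filter ℕ), G.rep a k ≠ G.rep b k := by
  rw [Ne, G.eq_iff, ← Ultrafilter.eventually_not]

theorem reps_cons {m : ℕ} (x : N) (xs : Fin m → N) (k : ℕ) :
    G.reps (Fin.cons x xs : Fin (m + 1) → N) k = Fin.cons (G.rep x k) (G.reps xs k) := by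
  funext i
  refine Fin.cases ?_ (fun i => ?_) i <;> simp [reps]

theorem reps_vec1 (a : N) (k : ℕ) : G.reps ![a] k = ![G.rep a k] := by
  funext i
  fin_cases i
  rfl

theorem reps_vec2 (a b : N) (k : ℕ) : G.reps ![a, b] k = ![G.rep a k, G.rep b k] := by
  funext i
  fin_cases i <;> rfl

variable [PV.incl.IsExpansionOn N] (κ : BasicSymbols)

/-! ## Basic functions in generic models -/

theorem rep_pvFn {r : ℕ} (f : PV.Functions r) (v : Fin r → N) :
    ∀ᶠ k in (G.U : Filter ℕ), G.rep (Structure.funMap f v) k =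
      Structure.funMap (M := ℕ) f (G.reps v k) :=
  G.rep_pvTerm (Term.func f fun i => Term.var i) v

theorem rep_num (j : ℕ) : ∀ᶠ k in (G.U : Filter ℕ), G.rep (numN κ j) k = j := by
  filter_upwards [G.rep_pvFn (κ.num j) ![] ] with k hk
  rw [numN, hk, κ.num_spec]

theorem rep_len (a : N) : ∀ᶠ k in (G.U : Filter ℕ),
    G.rep (Structure.funMap κ.len ![a]) k = (G.rep a k).size := by
  filter_upwards [G.rep_pvFn κ.len ![a] ] with k hk
  rw [hk, reps_vec1, κ.len_spec]

theorem rep_bit (i a : N) : ∀ᶠ k in (G.U : Filter ℕ),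
    G.rep (Structure.funMap κ.bit ![i, a]) k = ((G.rep a k).testBit (G.rep i k)).toNat := by
  filter_upwards [G.rep_pvFn κ.bit ![i, a] ] with k hk
  rw [hk, reps_vec2, κ.bit_spec]

theorem rep_pred (a : N) : ∀ᶠ k in (G.U : Filter ℕ),
    G.rep (Structure.funMap κ.pred ![a]) k = G.rep a k - 1 := by
  filter_upwards [G.rep_pvFn κ.pred ![a] ] with k hk
  rw [hk, reps_vec1, κ.pred_spec]

theorem rep_tup {r : ℕ} (a : Fin r → N) : ∀ᶠ k in (G.U : Filter ℕ),
    G.rep (Structure.funMap (κ.tup r) a) k = seqCode (List.ofFn (G.reps a k)) := by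
  filter_upwards [G.rep_pvFn (κ.tup r) a] with k hk
  rw [hk, κ.tup_spec]

theorem rep_entry (a i : N) : ∀ᶠ k in (G.U : Filter ℕ),
    G.rep (Structure.funMap κ.entry ![a, i]) k = seqEntry (G.rep a k) (G.rep i k) := by
  filter_upwards [G.rep_pvFn κ.entry ![a, i] ] with k hk
  rw [hk, reps_vec2, κ.entry_spec]

theorem bit_eq_one_iff {i a : N} : Structure.funMap κ.bit ![i, a] = numN κ 1 ↔
    ∀ᶠ k in (G.U : Filter ℕ), (G.rep a k).testBit (G.rep i k) = true := by
  rw [G.eq_iff]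
  refine eventually_congr ?_
  filter_upwards [G.rep_bit κ i a, G.rep_num κ 1] with k h1 h2
  rw [h1, h2, Bool.toNat_eq_one]

theorem zero_lt_iff {a : N} : a ≠ numN κ 0 ↔ ∀ᶠ k in (G.U : Filter ℕ), 0 < G.rep a k := by
  rw [G.ne_iff]
  refine eventually_congr ?_
  filter_upwards [G.rep_num κ 0] with k hk
  rw [hk, Nat.pos_iff_ne_zero]

/-! ## Structures coded by ultraproducts of oracles -/

variable {K : FirstOrder.Language.{0, 0}} (code' : K.Symbols → ℕ)

theorem tup_rel_mem_iff {XN : Set N} {X : ℕ → Set ℕ}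
    (hX : ∀ u, u ∈ XN ↔ ∀ᶠ k in (G.U : Filter ℕ), G.rep u k ∈ X k) {r : ℕ} (R : K.Relations r)
    (a : Fin r → N) : Structure.funMap (κ.tup (r + 1))
        (Fin.cons (numN κ (code' (.inr ⟨r, R⟩))) a : Fin (r + 1) → N) ∈ XN ↔
      ∀ᶠ k in (G.U : Filter ℕ), relQ code' R (G.reps a k) ∈ X k := by
  rw [hX]
  refine eventually_congr ?_
  filter_upwards [G.rep_tup κ (Fin.cons (numN κ (code' (.inr ⟨r, R⟩))) a : Fin (r + 1) → N),
    G.rep_num κ (code' (.inr ⟨r, R⟩))] with k h1 h2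
  rw [h1, reps_cons, h2]
  rfl

theorem tup_fn_mem_iff {XN : Set N} {X : ℕ → Set ℕ}
    (hX : ∀ u, u ∈ XN ↔ ∀ᶠ k in (G.U : Filter ℕ), G.rep u k ∈ X k) {r : ℕ} (f : K.Functions r)
    (a : Fin r → N) (i : N) : Structure.funMap (κ.tup (r + 2))
        (Fin.cons (numN κ (code' (.inl ⟨r, f⟩))) (Fin.snoc a i : Fin (r + 1) → N) :
          Fin (r + 2) → N) ∈ XN ↔
      ∀ᶠ k in (G.U : Filter ℕ), fnQ code' f (G.reps a k) (G.rep i k) ∈ X k := by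
  rw [hX]
  refine eventually_congr ?_
  filter_upwards [G.rep_tup κ (Fin.cons (numN κ (code' (.inl ⟨r, f⟩)))
    (Fin.snoc a i : Fin (r + 1) → N) : Fin (r + 2) → N),
    G.rep_num κ (code' (.inl ⟨r, f⟩))] with k h1 h2
  rw [h1, reps_cons, h2, reps_snoc]
  rfl

/-- The structure coded by an ultraproduct of oracles. -/
theorem exists_isBinaryCode {m : N} (hm : m ≠ numN κ 0) {XN : Set N} {X : ℕ → Set ℕ}
    (hX : ∀ u, u ∈ XN ↔ ∀ᶠ k in (G.U : Filter ℕ), G.rep u k ∈ X k)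
    (hbits : ∀ {r : ℕ} (f : K.Functions r) (a : Fin r → below m), ∃ c : N,
      ∀ᶠ k in (G.U : Filter ℕ), G.rep c k =
        bitsOf code' (G.rep m k) (X k) f (G.reps (fun i => (a i : N)) k)) :
    ∃ T : K.Structure (below m), IsBinaryCode κ code' m XN T ∧
      (∀ {r : ℕ} (R : K.Relations r) (a : Fin r → below m), T.RelMap R a ↔
        ∀ᶠ k in (G.U : Filter ℕ), relQ code' R (G.reps (fun i => (a i : N)) k) ∈ X k) ∧
      ∀ {r : ℕ} (f : K.Functions r) (a : Fin r → below m), ∀ᶠ k in (G.U : Filter ℕ),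
        G.rep (T.funMap f a) k =
          codedFn code' (G.rep m k) (X k) f (G.reps (fun i => (a i : N)) k) := by
  have hval {r : ℕ} (f : K.Functions r) (a : Fin r → below m) : ∃ v : below m,
      (∀ᶠ k in (G.U : Filter ℕ), G.rep v k =
        codedFn code' (G.rep m k) (X k) f (G.reps (fun i => (a i : N)) k)) ∧
      ∀ c, (∀ᶠ k in (G.U : Filter ℕ), G.rep c k =
          bitsOf code' (G.rep m k) (X k) f (G.reps (fun i => (a i : N)) k)) →
        (ltN c m ∧ (v : N) = c) ∨ (¬ ltN c m ∧ (v : N) = Structure.funMap κ.pred ![m]) := by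
    have h0 := (G.zero_lt_iff κ).1 hm
    obtain ⟨c, hcb⟩ := hbits f a
    have huniq : ∀ c', (∀ᶠ k in (G.U : Filter ℕ), G.rep c' k =
        bitsOf code' (G.rep m k) (X k) f (G.reps (fun i => (a i : N)) k)) → c' = c := by
      intro c' hc'
      refine G.eq_of_rep ?_
      filter_upwards [hc', hcb] with k h1 h2 using h1.trans h2.symm
    by_cases hlt : ltN c m
    · refine ⟨⟨c, hlt⟩, ?_, fun c' hc' => .inl ?_⟩
      · filter_upwards [hcb, G.lt_iff.1 hlt] with k h1 h2
        rw [h1] at h2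
        rw [h1, codedFn, min_eq_left (Nat.le_sub_one_of_lt h2)]
      · rw [huniq c' hc']
        exact ⟨hlt, rfl⟩
    · have hlt' := hlt
      rw [G.lt_iff, ← Ultrafilter.eventually_not] at hlt'
      refine ⟨⟨Structure.funMap κ.pred ![m], G.lt_iff.2 ?_⟩, ?_, fun c' hc' => .inr ?_⟩
      · filter_upwards [h0, G.rep_pred κ m] with k h1 h2
        rw [h2]
        exact Nat.sub_lt h1 one_pos
      · filter_upwards [hcb, hlt', G.rep_pred κ m] with k h1 h2 h3
        rw [h1] at h2
        rw [h3, codedFn, min_eq_right (by omega)]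
      · rw [huniq c' hc']
        exact ⟨hlt, rfl⟩
  choose val hval huniq using @hval
  refine ⟨{ funMap := fun f a => val f a
            RelMap := fun R a => ∀ᶠ k in (G.U : Filter ℕ),
              relQ code' R (G.reps (fun i => (a i : N)) k) ∈ X k }, ⟨fun r R a => ?_,
    fun r f a => ?_⟩, fun R a => Iff.rfl, fun f a => hval f a⟩
  · exact (G.tup_rel_mem_iff κ code' hX R _).symm
  · obtain ⟨c, hc⟩ := hbits f a
    refine ⟨c, fun hlt => ?_, fun i hi => ?_, huniq f a c hc⟩
    · obtain ⟨k, h1, h2, h3, h4⟩ :=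
        ((G.lt_iff.1 hlt).and ((G.rep_len κ m).and ((G.rep_len κ c).and hc))).exists
      rw [h2, h3, h4] at h1
      exact absurd (bitsOf_size_le code' _ _ _ _) h1.not_ge
    · rw [G.bit_eq_one_iff, G.tup_fn_mem_iff κ code' hX]
      refine eventually_congr ?_
      filter_upwards [hc, G.lt_iff.1 hi, G.rep_len κ m] with k h1 h2 h3
      rw [h1, testBit_bitsOf code' (h3 ▸ h2)]

/-- Literals that are true almost everywhere are verified by the coded structure. -/
theorem verifiesLit_of_litTrue {m : N} {X : ℕ → Set ℕ} (T : K.Structure (below m))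
    (hrel : ∀ {r : ℕ} (R : K.Relations r) (a : Fin r → below m), T.RelMap R a ↔
      ∀ᶠ k in (G.U : Filter ℕ), relQ code' R (G.reps (fun i => (a i : N)) k) ∈ X k)
    (hfn : ∀ {r : ℕ} (f : K.Functions r) (a : Fin r → below m), ∀ᶠ k in (G.U : Filter ℕ),
      G.rep (T.funMap f a) k =
        codedFn code' (G.rep m k) (X k) f (G.reps (fun i => (a i : N)) k))
    {l : ℕ} (w : Fin l → below m) (lit : BasicLiteral (K.sum PV) l)
    (h : ∀ᶠ k in (G.U : Filter ℕ), LitTrue code' (G.rep m k) (X k)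
      (G.reps (fun i => (w i : N)) k) lit) :
    (PartialStr.withPV inferInstance (below m) (PartialStr.ofTotal T)).VerifiesLit w lit := by
  have hlt {r : ℕ} (R : PV.Relations r) (a : Fin r → N) : Structure.RelMap R a ↔
      ∀ᶠ k in (G.U : Filter ℕ), PV.standard.RelMap R (G.reps a k) := by
    cases R
    have : Structure.RelMap (L := PV) PVRel.lt a ↔ ltN (a 0) (a 1) := by
      refine iff_of_eq (congrArg (Structure.RelMap (L := PV) PVRel.lt) ?_)
      funext i
      fin_cases i <;> rfl
    rw [this, G.lt_iff]
    rfl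
  classical
  cases lit with
  | rel R u =>
    rcases R with R | R
    · exact congrArg some (decide_eq_true ((hrel R (w ∘ u)).2 h))
    · exact congrArg some (decide_eq_true ((hlt R fun i => (w (u i) : N)).2 h))
  | nrel R u =>
    rcases R with R | R
    · exact congrArg some (decide_eq_false fun h' => by
        obtain ⟨k, h1, h2⟩ := (h.and ((hrel R (w ∘ u)).1 h')).exists
        exact h1 h2)
    · exact congrArg some (decide_eq_false fun h' => by
        obtain ⟨k, h1, h2⟩ := (h.and ((hlt R fun i => (w (u i) : N)).1 h')).exists
        exact h1 h2)
  | fn f u v =>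
    rcases f with f | f
    · refine congrArg some (Subtype.ext (G.eq_of_rep ?_))
      filter_upwards [h, hfn f (w ∘ u)] with k h1 h2
      exact h2.trans h1
    · have h1 : Structure.funMap f (fun i => (w (u i) : N)) = w v := by
        refine G.eq_of_rep ?_
        filter_upwards [h, G.rep_pvFn f fun i => (w (u i) : N)] with k h1 h2
        exact h2.trans h1
      have h2 : Structure.funMap f (fun i => ((w ∘ u) i : N)) ∈ below m := by
        rw [show (fun i => ((w ∘ u) i : N)) = fun i => (w (u i) : N) from rfl, h1]
        exact (w v).2
      exact (dif_pos h2).trans (congrArg some (Subtype.ext h1))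
  | eq u v => exact Subtype.ext (G.eq_of_rep h)
  | ne u v => exact fun h' => (G.ne_iff.2 h) (congrArg Subtype.val h')

end GenericModel

end CodedStructures

/-! ### Failure of the strong sentence and validity of the weak principle in generic models. -/

section Models

open Filter

variable {L : FirstOrder.Language.{0, 0}} {code : L.Symbols → ℕ} {B : Type} {S : L.Structure B}
  {N : Type} [PV.Structure N] [PVα.Structure N]

namespace GenericModel

variable (G : GenericModel code S N) (κ : BasicSymbols)

/-! ## The structure coded by the generic oracle -/

/-- A fact naming the value `c` enters some condition. Its digits at positions below the length of
`n` are then in the oracle, and at higher positions the digits vanish on both sides because `c < n`.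
-/
theorem exists_value (hc : Function.Injective code) [Fintype L.Symbols] {g : ℕ → ℕ} {n : N}
    (hn : ∀ᶠ k in (G.U : Filter ℕ), G.rep n k = G.n k) {r : ℕ} (f : L.Functions r)
    (hf : G.Meets (Req.value S g f)) (a : Fin r → below n) :
    ∃ c : N, ∀ᶠ k in (G.U : Filter ℕ), G.rep c k < G.n k ∧
      G.rep c k = bitsOf code (G.rep n k) (G.A k) f (G.reps (fun i => (a i : N)) k) ∧
      S.funMap f (G.e k ∘ G.reps (fun i => (a i : N)) k) = G.e k (G.rep c k) := by
  obtain ⟨i, s, hP, hs⟩ := hf (Sum.elim (fun i => (a i : N)) Fin.elim0)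
  have ha : ∀ᶠ k in (G.U : Filter ℕ), ∀ i, G.reps (fun i => (a i : N)) k i < G.n k := by
    rw [eventually_all]
    intro i
    filter_upwards [G.lt_iff.1 (a i).2, hn] with k h1 h2
    rwa [h2] at h1
  have hv : ∀ᶠ k in (G.U : Filter ℕ), s k 0 < G.n k ∧
      s k 0 = bitsOf code (G.rep n k) (G.A k) f (G.reps (fun i => (a i : N)) k) ∧
      S.funMap f (G.e k ∘ G.reps (fun i => (a i : N)) k) = G.e k (s k 0) := by
    filter_upwards [hP, ha, hn, G.compat hc (i + 1), G.holds (i + 1)] with k h1 h2 h3 h4 h5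
    obtain ⟨h6, h7⟩ := h1 h2
    refine ⟨h7, ?_, (h5 _ h6).1⟩
    rw [h3]
    refine Nat.eq_of_testBit_eq fun j => ?_
    rcases lt_or_ge j (G.n k).size with hj | hj
    · rw [Bool.eq_iff_iff, testBit_bitsOf code hj]
      exact (h4.1 _ h6 j hj).symm
    · have h8 : ∀ x : ℕ, x.size ≤ (G.n k).size → x.testBit j = false := fun x hx =>
        Nat.testBit_lt_two_pow (Nat.size_le.1 (hx.trans hj))
      rw [h8 _ (Nat.size_le_size h7.le), h8 _ (bitsOf_size_le _ _ _ _ _)]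
  obtain ⟨c, hc⟩ := hs 0 ((G.small n).mono (by
    filter_upwards [hv, hn] with k h1 h2
    rw [h2]
    exact Nat.size_le_size h1.1.le))
  refine ⟨c, ?_⟩
  filter_upwards [hc, hv] with k h1 h2
  rwa [h1]

/-- Coordinatewise, the coded structure is `S` pulled back along an injection, its function values
lying in the range by the value requirements. An assignment verifying the sentence would thus yield
one in `S`. -/
theorem bFails [PV.incl.IsExpansionOn N] (hc : Function.Injective code) [Fintype L.Symbols] {g : ℕ → ℕ} {n : N}
    (hn : ∀ᶠ k in (G.U : Filter ℕ), G.rep n k = G.n k)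
    (hf : ∀ {r : ℕ} (f : L.Functions r), G.Meets (Req.value S g f)) {φ : BasicSentence L}
    (hφ : ¬ (PartialStr.ofTotal S).Verifies φ) : BFails κ code n (oracle N) φ := by
  classical
  have hn0 : n ≠ numN κ 0 := by
    rw [G.zero_lt_iff]
    filter_upwards [hn, G.le_n 1] with k h1 h2
    omega
  obtain ⟨T, hT, hrel, hfn⟩ := G.exists_isBinaryCode κ code hn0 (XN := oracle N) (X := G.A)
    (fun u => G.mem_iff) fun f a => by
      obtain ⟨c, hc⟩ := G.exists_value hc hn f (hf f) a
      exact ⟨c, hc.mono fun k h => h.2.1⟩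
  refine ⟨T, hT, fun ⟨w, i, hw⟩ => ?_⟩
  have hlt (u : below n) : ∀ᶠ k in (G.U : Filter ℕ), G.rep u k < G.n k := by
    filter_upwards [G.lt_iff.1 u.2, hn] with k h1 h2
    rwa [h2] at h1
  have hR {r : ℕ} (R : L.Relations r) (a : Fin r → below n) : T.RelMap R a ↔
      ∀ᶠ k in (G.U : Filter ℕ), S.RelMap R (G.e k ∘ G.reps (fun i => (a i : N)) k) := by
    rw [hrel]
    refine eventually_congr ?_
    filter_upwards [eventually_all.2 fun i => hlt (a i)] with k h1
    exact relQ_mem_oracleOf hc h1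
  have hlit (j : Fin φ.J) : ∀ᶠ k in (G.U : Filter ℕ), (PartialStr.ofTotal S).VerifiesLit
      (G.e k ∘ G.reps (fun i => (w i : N)) k) (φ.lit i j) := by
    have h := hw j
    generalize φ.lit i j = lit at h ⊢
    cases lit with
    | rel R u =>
      have h1 := (hR R (w ∘ u)).1 (of_decide_eq_true (Option.some.inj h))
      filter_upwards [h1] with k hk
      exact congrArg some (decide_eq_true hk)
    | nrel R u =>
      have h1 := (not_congr (hR R (w ∘ u))).1 (of_decide_eq_false (Option.some.inj h))
      rw [← Ultrafilter.eventually_not] at h1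
      filter_upwards [h1] with k hk
      exact congrArg some (decide_eq_false hk)
    | fn f u v =>
      have h1 : T.funMap f (w ∘ u) = w v := Option.some.inj h
      obtain ⟨c, hc⟩ := G.exists_value hc hn f (hf f) (w ∘ u)
      filter_upwards [hfn f (w ∘ u), hc, hn] with k h2 h3 h4
      refine congrArg some (h3.2.2.trans (congrArg (G.e k) ?_))
      rw [h1, codedFn, ← h3.2.1, h4, min_eq_left (Nat.le_sub_one_of_lt h3.1)] at h2
      exact h2.symm
    | eq u v =>
      have h1 : w u = w v := h
      refine Eventually.of_forall fun k => ?_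
      change G.e k (G.rep (w u) k) = G.e k (G.rep (w v) k)
      rw [h1]
    | ne u v =>
      have h1 : (w u : N) ≠ w v := fun h' => h (Subtype.ext h')
      filter_upwards [G.ne_iff.1 h1, hlt (w u), hlt (w v)] with k h2 h3 h4
      exact fun h' => h2 (G.e_inj k h3 h4 h')
  obtain ⟨k, hk⟩ := (eventually_all.2 hlit).exists
  exact hφ ⟨_, i, hk⟩

/-! ## The structures coded by definable oracles -/

theorem mem_zeroSet_iff [PV.incl.IsExpansionOn N] {k : ℕ} (f : PVα.Functions (k + 1)) (a : Fin k → N) (u : N) :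
    u ∈ zeroSet κ f a ↔ ∀ᶠ i in (G.U : Filter ℕ), G.rep u i ∈ zeroNat f (G.A i) (G.reps a i) := by
  rw [zeroSet, Set.mem_ofPred_eq, G.eq_iff]
  refine eventually_congr ?_
  filter_upwards [G.rep_fn f (Fin.cons u a : Fin (k + 1) → N), G.rep_num κ 0] with i h1 h2
  rw [h1, h2, zeroNat, Set.mem_ofPred_eq, ← reps_cons]
  rfl

end GenericModel

variable {K : FirstOrder.Language.{0, 0}}

/-- To decide the bits coding the value of a function. -/
theorem exists_req_bitsOf (hc : Function.Injective code) [Fintype L.Symbols] (S : L.Structure B)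
    (g : ℕ → ℕ) (κ : BasicSymbols) (code' : K.Symbols → ℕ) {l r : ℕ} (f : PVα.Functions (l + 1))
    (h : K.Functions r) : ∃ ρ : Req S g, ∀ {N : Type} [PV.Structure N] [PVα.Structure N]
      [PV.incl.IsExpansionOn N] (G : GenericModel code S N), G.Meets ρ →
      ∀ (m : N) (a : Fin l → N) (b : Fin r → N), ∃ c : N, ∀ᶠ k in (G.U : Filter ℕ),
        G.rep c k = bitsOf code' (G.rep m k) (zeroNat f (G.A k) (G.reps a k)) h (G.reps b k) := by
  obtain ⟨p, hp⟩ := bitsOf_qc code' κ f h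
  refine ⟨.decide S g code (l + 1) r (fun A v => bitsOf code' (v (.inl 0))
    (zeroNat f A fun i => v (.inl i.succ)) h (v ∘ Sum.inr)) p fun v => (hp _ _ _).mono
      (p.eval_mono_nat ?_), fun {N} _ _ _ G hG m a b => ?_⟩
  · simp [sz, Fintype.sum_sum_type, Fin.sum_univ_succ]
  · refine G.exists_rep_of_meets_decide hc hG
      (Sum.elim (Fin.cons m a : Fin (l + 1) → N) b) ?_
    refine (G.small m).mono (Eventually.of_forall fun k => ?_)
    exact bitsOf_size_le _ _ _ _ _

theorem exists_allDefinableModel [Infinite B] [Fintype L.Symbols] (hc : Function.Injective code)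
    {g : ℕ → ℕ} (hL : IsLarge S g) (hg : Monotone g) (κ : BasicSymbols) [Fintype K.Symbols]
    (code' : K.Symbols → ℕ) {φ : BasicSentence (K.sum PV)} (hφ : IsFinitaryPrinciple φ)
    (hweak : IsWeak φ) : ∃ C : Set (Req S g), C.Countable ∧ ∀ {N : Type} [PV.Structure N]
      [PVα.Structure N] [PV.incl.IsExpansionOn N] (G : GenericModel code S N),
      (∀ ρ ∈ C, G.Meets ρ) → AllDefinableModel κ (N := N) code' φ := by
  have : Countable K.Symbols := inferInstance
  have hK (r : ℕ) : Countable (K.Functions r) :=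
    (show Function.Injective (fun f : K.Functions r => (.inl ⟨r, f⟩ : K.Symbols)) from
      fun f f' h => by simpa using h).countable
  choose ρ hρ using fun s : Σ l r, PVα.Functions (l + 1) × K.Functions r =>
    exists_req_bitsOf hc S g κ code' s.2.2.1 s.2.2.2
  let ρ' : (Σ l, PVα.Functions (l + 1)) → Req S g := fun s =>
    .verify S g code κ hc hL hg code' hφ hweak s.2
  refine ⟨Set.range ρ ∪ Set.range ρ', (Set.countable_range _).union (Set.countable_range _),
    fun {N} _ _ _ G hG m hm l f a => ?_⟩
  obtain ⟨T, hT, hrel, hfn⟩ := G.exists_isBinaryCode κ code' hm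
    (fun u => G.mem_zeroSet_iff κ f a u) fun {r} h b =>
      hρ ⟨l, r, f, h⟩ G (hG _ (.inl ⟨_, rfl⟩)) m a fun i => (b i : N)
  obtain ⟨j, s, hP, hs⟩ := hG (ρ' ⟨l, f⟩) (.inr ⟨_, rfl⟩)
    (Sum.elim (Fin.cons m a : Fin (l + 1) → N) Fin.elim0)
  have h1 : ∀ᶠ k in (G.U : Filter ℕ), ∃ i : Fin φ.I, (∀ j < φ.vars, s k j < G.rep m k) ∧
      ∀ j, LitTrue code' (G.rep m k) (zeroNat f (G.A k) (G.reps a k)) (fun j => s k j)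
        (φ.lit i j) := by
    filter_upwards [hP, (G.zero_lt_iff κ).1 hm, G.compat hc (j + 1)] with k h1 h2 h3
    obtain ⟨i, h4, h5⟩ := h1 h2
    exact ⟨i, h4, h5 _ h3⟩
  -- The true disjunct may vary with the coordinate; as there are finitely many, one is true almost
  -- everywhere.
  obtain ⟨i, hi⟩ : ∃ i : Fin φ.I, ∀ᶠ k in (G.U : Filter ℕ),
      (∀ j < φ.vars, s k j < G.rep m k) ∧ ∀ j, LitTrue code' (G.rep m k)
        (zeroNat f (G.A k) (G.reps a k)) (fun j => s k j) (φ.lit i j) := by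
    by_contra hno
    rw [not_exists] at hno
    have h2 := eventually_all.2 fun i => Ultrafilter.eventually_not.2 (hno i)
    obtain ⟨k, ⟨i, h3⟩, h4⟩ := (h1.and h2).exists
    exact h4 i h3
  have hw (j : Fin φ.vars) : ∃ w : below m, ∀ᶠ k in (G.U : Filter ℕ), G.rep w k = s k j := by
    obtain ⟨c, hc⟩ := hs j ((G.small m).mono (by
      filter_upwards [hi] with k hk
      exact Nat.size_le_size (hk.1 j j.2).le))
    refine ⟨⟨c, G.lt_iff.2 ?_⟩, hc⟩
    filter_upwards [hi, hc] with k h2 h3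
    rw [h3]
    exact h2.1 j j.2
  choose w hw using hw
  refine ⟨T, hT, w, i, fun j => G.verifiesLit_of_litTrue code' T hrel hfn w _ ?_⟩
  filter_upwards [hi, eventually_all.2 hw] with k h2 h3
  have h4 : G.reps (fun i => (w i : N)) k = fun j : Fin φ.vars => s k j := funext h3
  rw [h4]
  exact h2.2 j

end Models

/-! ## The search formulas -/

theorem realize_up {N : Type} [PVα.Structure N] {β : Type} {m : ℕ} (t : PVα.Term β) (v : β → N) (xs : Fin m → N) :
    (up m t).realize (Sum.elim v xs) = t.realize v := by
  rw [up, Term.realize_relabel, Sum.elim_comp_inl]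

section Realize

variable {N : Type} [PV.Structure N] [PVα.Structure N] [PV.incl.IsExpansionOn N]
  (κ : BasicSymbols) {β : Type}

theorem realize_numT (j : ℕ) {γ : Type} (w : γ → N) : (numT κ j).realize w = numN κ j := by
  rw [numT, Term.realize_func, LHom.map_onFunction, numN]
  exact congrArg _ (Subsingleton.elim _ _)

theorem realize_lenT {γ : Type} (t : PVα.Term γ) (w : γ → N) :
    (lenT κ t).realize w = Structure.funMap κ.len ![t.realize w] := by
  rw [lenT, Term.realize_functions_apply₁, LHom.map_onFunction]

theorem realize_predT {γ : Type} (t : PVα.Term γ) (w : γ → N) :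
    (predT κ t).realize w = Structure.funMap κ.pred ![t.realize w] := by
  rw [predT, Term.realize_functions_apply₁, LHom.map_onFunction]

theorem realize_bitT {γ : Type} (i t : PVα.Term γ) (w : γ → N) :
    (bitT κ i t).realize w = Structure.funMap κ.bit ![i.realize w, t.realize w] := by
  rw [bitT, Term.realize_functions_apply₂, LHom.map_onFunction]

theorem realize_entryT {γ : Type} (t i : PVα.Term γ) (w : γ → N) :
    (entryT κ t i).realize w = Structure.funMap κ.entry ![t.realize w, i.realize w] := by
  rw [entryT, Term.realize_functions_apply₂, LHom.map_onFunction]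

theorem realize_tupT {γ : Type} {k : ℕ} (t : Fin k → PVα.Term γ) (w : γ → N) :
    (tupT κ t).realize w = Structure.funMap (κ.tup k) fun i => (t i).realize w := by
  rw [tupT, Term.realize_func, LHom.map_onFunction]

theorem realize_queryT {r m : ℕ} (c : ℕ) (u : Fin r → PVα.Term β) (i : PVα.Term (β ⊕ Fin m))
    (v : β → N) (xs : Fin m → N) : (queryT κ c u i).realize (Sum.elim v xs) =
      Structure.funMap (κ.tup (r + 2)) (Fin.cons (numN κ c)
        (Fin.snoc (fun j => (u j).realize v) (i.realize (Sum.elim v xs)) : Fin (r + 1) → N) :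
          Fin (r + 2) → N) := by
  rw [queryT, realize_tupT]
  congr 1
  funext j
  refine Fin.cases ?_ (fun j => ?_) j
  · exact realize_numT κ c _
  · simp only [Fin.cons_succ]
    refine Fin.lastCases ?_ (fun j => ?_) j
    · simp
    · simp [realize_up]

theorem realize_graphF {χ : OracleFormula β} {v : β → N} {X : Set N}
    (hχ : ∀ (m : ℕ) (t : PVα.Term (β ⊕ Fin m)) (xs : Fin m → N),
      (χ m t).Realize v xs ↔ t.realize (Sum.elim v xs) ∈ X)
    {r : ℕ} (c : ℕ) (u : Fin r → PVα.Term β) (y x : PVα.Term β) (xs : Fin 0 → N) :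
    let Q : N → Prop := fun i => Structure.funMap (κ.tup (r + 2)) (Fin.cons (numN κ c)
      (Fin.snoc (fun j => (u j).realize v) i : Fin (r + 1) → N) : Fin (r + 2) → N) ∈ X
    let len := Structure.funMap κ.len ![x.realize v]
    let pred := Structure.funMap κ.pred ![x.realize v]
    (graphF κ χ c u y x).Realize v xs ↔
      (ltN (y.realize v) (x.realize v) ∧ ∀ i, ltN i len →
        (Q i ↔ Structure.funMap κ.bit ![i, y.realize v] = numN κ 1)) ∨
      (y.realize v = pred ∧ ∃ i, ltN i len ∧ Q i ∧ Structure.funMap κ.bit ![i, pred] = numN κ 0 ∧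
        ∀ j, ltN j len → ltN i j → (Q j ↔ Structure.funMap κ.bit ![j, pred] = numN κ 1)) := by
  intro Q len pred
  have e1 (i : N) : (Fin.snoc xs i : Fin 1 → N) 0 = i := rfl
  have e2 (i j : N) : (Fin.snoc (Fin.snoc xs i : Fin 1 → N) j : Fin 2 → N) 0 = i := rfl
  have e3 (i j : N) : (Fin.snoc (Fin.snoc xs i : Fin 1 → N) j : Fin 2 → N) 1 = j := rfl
  simp only [graphF, BoundedFormula.realize_sup, BoundedFormula.realize_inf,
    BoundedFormula.realize_all, BoundedFormula.realize_ex, BoundedFormula.realize_imp,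
    BoundedFormula.realize_iff, BoundedFormula.realize_bdEqual, realize_ltF, realize_up,
    realize_lenT, realize_predT, realize_bitT, realize_numT, hχ, realize_queryT,
    Term.realize_var, Sum.elim_inr, e1, e2, e3]
  rfl

end Realize

/-! ### Highest differing digits and graphs of coded functions. -/

section Search

open Filter

/-- The highest position at which the binary digits of two numbers differ. -/
theorem Nat.exists_highest_differing_bit {c v : ℕ} (h : c ≠ v) :
    ∃ i, c.testBit i ≠ v.testBit i ∧ ∀ j, i < j → c.testBit j = v.testBit j := by
  obtain ⟨i, h1, h2⟩ := Nat.exists_most_significant_bit (Nat.xor_ne_zero_iff.2 h)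
  refine ⟨i, fun h' => ?_, fun j hj => ?_⟩
  · simp [Nat.testBit_xor, h'] at h1
  · simpa [Nat.testBit_xor] using h2 j hj

theorem Nat.lt_size_of_testBit_ne {c v i m : ℕ} (h : c.testBit i ≠ v.testBit i)
    (hc : c.size ≤ m) (hv : v.size ≤ m) : i < m := by
  by_contra hi
  rw [not_lt] at hi
  exact h ((Nat.testBit_lt_two_pow (Nat.size_le.1 (hc.trans hi))).trans
    (Nat.testBit_lt_two_pow (Nat.size_le.1 (hv.trans hi))).symm)

variable {L : FirstOrder.Language.{0, 0}} {code : L.Symbols → ℕ} {B : Type} {S : L.Structure B}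

-- The position is a functional that ignores the oracle, so deciding it needs no query; being
-- bounded by a length it is small, and hence represented in `N`.
open Classical in
theorem exists_req_differing_bit [Fintype L.Symbols] (hc : Function.Injective code)
    (S : L.Structure B) (g : ℕ → ℕ) : ∃ ρ : Req S g, ∀ {N : Type} [PV.Structure N]
      [PVα.Structure N] (G : GenericModel code S N), G.Meets ρ → ∀ {c v : N}, c ≠ v →
      ∃ i : N, ∀ᶠ k in (G.U : Filter ℕ),
        (G.rep c k).testBit (G.rep i k) ≠ (G.rep v k).testBit (G.rep i k) ∧
        ∀ j, G.rep i k < j → (G.rep c k).testBit j = (G.rep v k).testBit j := by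
  let d : ℕ → ℕ → ℕ := fun c v =>
    if h : c ≠ v then (Nat.exists_highest_differing_bit h).choose else 0
  refine ⟨.decide S g code 2 0 (fun _ w => d (w (.inl 0)) (w (.inl 1))) 0
    (fun w => QC.const _ _), fun {N} _ _ G hG c v hcv => ?_⟩
  have hd : ∀ᶠ k in (G.U : Filter ℕ),
      (G.rep c k).testBit (d (G.rep c k) (G.rep v k)) ≠
        (G.rep v k).testBit (d (G.rep c k) (G.rep v k)) ∧
      ∀ j, d (G.rep c k) (G.rep v k) < j → (G.rep c k).testBit j = (G.rep v k).testBit j := by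
    filter_upwards [G.ne_iff.1 hcv] with k hk
    have : d (G.rep c k) (G.rep v k) = (Nat.exists_highest_differing_bit hk).choose := dif_pos hk
    rw [this]
    exact (Nat.exists_highest_differing_bit hk).choose_spec
  obtain ⟨i, hi⟩ := G.exists_rep_of_meets_decide hc hG (Sum.elim ![c, v] Fin.elim0)
    (((G.small c).add G.le_n (G.small v)).mono (by
      filter_upwards [hd] with k hk
      exact (Nat.size_le_self _).trans (Nat.lt_size_of_testBit_ne hk.1 (Nat.le_add_right _ _)
        (Nat.le_add_left _ _)).le))
  refine ⟨i, ?_⟩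
  filter_upwards [hi, hd] with k h1 h2
  have h3 : G.rep i k = d (G.rep c k) (G.rep v k) := h1
  rw [h3]
  exact h2

variable {N : Type} [PV.Structure N] [PVα.Structure N] [PV.incl.IsExpansionOn N]

namespace GenericModel

variable (G : GenericModel code S N) (κ : BasicSymbols)

theorem bit_eq_zero_iff {i a : N} : Structure.funMap κ.bit ![i, a] = numN κ 0 ↔
    ∀ᶠ k in (G.U : Filter ℕ), (G.rep a k).testBit (G.rep i k) = false := by
  rw [G.eq_iff]
  refine eventually_congr ?_
  filter_upwards [G.rep_bit κ i a, G.rep_num κ 0] with k h1 h2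
  rw [h1, h2, Bool.toNat_eq_zero]

/-- Every two different elements have a highest position at which their digits differ. -/
def HasDifferingBits : Prop := ∀ {c v : N}, c ≠ v → ∃ i : N, ∀ᶠ k in (G.U : Filter ℕ),
  (G.rep c k).testBit (G.rep i k) ≠ (G.rep v k).testBit (G.rep i k) ∧
  ∀ j, G.rep i k < j → (G.rep c k).testBit j = (G.rep v k).testBit j

variable {G}

/-- The number `c` has the digits `Q`. The first alternative identifies `v` with `c` digit by digit.
The second expresses that `c` exceeds the predecessor of `x`, by the highest digit in which they
differ: exactly the case in which the value is truncated. -/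
theorem HasDifferingBits.graph_iff (hG : G.HasDifferingBits) {x c v val : N}
    (hx : x ≠ numN κ 0)
    (hlen : ¬ ltN (Structure.funMap κ.len ![x]) (Structure.funMap κ.len ![c]))
    (hval : (ltN c x ∧ val = c) ∨ (¬ ltN c x ∧ val = Structure.funMap κ.pred ![x]))
    {Q : N → Prop} (hQ : ∀ i, ltN i (Structure.funMap κ.len ![x]) →
      (Structure.funMap κ.bit ![i, c] = numN κ 1 ↔ Q i)) :
    ((ltN v x ∧ ∀ i, ltN i (Structure.funMap κ.len ![x]) →
        (Q i ↔ Structure.funMap κ.bit ![i, v] = numN κ 1)) ∨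
      (v = Structure.funMap κ.pred ![x] ∧ ∃ i, ltN i (Structure.funMap κ.len ![x]) ∧ Q i ∧
        Structure.funMap κ.bit ![i, Structure.funMap κ.pred ![x] ] = numN κ 0 ∧
        ∀ j, ltN j (Structure.funMap κ.len ![x]) → ltN i j →
          (Q j ↔ Structure.funMap κ.bit ![j, Structure.funMap κ.pred ![x] ] = numN κ 1))) ↔
      val = v := by
  have hx0 := (G.zero_lt_iff κ).1 hx
  have hcs : ∀ᶠ k in (G.U : Filter ℕ), (G.rep c k).size ≤ (G.rep x k).size := by
    rw [G.lt_iff, ← Ultrafilter.eventually_not] at hlen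
    filter_upwards [hlen, G.rep_len κ x, G.rep_len κ c] with k h1 h2 h3
    rw [h2, h3] at h1
    exact not_lt.1 h1
  have hpred := G.rep_pred κ x
  have hltlen {i v : N} (hv : ∀ᶠ k in (G.U : Filter ℕ), G.rep v k < G.rep x k)
      (hi : ∀ᶠ k in (G.U : Filter ℕ),
        (G.rep c k).testBit (G.rep i k) ≠ (G.rep v k).testBit (G.rep i k)) :
      ltN i (Structure.funMap κ.len ![x]) := by
    rw [G.lt_iff]
    filter_upwards [hv, hi, hcs, G.rep_len κ x] with k h1 h2 h3 h4
    rw [h4]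
    exact Nat.lt_size_of_testBit_ne h2 h3 (Nat.size_le_size h1.le)
  have hpx : ∀ᶠ k in (G.U : Filter ℕ), G.rep (Structure.funMap κ.pred ![x]) k < G.rep x k := by
    filter_upwards [hpred, hx0] with k h1 h2
    omega
  constructor
  · rintro (⟨hv, hb⟩ | ⟨rfl, i, hi, hQi, hbi, hb⟩)
    · have hcv : c = v := by
        by_contra hne
        obtain ⟨i, hi⟩ := hG hne
        have hil := hltlen (G.lt_iff.1 hv) (hi.mono fun k h => h.1)
        have h1 := (hQ i hil).trans (hb i hil)
        rw [G.bit_eq_one_iff, G.bit_eq_one_iff] at h1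
        by_cases h2 : ∀ᶠ k in (G.U : Filter ℕ), (G.rep c k).testBit (G.rep i k) = true
        · obtain ⟨k, h3, h4, h5⟩ := (h2.and ((h1.1 h2).and hi)).exists
          exact h5.1 (h3.trans h4.symm)
        · refine h2 (h1.2 ?_)
          rw [← Ultrafilter.eventually_not] at h2
          filter_upwards [h2, hi] with k h3 h4
          have := h4.1
          rw [Bool.not_eq_true] at h3
          rw [h3] at this
          simpa using this.symm
      subst hcv
      exact (hval.resolve_right fun h => h.1 hv).2
    · refine (hval.resolve_left fun h => ?_).2
      have hci := (hQ i hi).2 hQi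
      rw [G.bit_eq_one_iff] at hci
      rw [G.bit_eq_zero_iff] at hbi
      have hne : c ≠ Structure.funMap κ.pred ![x] := by
        rw [G.ne_iff]
        filter_upwards [hci, hbi] with k h1 h2 h3
        rw [h3, h2] at h1
        cases h1
      -- Suppose `c < x`. At the highest difference `j` the digit of `c` is then `0` and that of the
      -- predecessor is `1`. The opposite digits at `i` exclude `j = i`, and they differ, which
      -- excludes `j < i`; above `i`, the digits agree by assumption.
      obtain ⟨j, hj⟩ := hG hne
      have hjl := hltlen hpx (hj.mono fun k h => h.1)
      have h1 : ∀ᶠ k in (G.U : Filter ℕ), (G.rep c k).testBit (G.rep j k) = false ∧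
          (G.rep (Structure.funMap κ.pred ![x]) k).testBit (G.rep j k) = true := by
        filter_upwards [hj, G.lt_iff.1 h.1, hpred, G.ne_iff.1 hne] with k h1 h2 h3 h4
        have h5 : ¬ (G.rep (Structure.funMap κ.pred ![x]) k < G.rep c k) := by omega
        cases h6 : (G.rep c k).testBit (G.rep j k) <;>
          cases h7 : (G.rep (Structure.funMap κ.pred ![x]) k).testBit (G.rep j k)
        · exact absurd (h6.trans h7.symm) h1.1
        · exact ⟨rfl, rfl⟩
        · exact absurd (Nat.lt_of_testBit _ h7 h6 fun j hj => (h1.2 j hj).symm) h5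
        · exact absurd (h6.trans h7.symm) h1.1
      have hij : ltN i j := by
        rw [G.lt_iff]
        filter_upwards [hj, h1, hci, hbi] with k h2 h3 h4 h5
        by_contra hle
        rcases (not_lt.1 hle).eq_or_lt with h6 | h6
        · rw [h6, h4] at h3
          cases h3.1
        · have := h2.2 _ h6
          rw [h4, h5] at this
          cases this
      have h2 := (hQ j hjl).2 ((hb j hjl hij).2 (by
        rw [G.bit_eq_one_iff]
        exact h1.mono fun k h => h.2))
      rw [G.bit_eq_one_iff] at h2
      obtain ⟨k, h3, h4⟩ := (h2.and h1).exists
      rw [h4.1] at h3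
      cases h3
  · rintro rfl
    rcases hval with ⟨hlt, rfl⟩ | ⟨hlt, rfl⟩
    · exact .inl ⟨hlt, fun i hi => (hQ i hi).symm⟩
    · refine .inr ⟨rfl, ?_⟩
      rw [G.lt_iff, ← Ultrafilter.eventually_not] at hlt
      have hne : c ≠ Structure.funMap κ.pred ![x] := by
        rw [G.ne_iff]
        filter_upwards [hlt, hpx] with k h1 h2
        omega
      obtain ⟨i, hi⟩ := hG hne
      have hil := hltlen hpx (hi.mono fun k h => h.1)
      have h1 : ∀ᶠ k in (G.U : Filter ℕ), (G.rep c k).testBit (G.rep i k) = true ∧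
          (G.rep (Structure.funMap κ.pred ![x]) k).testBit (G.rep i k) = false := by
        filter_upwards [hi, hlt, hpx] with k h1 h2 h3
        have h5 : ¬ (G.rep c k < G.rep (Structure.funMap κ.pred ![x]) k) := by omega
        cases h6 : (G.rep c k).testBit (G.rep i k) <;>
          cases h7 : (G.rep (Structure.funMap κ.pred ![x]) k).testBit (G.rep i k)
        · exact absurd (h6.trans h7.symm) h1.1
        · exact absurd (Nat.lt_of_testBit _ h6 h7 fun j hj => (h1.2 j hj)) h5
        · exact ⟨rfl, rfl⟩
        · exact absurd (h6.trans h7.symm) h1.1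
      refine ⟨i, hil, (hQ i hil).1 ?_, ?_, fun j hjl hij => (hQ j hjl).symm.trans ?_⟩
      · rw [G.bit_eq_one_iff]
        exact h1.mono fun k h => h.1
      · rw [G.bit_eq_zero_iff]
        exact h1.mono fun k h => h.2
      · rw [G.bit_eq_one_iff, G.bit_eq_one_iff]
        refine eventually_congr ?_
        filter_upwards [hi, G.lt_iff.1 hij] with k h2 h3
        rw [h2.2 _ h3]

end GenericModel

end Search

section Independence

open Filter

variable {L : FirstOrder.Language.{0, 0}} {code : L.Symbols → ℕ} {B : Type} {S : L.Structure B}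
  {N : Type} [PV.Structure N] [PVα.Structure N] [PV.incl.IsExpansionOn N]
  {G : GenericModel code S N} (κ : BasicSymbols) {β : Type} {K : FirstOrder.Language.{0, 0}}
  {code' : K.Symbols → ℕ}

/-! ## Truth of the search formulas -/

namespace GenericModel.HasDifferingBits

theorem realize_litF (hG : G.HasDifferingBits) {χ : OracleFormula β} {v : β → N} {X : Set N}
    (hχ : ∀ (m : ℕ) (t : PVα.Term (β ⊕ Fin m)) (xs : Fin m → N),
      (χ m t).Realize v xs ↔ t.realize (Sum.elim v xs) ∈ X) {x y : β} (hx : v x ≠ numN κ 0)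
    {T : K.Structure (below (v x))} (hT : IsBinaryCode κ code' (v x) X T) {l : ℕ}
    {w : Fin l → below (v x)} (hw : ∀ i, (w i : N) = Structure.funMap κ.entry ![v y, numN κ i])
    (lit : BasicLiteral (K.sum PV) l) (xs : Fin 0 → N) :
    (litF κ code' χ x y lit).Realize v xs ↔
      (PartialStr.withPV inferInstance (below (v x)) (PartialStr.ofTotal T)).VerifiesLit w lit := by
  classical
  have hvar (i : Fin l) : (entryT κ (Term.var y) (numT κ i)).realize v = (w i : N) := by
    rw [realize_entryT, realize_numT, hw]
    rfl
  have hrel {r : ℕ} (R : K.Relations r) (u : Fin r → Fin l) :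
      (χ 0 (tupT κ (Fin.cons (numT κ (code' (.inr ⟨r, R⟩)))
        (fun i => up 0 (entryT κ (Term.var y) (numT κ (u i)))) :
          Fin (r + 1) → PVα.Term (β ⊕ Fin 0)))).Realize v xs ↔ T.RelMap R (w ∘ u) := by
    rw [hχ, realize_tupT, hT.1 r R]
    refine iff_of_eq (congrArg (· ∈ X) (congrArg _ ?_))
    funext j
    refine Fin.cases ?_ (fun j => ?_) j
    · exact realize_numT κ _ _
    · simp only [Fin.cons_succ]
      rw [realize_up, hvar]
      rfl
  have hpvrel {r : ℕ} (R : PV.Relations r) (u : Fin r → Fin l) :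
      (Relations.boundedFormula (PV.incl.onRelation R)
        (fun i => up 0 (entryT κ (Term.var y) (numT κ (u i))))).Realize v xs ↔
      Structure.RelMap R fun i => (w (u i) : N) := by
    rw [BoundedFormula.realize_rel, LHom.map_onRelation]
    simp only [realize_up, hvar]
  cases lit with
  | rel R u =>
    rcases R with R | R
    · refine (hrel R u).trans ⟨fun h => congrArg some (decide_eq_true h), fun h => ?_⟩
      exact of_decide_eq_true (Option.some.inj h)
    · refine (hpvrel R u).trans ⟨fun h => congrArg some (decide_eq_true h), fun h => ?_⟩
      exact of_decide_eq_true (Option.some.inj h)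
  | nrel R u =>
    rcases R with R | R
    · refine (not_congr (hrel R u)).trans ⟨fun h => congrArg some (decide_eq_false h), fun h => ?_⟩
      exact of_decide_eq_false (Option.some.inj h)
    · refine (not_congr (hpvrel R u)).trans
        ⟨fun h => congrArg some (decide_eq_false h), fun h => ?_⟩
      exact of_decide_eq_false (Option.some.inj h)
  | @fn r f u z =>
    rcases f with f | f
    · obtain ⟨c, hlen, hQ, hval⟩ := hT.2 r f (w ∘ u)
      refine (realize_graphF κ hχ _ _ _ _ xs).trans ?_
      simp only [hvar]
      refine (hG.graph_iff κ hx hlen hval hQ).trans ?_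
      constructor
      · exact fun h => congrArg some (Subtype.ext h)
      · exact fun h => congrArg Subtype.val (Option.some.inj h)
    · have h1 : (litF κ code' χ x y (.fn (.inr f : (K.sum PV).Functions r) u z)).Realize v xs ↔
          Structure.funMap f (fun i => (w (u i) : N)) = w z := by
        change BoundedFormula.Realize (Term.bdEqual _ _) v xs ↔ _
        rw [BoundedFormula.realize_bdEqual, Term.realize_func, LHom.map_onFunction, realize_up, hvar]
        simp only [realize_up, hvar]
      refine h1.trans ?_
      change _ ↔ (PartialStr.induced inferInstance (below (v x))).fn f (w ∘ u) = some (w z)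
      constructor
      · intro h
        have h2 : Structure.funMap f (fun i => ((w ∘ u) i : N)) ∈ below (v x) := by
          change Structure.funMap f (fun i => (w (u i) : N)) ∈ _
          rw [h]
          exact (w z).2
        exact (dif_pos h2).trans (congrArg some (Subtype.ext h))
      · intro h
        by_cases h2 : Structure.funMap f (fun i => ((w ∘ u) i : N)) ∈ below (v x)
        · exact congrArg Subtype.val (Option.some.inj ((dif_pos h2).symm.trans h))
        · cases (dif_neg h2).symm.trans h
  | eq u z =>
    have h1 : (litF κ code' χ x y (.eq u z : BasicLiteral (K.sum PV) l)).Realize v xs ↔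
        (w u : N) = w z := by
      change BoundedFormula.Realize (Term.bdEqual _ _) v xs ↔ _
      rw [BoundedFormula.realize_bdEqual, realize_up, realize_up, hvar, hvar]
    exact h1.trans Subtype.ext_iff.symm
  | ne u z =>
    have h1 : (litF κ code' χ x y (.ne u z : BasicLiteral (K.sum PV) l)).Realize v xs ↔
        (w u : N) ≠ w z := by
      change (BoundedFormula.not (Term.bdEqual _ _)).Realize v xs ↔ _
      rw [BoundedFormula.realize_not, BoundedFormula.realize_bdEqual, realize_up, realize_up, hvar,
        hvar]
    exact h1.trans (not_congr Subtype.ext_iff.symm)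

/-- The search formula expresses that the entries of `y` are a solution. -/
theorem realize_searchF (hG : G.HasDifferingBits) {χ : OracleFormula β} {v : β → N} {X : Set N}
    (hχ : ∀ (m : ℕ) (t : PVα.Term (β ⊕ Fin m)) (xs : Fin m → N),
      (χ m t).Realize v xs ↔ t.realize (Sum.elim v xs) ∈ X) {x y : β} (hx : v x ≠ numN κ 0)
    {T : K.Structure (below (v x))} (hT : IsBinaryCode κ code' (v x) X T)
    (φ : BasicSentence (K.sum PV)) : (searchF κ code' φ χ x y).Realize v ↔
      ∃ w : Fin φ.vars → below (v x),
        (∀ i, (w i : N) = Structure.funMap κ.entry ![v y, numN κ i]) ∧ ∃ i, ∀ j,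
        (PartialStr.withPV inferInstance (below (v x)) (PartialStr.ofTotal T)).VerifiesLit w
          (φ.lit i j) := by
  have h0 : ltN (numN κ 0) (v x) := by
    rw [G.lt_iff]
    filter_upwards [(G.zero_lt_iff κ).1 hx, G.rep_num κ 0] with k h1 h2
    rwa [h2]
  rw [searchF, Formula.Realize, BoundedFormula.realize_imp, realize_ltF, realize_numT, realize_up,
    BoundedFormula.realize_inf, BoundedFormula.realize_iInf, BoundedFormula.realize_iSup]
  simp only [BoundedFormula.realize_iInf, realize_ltF, realize_up, realize_entryT, realize_numT,
    Term.realize_var]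
  constructor
  · intro h
    obtain ⟨h1, i, h2⟩ := h h0
    exact ⟨fun i => ⟨_, h1 i⟩, fun i => rfl, i, fun j =>
      (hG.realize_litF κ hχ hx hT (fun _ => rfl) _ _).1 (h2 j)⟩
  · rintro ⟨w, hw, i, h⟩ -
    refine ⟨fun j => ?_, i, fun j => (hG.realize_litF κ hχ hx hT hw _ _).2 (h j)⟩
    rw [← hw]
    exact (w j).2

/-- In a generic model in which a principle holds in all definable structures, the corresponding
search problems have solutions. -/
theorem realize_substInstances (hG : G.HasDifferingBits) {φ : BasicSentence (K.sum PV)}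
    (h : AllDefinableModel κ (N := N) code' φ) : N ⊨ substInstances κ code' φ := by
  rw [Theory.model_iff]
  rintro σ ⟨k, f, rfl⟩
  rw [Sentence.Realize, Formula.realize_iAlls]
  intro i
  rw [Formula.realize_iExs]
  by_cases hx : i none = numN κ 0
  · refine ⟨fun _ => i none, ?_⟩
    rw [searchF, Formula.Realize, BoundedFormula.realize_imp, realize_ltF, realize_numT, realize_up]
    intro h0
    rw [G.lt_iff] at h0
    obtain ⟨j, h1, h2⟩ := (h0.and (G.eq_iff.1 hx)).exists
    exact absurd h2.symm h1.ne
  · obtain ⟨T, hT, w, I, hw⟩ := h (i none) hx k f fun j => i (some j)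
    -- The code of the verifying assignment solves the search problem.
    refine ⟨fun _ => Structure.funMap (κ.tup φ.vars) fun j => (w j : N),
      (hG.realize_searchF κ (v := Sum.elim (fun a => Sum.elim default i a) fun _ : Unit =>
        Structure.funMap (κ.tup φ.vars) fun j => (w j : N)) (x := Sum.inl (Sum.inr none))
        (fun m t xs => ?_) hx hT φ).2 ⟨w, fun j => ?_, I, hw⟩⟩
    · rw [substOracle, BoundedFormula.realize_bdEqual, Term.realize_func, realize_numT, zeroSet,
        Set.mem_ofPred_eq]
      refine iff_of_eq (congrArg (· = numN κ 0) (congrArg _ ?_))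
      funext j
      refine Fin.cases ?_ (fun j => ?_) j <;> simp
    · refine G.eq_of_rep ?_
      filter_upwards [G.rep_entry κ (Structure.funMap (κ.tup φ.vars) fun j => (w j : N))
        (numN κ j), G.rep_num κ j, G.rep_tup κ fun j => (w j : N)] with k h1 h2 h3
      refine Eq.trans ?_ h1.symm
      rw [h2, h3, seqEntry_seqCode]
      simp [GenericModel.reps]

/-- The model `N` with the value `n` refutes the entailment: the substitution instances hold by the
definable structures, while a solution at `n` would verify `φ` in the structure coded by the oracle.
-/
theorem not_isConsequence (hG : G.HasDifferingBits) {n : N} (hn : n ≠ numN κ 0) {Th : PVα.Theory}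
    (hTh : N ⊨ Th) {φ : BasicSentence L} {code₀ : L.Symbols → ℕ}
    (hφ : BFails κ code₀ n (oracle N) φ)
    {φ' : BasicSentence (K.sum PV)} (h : AllDefinableModel κ (N := N) code' φ') :
    IsIndependent κ Th code₀ (φ.map (LHom.sumInl : L →ᴸ L.sum PV)) code' φ' := by
  intro hcons
  have hmod : N ⊨ Th ∪ substInstances κ code' φ' := by
    rw [Theory.model_union_iff]
    exact ⟨hTh, hG.realize_substInstances κ h⟩
  have : Nonempty N := ⟨n⟩
  have h1 := hcons (Theory.ModelType.of _ N) (fun _ => n) default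
  obtain ⟨T, hT, hno⟩ := hφ
  have h2 : (Formula.iExs Unit (searchF κ code₀ (φ.map (LHom.sumInl : L →ᴸ L.sum PV))
    alphaOracle (Sum.inl ()) (Sum.inr ())) : PVα.Formula Unit).Realize (fun _ => n) := by
    rw [Formula.Realize]
    exact (iff_of_eq (congrArg _ (Subsingleton.elim _ _))).mp h1
  rw [Formula.realize_iExs] at h2
  obtain ⟨y, hy⟩ := h2
  rw [hG.realize_searchF κ (X := oracle N) (fun m t xs => ?_) hn hT] at hy
  · obtain ⟨w, -, i, hw⟩ := hy
    refine hno ⟨w, i, fun j => ?_⟩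
    have := hw j
    have e : (φ.map (LHom.sumInl : L →ᴸ L.sum PV)).lit i j =
      (φ.lit i j).map LHom.sumInl := rfl
    rw [e] at this
    generalize φ.lit i j = lit at this ⊢
    cases lit <;> exact this
  · rw [alphaOracle, BoundedFormula.realize_rel₁]
    rfl

end GenericModel.HasDifferingBits

end Independence

/-! ### Assembly of the countermodel. -/

section Main

open Filter

theorem IsLarge.mono {K : FirstOrder.Language.{0, 0}} {B : Type} {S : K.Structure B}
    {g g' : ℕ → ℕ} (h : IsLarge S g) (hg : ∀ n, g n ≤ g' n) : IsLarge S g' := fun A₀ hA P hP => by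
  obtain ⟨B₀, hB, ⟨V, hV, hcard, hf⟩, he⟩ := h A₀ hA P hP
  exact ⟨B₀, hB, ⟨V, hV, hcard.trans (hg _), hf⟩, he⟩

/-- Functions bounded by `n ^ o(1)` have monotone bounds of this kind. -/
theorem exists_monotone_bound {g : ℕ → ℕ}
    (hg : ∀ ε : ℝ, 0 < ε → ∀ᶠ n : ℕ in atTop, (g n : ℝ) ≤ (n : ℝ) ^ ε) :
    ∃ g' : ℕ → ℕ, Monotone g' ∧ (∀ n, g n ≤ g' n) ∧
      ∀ ε : ℝ, 0 < ε → ∀ᶠ n : ℕ in atTop, (g' n : ℝ) ≤ (n : ℝ) ^ ε := by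
  refine ⟨fun n => (Finset.range (n + 1)).sup g, fun a b hab => Finset.sup_mono
    (Finset.range_subset_range.2 (by omega)), fun n => Finset.le_sup (by simp), fun ε hε => ?_⟩
  obtain ⟨n₀, h₀⟩ := eventually_atTop.1 (hg ε hε)
  have h1 : ∀ᶠ n : ℕ in atTop, (((Finset.range n₀).sup g : ℕ) : ℝ) ≤ (n : ℝ) ^ ε :=
    ((tendsto_rpow_atTop hε).comp tendsto_natCast_atTop_atTop).eventually_ge_atTop _
  filter_upwards [h1] with n hn
  obtain ⟨m, hm, he⟩ := Finset.exists_mem_eq_sup (Finset.range (n + 1)) ⟨0, by simp⟩ g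
  rw [he]
  rcases lt_or_ge m n₀ with hlt | hge
  · exact le_trans (by exact_mod_cast Finset.le_sup (Finset.mem_range.2 hlt)) hn
  · refine (h₀ m hge).trans (Real.rpow_le_rpow (Nat.cast_nonneg _) ?_ hε.le)
    exact_mod_cast Nat.lt_succ_iff.1 (Finset.mem_range.1 hm)

/-- One generic model serves all parts. The countable family of requirements collects those for the
theory, for the weak principle, for function values and for highest differing digits. -/
theorem exists_countermodel (κ : BasicSymbols) (L L' : FirstOrder.Language.{0, 0})
    [Fintype L.Symbols] [Fintype L'.Symbols] (code : L.Symbols ↪ ℕ) (code' : L'.Symbols ↪ ℕ)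
    (φ : BasicSentence L) (hφ : IsStrong φ)
    (φ' : BasicSentence (L'.sum PV)) (hφ' : IsFinitaryPrinciple φ') (hweak : IsWeak φ')
    (ψ : PV.Formula (Fin 1)) (hψ : ∀ b : ℕ, ∃ x : ℕ, b ≤ x ∧ ψ.Realize ![x]) :
    ∃ (M : Type) (_ : PV.Structure M) (_ : ℕ ↪ₑ[PV] M) (N : PV.Substructure M)
      (_ : PVα.Structure N) (_ : PV.incl.IsExpansionOn N) (n : N),
      (IsCut N ∧ IsSubexponentialIn N (n : M) ∧ ψ.Realize ![(n : M)] ∧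
        N ⊨ forallT12 κ ∧ n ≠ numN κ 0 ∧
        BFails κ code n (oracle N) φ ∧ AllDefinableModel κ (N := N) code' φ') ∧
      IsIndependent κ (forallT12 κ) code
        (φ.map (FirstOrder.Language.LHom.sumInl : L →ᴸ L.sum PV)) code' φ' := by
  obtain ⟨B, S, g₀, hB, hno, hg₀, hL₀⟩ := hφ
  obtain ⟨g, hmono, hle, hg⟩ := exists_monotone_bound hg₀
  have hL := hL₀.mono hle
  have hc := code.injective
  obtain ⟨C₁, hC₁, h₁⟩ := exists_models_forallT12 hc κ S g
  obtain ⟨C₂, hC₂, h₂⟩ := exists_allDefinableModel hc hL hmono κ code' hφ' hweak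
  obtain ⟨ρ, hρ⟩ := exists_req_differing_bit hc S g
  have : Countable L.Symbols := inferInstance
  have : Countable (Σ r, L.Functions r) := (Sum.inl_injective (β := Σ r, L.Relations r)).countable
  have hC₃ := Set.countable_range fun f : Σ r, L.Functions r => Req.value S g f.2
  obtain ⟨M, sM, emb, N, sN, hexp, n, G, hcut, hsub, hψn, hn, hG⟩ :=
    exists_genericModel hc S hg (((hC₁.union hC₂).union hC₃).insert ρ) hψ
  have hn0 : n ≠ numN κ 0 := by
    rw [G.zero_lt_iff]
    filter_upwards [hn, G.le_n 1] with k h1 h2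
    omega
  have hT : N ⊨ forallT12 κ := h₁ G fun ρ h => hG ρ (.inr (.inl (.inl h)))
  have hD : AllDefinableModel κ (N := N) code' φ' := h₂ G fun ρ h => hG ρ (.inr (.inl (.inr h)))
  have hF : BFails κ code n (oracle N) φ :=
    G.bFails κ hc hn (fun {r} f => hG _ (.inr (.inr ⟨⟨r, f⟩, rfl⟩))) hno
  have hdb : G.HasDifferingBits := hρ G (hG ρ (.inl rfl))
  exact ⟨M, sM, emb, N, sN, hexp, n, ⟨hcut, hsub, hψn, hT, hn0, hF, hD⟩,
    hdb.not_isConsequence κ hn0 hT hF hD⟩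

end Main

theorem mainTheorem1 (κ : BasicSymbols) (L L' : FirstOrder.Language.{0, 0})
    [Fintype L.Symbols] [Fintype L'.Symbols] (code : L.Symbols ↪ ℕ) (code' : L'.Symbols ↪ ℕ)
    (φ : BasicSentence L) (hφ : IsStrong φ)
    (φ' : BasicSentence (L'.sum PV)) (hφ' : IsFinitaryPrinciple φ') (hweak : IsWeak φ') :
    -- a model of the theory with properties (a) and (b)
    (∃ (N : Type) (_ : PV.Structure N) (_ : PVα.Structure N) (_ : PV.incl.IsExpansionOn N)
        (n : N),
      N ⊨ forallT12 κ ∧ n ≠ numN κ 0 ∧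
      BFails κ code n (oracle N) φ ∧ AllDefinableModel κ (N := N) code' φ') ∧
    -- for a formula `ψ` defining an unbounded set: such a model that is a subexponential cut
    (∀ ψ : PV.Formula (Fin 1), (∀ b : ℕ, ∃ x : ℕ, b ≤ x ∧ ψ.Realize ![x]) →
      ∃ (M : Type) (_ : PV.Structure M) (_ : ℕ ↪ₑ[PV] M) (N : PV.Substructure M)
        (_ : PVα.Structure N) (_ : PV.incl.IsExpansionOn N) (n : N),
        IsCut N ∧ IsSubexponentialIn N (n : M) ∧ ψ.Realize ![(n : M)] ∧
        N ⊨ forallT12 κ ∧ n ≠ numN κ 0 ∧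
        BFails κ code n (oracle N) φ ∧ AllDefinableModel κ (N := N) code' φ') ∧
    -- if `φ` is moreover valid in the finite: independence of the search problems
    (IsFinitaryPrinciple (φ.map (FirstOrder.Language.LHom.sumInl : L →ᴸ L.sum PV)) →
      IsIndependent κ (forallT12 κ) code
        (φ.map (FirstOrder.Language.LHom.sumInl : L →ᴸ L.sum PV)) code' φ') := by
  have core := exists_countermodel κ L L' code code' φ hφ φ' hφ' hweak
  obtain ⟨M, sM, emb, N, sN, hexp, n, ⟨-, -, -, h⟩, hind⟩ :=
    -- Without a prescribed property of `n`, the formula `⊤` is used; it defines an unbounded set.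
    core ⊤ fun b => ⟨b, le_rfl, BoundedFormula.realize_top.2 trivial⟩
  refine ⟨⟨N, inferInstance, sN, hexp, n, h⟩, fun ψ hψ => ?_, fun _ => hind⟩
  obtain ⟨M, sM, emb, N, sN, hexp, n, h, -⟩ := core ψ hψ
  exact ⟨M, sM, emb, N, sN, hexp, n, h⟩
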